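/- Let $\mathbb{K}$ be a field of characteristic zero and let $\mathbf{M}=\mathbf{CDGA}_{\mathbb{K}}^{\le 0}$ be the category of commutative differential graded $\mathbb{K}$-algebras concentrated in non-positive (cohomological) degrees; its weak equivalences are the quasi-isomorphisms, its fibrations are the morphisms that are surjective in strictly negative degrees, and a trivial fibration is a fibration that is a weak equivalence. A morphism $A\to B$ in $\mathbf{M}$ is called flat if the push-out functor $-\amalg_A B$, from objects under $A$ to objects under $B$, preserves pull-back squares of trivial fibrations. Let $\mathcal{C}$ be a direct Reedy category, i.e. a small category with a degree function $\mathrm{Ob}(\mathcal{C})\to\mathbb{N}$ such that every non-identity morphism strictly raises the degree. Let $A$ be a (classical) local Artin $\mathbb{K}$-algebra with residue field $\mathbb{K}$, regarded as an object of $\mathbf{M}$ concentrated in degree $0$, and let $X\colon\mathcal{C}\to\mathbf{M}$ be a diagram. A deformation of $X$ over $A$ is a diagram $X_A\colon \mathcal{C}\to\mathbf{M}$ with a morphism $\Delta A\to X_A$ from the constant diagram and a morphism $X_A\to X$ such that the composite $\Delta A\to X_A\to X$ equals $\Delta A\to\Delta\mathbb{K}\to X$ and, for every $c\in\mathcal{C}$,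 the morphism $A\to X_{A,c}$ is flat and the induced morphism $X_{A,c}\amalg_A\mathbb{K}\to X_c$ is a weak equivalence. It is strict if the latter morphisms are isomorphisms. $\operatorname{Def}_X(A)$ is the quotient of the class of deformations by the equivalence relation generated by $X_A\sim Y_A$ whenever there is a morphism of diagrams $X_A\to Y_A$, compatible with the morphisms from $\Delta A$ and to $X$, that is a weak equivalence at every object of $\mathcal{C}$. $\operatorname{D}_X(A)$ is the class of strict deformations modulo isomorphisms compatible with the morphisms from $\Delta A$ and to $X$. 1. If every $X_c$ is concentrated in degree $0$, then the natural map $\operatorname{D}_X(A)\to\operatorname{Def}_X(A)$, sending the class of a strict deformation to its class as a deformation, is bijective. 2. If $X$ is given by a diagram of ordinary commutative $\mathbb{K}$-algebras placed in degree $0$, then $\operatorname{D}_X(A)$ is the set of classical deformations of $X$ over $A$ up to isomorphism. That is: let a classical deformation be a diagram $X_A$ of commutative $A$-algebras, flat over $A$ in the usual sense, together with a morphism $X_A\to X$ of diagrams of $A$-algebras that induces an isomorphism $X_A\otimes_A\mathbb{K}\to X$, isomorphisms being required to be compatible with the morphisms to $X$. Then every classical deformation, placed in degree $0$, is a strict deformation,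 and this induces a bijection from isomorphism classes of classical deformations to $\operatorname{D}_X(A)$; by 1 the classical deformations therefore agree with the deformations up to equivalence. -/

import Mathlib

open CategoryTheory HomotopicalAlgebra

universe w v u

/-! ### Commutative differential graded algebras in non-positive degrees -/

/-- A (cohomologically graded) commutative differential graded algebra over a field `K`,
concentrated in non-positive degrees. The carrier is the direct sum of the graded pieces.
(In characteristic zero, graded commutativity forces squares of odd elements to vanish.) -/
structure CDGA (K : Type u) [Field K] where
  /-- The total space of the algebra. -/
  carrier : Type u
  [ring : Ring carrier]
  [algebra : Algebra K carrier]
  /-- The homogeneous component of each degree. -/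
  deg : ℤ → Submodule K carrier
  isInternal : DirectSum.IsInternal deg
  gradedMonoid : SetLike.GradedMonoid deg
  nonpos : ∀ i : ℤ, 0 < i → deg i = ⊥
  comm : ∀ (i j : ℤ) (x y : carrier), x ∈ deg i → y ∈ deg j →
    x * y = (i * j).negOnePow • (y * x)
  /-- The differential. -/
  d : carrier →ₗ[K] carrier
  d_mem : ∀ (i : ℤ) (x : carrier), x ∈ deg i → d x ∈ deg (i + 1)
  d_d : ∀ x : carrier, d (d x) = 0
  leibniz : ∀ (i : ℤ) (x y : carrier), x ∈ deg i →
    d (x * y) = d x * y + i.negOnePow • (x * d y)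

namespace CDGA

attribute [instance] CDGA.ring CDGA.algebra

variable {K : Type u} [Field K]

/-- Morphisms of differential graded algebras: unital algebra maps which preserve the degrees
and commute with the differentials. -/
@[ext]
structure Hom (E F : CDGA K) where
  /-- The underlying algebra map. -/
  toAlgHom : E.carrier →ₐ[K] F.carrier
  map_deg : ∀ (i : ℤ) (x : E.carrier), x ∈ E.deg i → toAlgHom x ∈ F.deg i
  map_d : ∀ x : E.carrier, toAlgHom (E.d x) = F.d (toAlgHom x)

instance : Category (CDGA K) where
  Hom E F := Hom E F
  id E := ⟨AlgHom.id K E.carrier, fun _ _ h => h, fun _ => rfl⟩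
  comp f g := ⟨g.toAlgHom.comp f.toAlgHom, fun i x h => g.map_deg i _ (f.map_deg i x h),
    fun x => by simp [f.map_d, g.map_d]⟩

@[ext]
theorem hom_ext {E F : CDGA K} {f g : E ⟶ F}
    (h : ∀ x : E.carrier, f.toAlgHom x = g.toAlgHom x) : f = g :=
  Hom.ext (AlgHom.ext h)

@[simp]
theorem id_apply (E : CDGA K) (x : E.carrier) : (𝟙 E : E ⟶ E).toAlgHom x = x := rfl

@[simp]
theorem comp_apply {E F G : CDGA K} (f : E ⟶ F) (g : F ⟶ G) (x : E.carrier) :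
    (f ≫ g).toAlgHom x = g.toAlgHom (f.toAlgHom x) := rfl

/-! ### Cohomology -/

/-- The cocycles of degree `i`. -/
def cocycles (E : CDGA K) (i : ℤ) : Submodule K E.carrier :=
  E.deg i ⊓ LinearMap.ker E.d

/-- The coboundaries of degree `i`. -/
def coboundaries (E : CDGA K) (i : ℤ) : Submodule K E.carrier :=
  (E.deg (i - 1)).map E.d

/-- The `i`-th cohomology space, i.e. cocycles modulo coboundaries. -/
abbrev cohomology (E : CDGA K) (i : ℤ) : Type u :=
  E.cocycles i ⧸ (E.coboundaries i).submoduleOf (E.cocycles i)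

theorem map_mem_cocycles {E F : CDGA K} (f : E ⟶ F) (i : ℤ) (x : E.carrier)
    (hx : x ∈ E.cocycles i) : f.toAlgHom.toLinearMap x ∈ F.cocycles i := by
  refine ⟨f.map_deg i x hx.1, ?_⟩
  have h : E.d x = 0 := hx.2
  change F.d (f.toAlgHom x) = 0
  rw [← f.map_d, h, map_zero]

theorem map_mem_coboundaries {E F : CDGA K} (f : E ⟶ F) (i : ℤ) :
    (E.coboundaries i).submoduleOf (E.cocycles i) ≤
      ((F.coboundaries i).submoduleOf (F.cocycles i)).comap
        (f.toAlgHom.toLinearMap.restrict (map_mem_cocycles f i)) := by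
  rintro ⟨x, hx⟩ ⟨y, hy, hyx⟩
  refine ⟨f.toAlgHom y, f.map_deg _ y hy, ?_⟩
  rw [← f.map_d]
  exact congrArg f.toAlgHom hyx

/-- The map induced in cohomology by a morphism of differential graded algebras. -/
def cohomologyMap {E F : CDGA K} (f : E ⟶ F) (i : ℤ) : E.cohomology i →ₗ[K] F.cohomology i :=
  Submodule.mapQ _ _ (f.toAlgHom.toLinearMap.restrict (map_mem_cocycles f i))
    (map_mem_coboundaries f i)

/-! ### Weak equivalences and fibrations of the projective model structure -/

/-- Weak equivalences are the quasi-isomorphisms. -/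
instance : CategoryWithWeakEquivalences (CDGA K) where
  weakEquivalences := fun _ _ f => ∀ i : ℤ, Function.Bijective (cohomologyMap f i)

/-- Fibrations are the morphisms which are surjective in strictly negative degrees. -/
instance : CategoryWithFibrations (CDGA K) where
  fibrations := fun E F f => ∀ i : ℤ, i < 0 → ∀ y : F.carrier, y ∈ F.deg i →
    ∃ x : E.carrier, x ∈ E.deg i ∧ f.toAlgHom x = y

/-- The algebra `E` is concentrated in degree zero. -/
def ConcentratedInDegreeZero (E : CDGA K) : Prop :=
  ∀ i : ℤ, i ≠ 0 → E.deg i = ⊥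

/-! ### Ordinary commutative algebras as differential graded algebras -/

section DegreeZero

variable (R : Type u) [CommRing R] [Algebra K R]

/-- The grading of `R` for which every element has degree zero. -/
def zeroGrading (K : Type u) [Field K] (R : Type u) [CommRing R] [Algebra K R] (i : ℤ) :
    Submodule K R :=
  if i = 0 then ⊤ else ⊥

theorem zeroGrading_zero : zeroGrading K R 0 = ⊤ := if_pos rfl

theorem zeroGrading_ne {i : ℤ} (hi : i ≠ 0) : zeroGrading K R i = ⊥ := if_neg hi

theorem map_mem_of_mem_zeroGrading {N : Type u} [AddCommGroup N] [Module K N]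
    (f : R →ₗ[K] N) (G : ℤ → Submodule K N) (h : ∀ x, f x ∈ G 0) (i : ℤ) (x : R)
    (hx : x ∈ zeroGrading K R i) : f x ∈ G i := by
  by_cases hi : i = 0
  · subst hi
    exact h x
  · rw [zeroGrading_ne R hi, Submodule.mem_bot] at hx
    rw [hx, map_zero]; exact zero_mem _

theorem zeroGrading_isInternal : DirectSum.IsInternal (zeroGrading K R) := by
  rw [DirectSum.isInternal_submodule_iff_iSupIndep_and_iSup_eq_top]
  constructor
  · intro i
    by_cases hi : i = 0
    · subst hi
      have h : (⨆ (j : ℤ) (_ : j ≠ 0), zeroGrading K R j) = ⊥ := by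
        simp only [iSup_eq_bot]
        exact fun j hj => zeroGrading_ne R hj
      rw [h]
      exact disjoint_bot_right
    · rw [zeroGrading_ne R hi]
      exact disjoint_bot_left
  · exact top_le_iff.mp ((zeroGrading_zero (K := K) R).ge.trans (le_iSup (zeroGrading K R) 0))

theorem zeroGrading_gradedMonoid : SetLike.GradedMonoid (zeroGrading K R) where
  one_mem := by rw [zeroGrading_zero]; trivial
  mul_mem i j x y hx hy := by
    by_cases hi : i = 0
    · by_cases hj : j = 0
      · subst hi hj
        rw [add_zero, zeroGrading_zero]; trivial
      · rw [zeroGrading_ne R hj, Submodule.mem_bot] at hy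
        rw [hy, mul_zero]; exact zero_mem _
    · rw [zeroGrading_ne R hi, Submodule.mem_bot] at hx
      rw [hx, zero_mul]; exact zero_mem _

variable (K)

/-- A commutative algebra, regarded as a differential graded algebra concentrated in degree
zero (with zero differential). -/
def ofAlgebra : CDGA K where
  carrier := R
  deg := zeroGrading K R
  isInternal := zeroGrading_isInternal R
  gradedMonoid := zeroGrading_gradedMonoid R
  nonpos i hi := zeroGrading_ne R hi.ne'
  comm i j x y hx hy := by
    by_cases hi : i = 0
    · subst hi
      rw [zero_mul, Int.negOnePow_zero, one_smul, mul_comm]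
    · rw [zeroGrading_ne R hi, Submodule.mem_bot] at hx
      rw [hx, zero_mul, mul_zero, smul_zero]
  d := 0
  d_mem i x _ := zero_mem _
  d_d x := rfl
  leibniz i x y _ := by simp

variable {K R}

/-- An algebra map, regarded as a morphism of differential graded algebras. -/
def ofAlgHom {S : Type u} [CommRing S] [Algebra K S] (f : R →ₐ[K] S) :
    ofAlgebra K R ⟶ ofAlgebra K S :=
  { toAlgHom := f
    map_deg := map_mem_of_mem_zeroGrading R f.toLinearMap (zeroGrading K S)
      fun x => (zeroGrading_zero (K := K) S).ge (Submodule.mem_top (x := f x))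
    map_d := fun _ => map_zero f }

end DegreeZero

/-- The inclusion of commutative algebras into differential graded algebras. -/
def inclusion (K : Type u) [Field K] : CommAlgCat.{u} K ⥤ CDGA K where
  obj R := ofAlgebra K R
  map f := ofAlgHom f.hom
  map_id _ := rfl
  map_comp _ _ := rfl

theorem d_one (E : CDGA K) : E.d 1 = 0 := by
  have h := E.leibniz 0 1 1 E.gradedMonoid.one_mem
  rw [Int.negOnePow_zero, one_smul, mul_one, mul_one, one_mul] at h
  exact left_eq_add.mp h

theorem algebraMap_mem (E : CDGA K) (c : K) : algebraMap K E.carrier c ∈ E.deg 0 := by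
  rw [Algebra.algebraMap_eq_smul_one]
  exact Submodule.smul_mem _ _ E.gradedMonoid.one_mem

theorem d_algebraMap (E : CDGA K) (c : K) : E.d (algebraMap K E.carrier c) = 0 := by
  rw [Algebra.algebraMap_eq_smul_one, map_smul, d_one, smul_zero]

/-- The unit map `K ⟶ E`. -/
def unit (E : CDGA K) : ofAlgebra K K ⟶ E :=
  { toAlgHom := Algebra.ofId K E.carrier
    map_deg := map_mem_of_mem_zeroGrading K (Algebra.linearMap K E.carrier) E.deg
      E.algebraMap_mem
    map_d := fun c => (map_zero (algebraMap K E.carrier)).trans (E.d_algebraMap c).symm }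

end CDGA

/-! ### Direct Reedy categories -/

/-- A category is direct Reedy if it has a degree function with values in `ℕ` which is strictly
raised by every non-identity morphism. -/
def IsDirectReedy (C : Type v) [Category.{w} C] : Prop :=
  ∃ deg : C → ℕ, ∀ ⦃a b : C⦄ (f : a ⟶ b), ¬ MorphismProperty.identities C f → deg a < deg b

/-! ### Flat morphisms -/

section Flat

variable {M : Type v} [Category.{w} M] [CategoryWithFibrations M] [CategoryWithWeakEquivalences M]

/-- A morphism `f : A ⟶ B` is flat if the push-out functor from objects under `A` to objects
under `B` preserves pull-back squares of trivial fibrations. Here `P, E, C, D` is such a square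
under `A` (the trivial fibration is `r`, and hence also `l`), the objects `P', E', C', D'` are
push-outs along `f` of `P, E, C, D`, and `t', l', r', b'` are the induced morphisms.
(In `CDGA K` push-outs exist: they are graded tensor products.) -/
def IsFlatMorphism {A B : M} (f : A ⟶ B) : Prop :=
  ∀ ⦃P E C D : Under A⦄ (t : P ⟶ E) (l : P ⟶ C) (r : E ⟶ D) (b : C ⟶ D),
    IsPullback t l r b → trivialFibrations M r.right →
    ∀ ⦃P' E' C' D' : Under B⦄
      (p : P.right ⟶ P'.right) (e : E.right ⟶ E'.right)
      (c : C.right ⟶ C'.right) (d : D.right ⟶ D'.right),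
      IsPushout P.hom f p P'.hom → IsPushout E.hom f e E'.hom →
      IsPushout C.hom f c C'.hom → IsPushout D.hom f d D'.hom →
    ∀ (t' : P' ⟶ E') (l' : P' ⟶ C') (r' : E' ⟶ D') (b' : C' ⟶ D'),
      p ≫ t'.right = t.right ≫ e → p ≫ l'.right = l.right ≫ c →
      e ≫ r'.right = r.right ≫ d → c ≫ b'.right = b.right ≫ d →
    IsPullback t' l' r' b' ∧ trivialFibrations M r'.right

/-- The class of flat morphisms. -/
def flatMorphisms (M : Type v) [Category.{w} M] [CategoryWithFibrations M]
    [CategoryWithWeakEquivalences M] : MorphismProperty M :=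
  fun _ _ f => IsFlatMorphism f

end Flat

/-! ### Deformations of diagrams -/

section Deformations

universe w' v'

variable {C : Type v} [Category.{w} C] {M : Type v'} [Category.{w'} M]

/-- A commutative square of diagrams `C ⥤ M`, with `ΔA → total → X` and `ΔA → ΔL → X`,
where `Δ` denotes the constant diagram. -/
structure DiagramSquare {A L : M} (p : A ⟶ L) {X : C ⥤ M}
    (x : (Functor.const C).obj L ⟶ X) where
  /-- The total diagram. -/
  total : C ⥤ M
  /-- The structure map. -/
  str : (Functor.const C).obj A ⟶ total
  /-- The map to the diagram to be deformed. -/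
  proj : total ⟶ X
  comm : str ≫ proj = (Functor.const C).map p ≫ x

namespace DiagramSquare

variable {A L : M} {p : A ⟶ L} {X : C ⥤ M} {x : (Functor.const C).obj L ⟶ X}

/-- The square is, objectwise, such that the structure map `A ⟶ total a` has the property
`flat` and the induced map from the push-out of `total a` along `A ⟶ L` to `X a` has the
property `W`. -/
def IsDeformation (flat W : MorphismProperty M) (S : DiagramSquare p x) : Prop :=
  ∀ a : C, flat (S.str.app a) ∧
    ∃ (Q : M) (q₁ : S.total.obj a ⟶ Q) (q₂ : L ⟶ Q) (g : Q ⟶ X.obj a),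
      IsPushout (S.str.app a) p q₁ q₂ ∧ q₁ ≫ g = S.proj.app a ∧ q₂ ≫ g = x.app a ∧ W g

/-- There is a morphism of total diagrams, compatible with the maps from `ΔA` and to `X`, which
objectwise has the property `W`. -/
def Rel (W : MorphismProperty M) (S T : DiagramSquare p x) : Prop :=
  ∃ h : S.total ⟶ T.total, S.str ≫ h = T.str ∧ h ≫ T.proj = S.proj ∧ ∀ a : C, W (h.app a)

end DiagramSquare

variable {A L : M} (p : A ⟶ L) {X : C ⥤ M} (x : (Functor.const C).obj L ⟶ X)

/-- Deformations (with respect to `flat` and `W`), modulo the equivalence relation generated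
by the direct equivalences, i.e. by the morphisms of deformations having objectwise the
property `W`. -/
def DeformationClasses (flat W : MorphismProperty M) :=
  Quot fun S T : {S : DiagramSquare p x // S.IsDeformation flat W} =>
    DiagramSquare.Rel W S.1 T.1

/-- The class of a deformation. -/
def DeformationClasses.mk {flat W : MorphismProperty M} (S : DiagramSquare p x)
    (hS : S.IsDeformation flat W) : DeformationClasses p x flat W :=
  Quot.mk _ ⟨S, hS⟩

/-- If `W ≤ W'`, every deformation with respect to `W` is one with respect to `W'`; this is the
map on classes induced by the identity on deformations. -/
def DeformationClasses.ofLE (flat : MorphismProperty M) {W W' : MorphismProperty M}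
    (hW : W ≤ W') : DeformationClasses p x flat W → DeformationClasses p x flat W' :=
  Quot.map
    (fun S => ⟨S.1, fun a => ⟨(S.2 a).1, by
      obtain ⟨Q, q₁, q₂, g, h, h₁, h₂, hg⟩ := (S.2 a).2
      exact ⟨Q, q₁, q₂, g, h, h₁, h₂, hW _ hg⟩⟩⟩)
    (fun _ _ ⟨h, h₁, h₂, h₃⟩ => ⟨h, h₁, h₂, fun a => hW _ (h₃ a)⟩)

end Deformations

/-! ### Deformations of diagrams of algebras -/

section Algebras

variable {K : Type u} [Field K]

theorem CDGA.isomorphisms_le_weakEquivalences :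
    MorphismProperty.isomorphisms (CDGA K) ≤ weakEquivalences (CDGA K) := by
  intro E F f (hf : IsIso f)
  have key : ∀ {E F : CDGA K} (f : E ⟶ F) (g : F ⟶ E), f ≫ g = 𝟙 E → ∀ i : ℤ,
      Function.LeftInverse (CDGA.cohomologyMap g i) (CDGA.cohomologyMap f i) := by
    intro E F f g hfg i y
    obtain ⟨⟨y, hy⟩, rfl⟩ := Submodule.Quotient.mk_surjective _ y
    have h : g.toAlgHom (f.toAlgHom y) = y := by
      rw [← CDGA.comp_apply, hfg, CDGA.id_apply]
    exact congrArg (Submodule.Quotient.mk) (Subtype.ext h)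
  intro i
  exact ⟨(key f (inv f) (IsIso.hom_inv_id f) i).injective,
    (key (inv f) f (IsIso.inv_hom_id f) i).surjective⟩

variable {C : Type v} [Category.{w} C]

/-- The unique cone `ΔK ⟶ X` over a diagram of differential graded algebras. -/
def CDGA.unitTrans (X : C ⥤ CDGA K) : (Functor.const C).obj (CDGA.ofAlgebra K K) ⟶ X where
  app a := CDGA.unit (X.obj a)
  naturality a b f := by
    ext c
    exact ((X.map f).toAlgHom.commutes c).symm

/-- The unique cone `ΔK ⟶ X` over a diagram of commutative algebras. -/
def CommAlgCat.unitTrans (X : C ⥤ CommAlgCat.{u} K) :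
    (Functor.const C).obj (CommAlgCat.of K K) ⟶ X where
  app a := CommAlgCat.ofHom (Algebra.ofId K (X.obj a))
  naturality _ _ _ := by
    ext

variable (A : Type u) [CommRing A] [Algebra K A] (ε : A →ₐ[K] K)

/-- Deformations of the diagram of differential graded algebras `X` over the augmented algebra
`ε : A → K`, up to equivalence: the structure maps are flat, the maps from the reduction to
`X` are weak equivalences, and equivalences are generated by weak equivalences. -/
abbrev DefClasses (X : C ⥤ CDGA K) :=
  DeformationClasses (CDGA.ofAlgHom ε) (CDGA.unitTrans X)
    (flatMorphisms (CDGA K)) (weakEquivalences (CDGA K))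

/-- Strict deformations of the diagram of differential graded algebras `X` over the augmented
algebra `ε : A → K`, up to isomorphism: the structure maps are flat and the maps from the
reduction to `X` are isomorphisms. -/
abbrev StrictDefClasses (X : C ⥤ CDGA K) :=
  DeformationClasses (CDGA.ofAlgHom ε) (CDGA.unitTrans X)
    (flatMorphisms (CDGA K)) (MorphismProperty.isomorphisms (CDGA K))

/-- The natural map from strict deformations up to isomorphism to deformations up to
equivalence, sending the class of a strict deformation to its class as a deformation. -/
def strictDefToDef (X : C ⥤ CDGA K) : StrictDefClasses A ε X → DefClasses A ε X :=
  DeformationClasses.ofLE _ _ _ CDGA.isomorphisms_le_weakEquivalences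

/-- Flat homomorphisms of commutative algebras, in the usual sense of commutative algebra. -/
def CommAlgCat.flatHoms (K : Type u) [Field K] : MorphismProperty (CommAlgCat.{u} K) :=
  fun _ _ f => f.hom.toRingHom.Flat

/-- Classical deformations over `ε : A → K` of a diagram of commutative algebras, up to
isomorphism: diagrams of flat commutative `A`-algebras together with an isomorphism of their
reduction (tensor product with `K` over `A`) with the given diagram. -/
abbrev ClassicalDefClasses (X : C ⥤ CommAlgCat.{u} K) :=
  DeformationClasses (CommAlgCat.ofHom ε) (CommAlgCat.unitTrans X)
    (CommAlgCat.flatHoms K) (MorphismProperty.isomorphisms (CommAlgCat.{u} K))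

variable {A ε}

/-- A square of diagrams of commutative algebras, regarded as a square of diagrams of
differential graded algebras concentrated in degree zero. -/
def DiagramSquare.toCDGA {X : C ⥤ CommAlgCat.{u} K}
    (S : DiagramSquare (CommAlgCat.ofHom ε) (CommAlgCat.unitTrans X)) :
    DiagramSquare (CDGA.ofAlgHom ε) (CDGA.unitTrans (X ⋙ CDGA.inclusion K)) where
  total := S.total ⋙ CDGA.inclusion K
  str :=
    { app := fun a => (CDGA.inclusion K).map (S.str.app a)
      naturality := fun _ _ f => congrArg (CDGA.inclusion K).map (S.str.naturality f) }
  proj := Functor.whiskerRight S.proj (CDGA.inclusion K)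
  comm := by
    ext a : 2
    exact congrArg (fun h => (CDGA.inclusion K).map (h.app a)) S.comm

end Algebras

namespace CDGA

variable {K : Type u} [Field K]

/-! ### Homogeneous components -/

/-! Everything reduces to one fact about a single algebra: if `A → B` is flat in the
model-categorical sense and `B ⊗_A K` has no cohomology in negative degrees, then `B` has none
either, and `H⁰(B)` is flat over `A` in the usual sense. Then `B → H⁰(B)` is a weak equivalence onto
a classical flat algebra. As it is natural in `B`, diagrams are no harder than single algebras.

Push-outs along a map out of `A` are graded tensor products over `A` (`isPushout_tensor`,
`mulMap_bijective`). Flatness is tested on one family of trivial fibrations: for an ideal `J` of an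
`A`-algebra `R`, the cone `R ⊕ J[1]` maps to `R/J` with acyclic kernel. That the push-out is again a
trivial fibration says that `B ⊗ J → B ⊗ R → B ⊗ R/J` behaves in cohomology like a short exact
sequence of complexes (`coneExact_of_isFlatMorphism`). Splitting off a copy of the residue field
generated by a socle element, and inducting over the quotients of `A`, gives vanishing of the
negative cohomology of `B ⊗ R` for every quotient `R` (`negExact_of_isFlatMorphism`). Vanishing of
`H⁻¹(B ⊗ A/I)` then yields injectivity of `I ⊗ H⁰(B) → H⁰(B)`, which is the ideal criterion for
flatness (`flat_toCohomologyZero`). Conversely, a classically flat algebra in degree zero is flat in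
the model-categorical sense, by exactness of the tensor product (`isFlatMorphism_ofAlgHom`).

The functor `H⁰` is left adjoint to the inclusion of algebras, and the inclusion is left adjoint to
the degree zero part. Hence truncation preserves push-outs, so it commutes with reduction along `A →
K`. It turns weak equivalences into isomorphisms, and thus maps deformations up to equivalence to
strict deformations up to isomorphism. The unit of the adjunction is a weak equivalence on every
deformation. On a strict one it is an isomorphism, since strict deformations are concentrated in
degree zero by a Nakayama argument (`concentratedInDegreeZero_of_isPushout`). So truncation inverts
the natural map. The same functor, with values in ordinary algebras, inverts the passage from
classical to strict deformations. -/

instance (E : CDGA K) : SetLike.GradedMonoid E.deg := E.gradedMonoid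

noncomputable instance (E : CDGA K) : DirectSum.Decomposition E.deg :=
  E.isInternal.chooseDecomposition

noncomputable instance (E : CDGA K) : GradedAlgebra E.deg where

theorem induction_on (E : CDGA K) {p : E.carrier → Prop}
    (mem : ∀ i x, x ∈ E.deg i → p x) (add : ∀ x y, p x → p y → p (x + y)) (x : E.carrier) :
    p x := by
  induction x using DirectSum.Decomposition.inductionOn E.deg with
  | zero => exact mem 0 0 (zero_mem _)
  | homogeneous m => exact mem _ _ m.2
  | add m n hm hn => exact add _ _ hm hn

/-- The projection to the homogeneous component of degree `i`. -/
noncomputable def proj (E : CDGA K) (i : ℤ) : E.carrier →ₗ[K] E.carrier :=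
  GradedAlgebra.proj E.deg i

theorem proj_apply (E : CDGA K) (i : ℤ) (x : E.carrier) :
    E.proj i x = DirectSum.decompose E.deg x i := rfl

theorem proj_mem (E : CDGA K) (i : ℤ) (x : E.carrier) : E.proj i x ∈ E.deg i :=
  (DirectSum.decompose E.deg x i).2

theorem proj_of_mem {E : CDGA K} {i : ℤ} {x : E.carrier} (hx : x ∈ E.deg i) : E.proj i x = x :=
  DirectSum.decompose_of_mem_same _ hx

theorem proj_of_mem_ne {E : CDGA K} {i j : ℤ} {x : E.carrier} (hx : x ∈ E.deg i) (h : i ≠ j) :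
    E.proj j x = 0 :=
  DirectSum.decompose_of_mem_ne _ hx h

theorem map_proj {E F : CDGA K} (f : E ⟶ F) (i : ℤ) (x : E.carrier) :
    f.toAlgHom (E.proj i x) = F.proj i (f.toAlgHom x) := by
  induction x using E.induction_on with
  | mem j x hx =>
    by_cases h : j = i
    · subst h
      rw [proj_of_mem hx, proj_of_mem (f.map_deg _ _ hx)]
    · rw [proj_of_mem_ne hx h, proj_of_mem_ne (f.map_deg _ _ hx) h, map_zero]
  | add x y hx hy => simp only [map_add, hx, hy]

theorem d_proj (E : CDGA K) (i : ℤ) (x : E.carrier) :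
    E.d (E.proj i x) = E.proj (i + 1) (E.d x) := by
  induction x using E.induction_on with
  | mem j x hx =>
    by_cases h : j = i
    · subst h
      rw [proj_of_mem hx, proj_of_mem (E.d_mem _ _ hx)]
    · rw [proj_of_mem_ne hx h, proj_of_mem_ne (E.d_mem _ _ hx) (by omega), map_zero]
  | add x y hx hy => simp only [map_add, hx, hy]

theorem eq_zero_of_mem {E : CDGA K} {i : ℤ} (hi : 0 < i) {x : E.carrier} (hx : x ∈ E.deg i) :
    x = 0 := by
  rwa [E.nonpos i hi, Submodule.mem_bot] at hx

/-- If every homogeneous component of `x` is the image under the linear map `g` of an element of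
the submodule `P`, then so is `x`. -/
theorem mem_map_of_proj {E : CDGA K} {V : Type*} [AddCommGroup V] [Module K V] (P : Submodule K V)
    (g : V →ₗ[K] E.carrier) (x : E.carrier) (h : ∀ i, E.proj i x ∈ P.map g) : x ∈ P.map g := by
  classical
  rw [← DirectSum.sum_support_decompose E.deg x]
  exact Submodule.sum_mem _ fun i _ => h i

theorem d_eq_zero_of_mem_zero {E : CDGA K} {x : E.carrier} (hx : x ∈ E.deg 0) : E.d x = 0 :=
  eq_zero_of_mem (by norm_num) (E.d_mem 0 x hx)

/-! ### Trivial fibrations -/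

theorem cohomologyMap_injective_iff {E F : CDGA K} (f : E ⟶ F) (i : ℤ) :
    Function.Injective (cohomologyMap f i) ↔
      ∀ x ∈ E.cocycles i, f.toAlgHom x ∈ F.coboundaries i → x ∈ E.coboundaries i := by
  rw [← LinearMap.ker_eq_bot, LinearMap.ker_eq_bot']
  constructor
  · intro h x hx hfx
    have := h (Submodule.Quotient.mk ⟨x, hx⟩)
      ((Submodule.Quotient.mk_eq_zero _).2 (by exact hfx))
    exact (Submodule.Quotient.mk_eq_zero ((E.coboundaries i).submoduleOf (E.cocycles i))).1 this
  · intro h y hy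
    obtain ⟨⟨x, hx⟩, rfl⟩ := Submodule.Quotient.mk_surjective _ y
    have h2 : f.toAlgHom x ∈ F.coboundaries i := 
      (Submodule.Quotient.mk_eq_zero ((F.coboundaries i).submoduleOf (F.cocycles i))).1 hy
    exact (Submodule.Quotient.mk_eq_zero _).2 (h x hx h2)

theorem cohomologyMap_surjective_iff {E F : CDGA K} (f : E ⟶ F) (i : ℤ) :
    Function.Surjective (cohomologyMap f i) ↔
      ∀ y ∈ F.cocycles i, ∃ x ∈ E.cocycles i, f.toAlgHom x - y ∈ F.coboundaries i := by
  constructor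
  · intro h y hy
    obtain ⟨z, hz⟩ := h (Submodule.Quotient.mk ⟨y, hy⟩)
    obtain ⟨⟨x, hx⟩, rfl⟩ := Submodule.Quotient.mk_surjective _ z
    exact ⟨x, hx, (Submodule.Quotient.eq ((F.coboundaries i).submoduleOf (F.cocycles i))).1 hz⟩
  · intro h z
    obtain ⟨⟨y, hy⟩, rfl⟩ := Submodule.Quotient.mk_surjective _ z
    obtain ⟨x, hx, hxy⟩ := h y hy
    exact ⟨Submodule.Quotient.mk ⟨x, hx⟩, (Submodule.Quotient.eq _).2 hxy⟩

theorem weakEquivalences_iff {E F : CDGA K} (f : E ⟶ F) :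
    weakEquivalences (CDGA K) f ↔ ∀ i : ℤ, Function.Bijective (cohomologyMap f i) := Iff.rfl

theorem exists_proj_of_map_eq {E F : CDGA K} {f : E ⟶ F} (hf : Function.Surjective f.toAlgHom)
    {i : ℤ} {y : F.carrier} (hy : y ∈ F.deg i) : ∃ x ∈ E.deg i, f.toAlgHom x = y := by
  obtain ⟨x, rfl⟩ := hf y
  exact ⟨E.proj i x, E.proj_mem i x, by rw [map_proj, proj_of_mem hy]⟩

theorem mem_coboundaries_of_d_eq {E : CDGA K} {i : ℤ} {x y : E.carrier} (hx : x ∈ E.deg i)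
    (h : E.d y = x) : x ∈ E.coboundaries i := by
  refine ⟨E.proj (i - 1) y, E.proj_mem _ _, ?_⟩
  rw [d_proj, h, sub_add_cancel, proj_of_mem hx]

/-- The definition of a fibration gives nothing in degree zero. There every element is a cocycle, so
surjectivity on `H⁰` gives a preimage up to a coboundary. That coboundary is the differential of an
element of degree `-1`, which lifts. -/
theorem surjective_of_trivialFibrations {E F : CDGA K} {f : E ⟶ F}
    (hf : trivialFibrations (CDGA K) f) : Function.Surjective f.toAlgHom := by
  obtain ⟨hfib, hw⟩ := hf
  rw [weakEquivalences_iff] at hw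
  intro y
  induction y using F.induction_on with
  | mem i y hy =>
    rcases lt_trichotomy i 0 with hi | rfl | hi
    · obtain ⟨x, _, hx⟩ := hfib i hi y hy
      exact ⟨x, hx⟩
    · obtain ⟨x, hx, w, hw', hxy⟩ := (cohomologyMap_surjective_iff f 0).1 (hw 0).2 y
        ⟨hy, d_eq_zero_of_mem_zero hy⟩
      obtain ⟨v, _, rfl⟩ := hfib (0 - 1) (by norm_num) w hw'
      refine ⟨x - E.d v, ?_⟩
      rw [map_sub, f.map_d, hxy, sub_sub_cancel]
    · exact ⟨0, by rw [eq_zero_of_mem hi hy, map_zero]⟩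
  | add x y hx hy =>
    obtain ⟨a, rfl⟩ := hx
    obtain ⟨b, rfl⟩ := hy
    exact ⟨a + b, map_add _ _ _⟩

/-- A homogeneous cocycle in the kernel is exact in `E`, say equal to `d w`. Then `f w` is a
cocycle, and surjectivity on cohomology one degree lower allows `w` to be changed by a cocycle and a
coboundary until it lies in the kernel. -/
theorem acyclic_of_trivialFibrations {E F : CDGA K} {f : E ⟶ F}
    (hf : trivialFibrations (CDGA K) f) (x : E.carrier) (hx : f.toAlgHom x = 0)
    (hdx : E.d x = 0) : ∃ y, f.toAlgHom y = 0 ∧ E.d y = x := by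
  have hsurj := surjective_of_trivialFibrations hf
  obtain ⟨hfib, hw⟩ := hf
  rw [weakEquivalences_iff] at hw
  suffices h : x ∈ (LinearMap.ker f.toAlgHom.toLinearMap).map E.d from h
  refine mem_map_of_proj _ _ x fun i => ?_
  have hx' : f.toAlgHom (E.proj i x) = 0 := by rw [map_proj, hx, map_zero]
  have hdx' : E.d (E.proj i x) = 0 := by rw [d_proj, hdx, map_zero]
  obtain ⟨w, hwi, hwx⟩ := (cohomologyMap_injective_iff f i).1 (hw i).1 (E.proj i x)
    ⟨E.proj_mem i x, hdx'⟩ (by rw [hx']; exact zero_mem _)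
  have hfw : F.d (f.toAlgHom w) = 0 := by rw [← f.map_d, hwx, hx']
  obtain ⟨z, hz, t, ht, hzt⟩ := (cohomologyMap_surjective_iff f (i - 1)).1 (hw (i - 1)).2 _
    ⟨f.map_deg _ _ hwi, hfw⟩
  obtain ⟨s, rfl⟩ := hsurj t
  have hdz : E.d z = 0 := hz.2
  refine ⟨w - z + E.d s, ?_, ?_⟩
  · change f.toAlgHom (w - z + E.d s) = 0
    rw [map_add, map_sub, f.map_d, hzt]
    abel
  · rw [map_add, map_sub, E.d_d, hdz, hwx, sub_zero, add_zero]

/-- A morphism is a trivial fibration if and only if it is surjective with acyclic kernel. -/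
theorem trivialFibrations_iff {E F : CDGA K} (f : E ⟶ F) :
    trivialFibrations (CDGA K) f ↔ Function.Surjective f.toAlgHom ∧
      ∀ x, f.toAlgHom x = 0 → E.d x = 0 → ∃ y, f.toAlgHom y = 0 ∧ E.d y = x := by
  refine ⟨fun h => ⟨surjective_of_trivialFibrations h, acyclic_of_trivialFibrations h⟩, ?_⟩
  rintro ⟨hs, ha⟩
  refine ⟨fun i _ y hy => exists_proj_of_map_eq hs hy, fun i => ⟨?_, ?_⟩⟩
  · rw [cohomologyMap_injective_iff]
    rintro x ⟨hx, hdx : E.d x = 0⟩ ⟨w, _, hw⟩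
    obtain ⟨v, rfl⟩ := hs w
    obtain ⟨y, _, hy⟩ := ha (x - E.d v) (by rw [map_sub, f.map_d, hw, sub_self])
      (by rw [map_sub, E.d_d, hdx, sub_zero])
    exact mem_coboundaries_of_d_eq hx (y := v + y) (by rw [map_add, hy]; abel)
  · rw [cohomologyMap_surjective_iff]
    rintro y ⟨hy, hdy : F.d y = 0⟩
    obtain ⟨x, hx, rfl⟩ := exists_proj_of_map_eq hs hy
    obtain ⟨z, hz, hdz⟩ := ha (E.d x) (by rw [f.map_d, hdy]) (E.d_d x)
    refine ⟨x - E.proj i z, ⟨sub_mem hx (E.proj_mem i z), ?_⟩, ?_⟩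
    · change E.d _ = 0
      rw [map_sub, d_proj, hdz, proj_of_mem (E.d_mem i x hx), sub_self]
    · rw [map_sub, map_proj, hz, map_zero, sub_zero, sub_self]
      exact zero_mem _

/-- The cohomology of `E` vanishes in negative degrees, formulated without reference to the
grading. -/
def NegAcyclic (E : CDGA K) : Prop :=
  ∀ x, E.d x = 0 → E.proj 0 x = 0 → ∃ y, E.d y = x

/-- In nonzero degrees the cohomology of `E` injects into that of `F`, where the components
themselves vanish. -/
theorem negAcyclic_of_weakEquivalences {E F : CDGA K} {f : E ⟶ F}
    (hf : weakEquivalences (CDGA K) f) (hF : F.ConcentratedInDegreeZero) : E.NegAcyclic := by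
  rw [weakEquivalences_iff] at hf
  intro x hdx h0
  suffices h : x ∈ (⊤ : Submodule K E.carrier).map E.d by
    obtain ⟨y, _, hy⟩ := h
    exact ⟨y, hy⟩
  refine mem_map_of_proj _ _ x fun i => ?_
  by_cases hi : i = 0
  · rw [hi, h0]; exact zero_mem _
  · have hfx : f.toAlgHom (E.proj i x) ∈ F.deg i := f.map_deg _ _ (E.proj_mem i x)
    rw [hF i hi, Submodule.mem_bot] at hfx
    obtain ⟨y, _, hy⟩ := (cohomologyMap_injective_iff f i).1 (hf i).1 (E.proj i x)
      ⟨E.proj_mem i x, by change E.d _ = 0; rw [d_proj, hdx, map_zero]⟩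
      (by rw [hfx]; exact zero_mem _)
    exact ⟨y, trivial, hy⟩

end CDGA

namespace CDGA

variable {K : Type u} [Field K]

/-! ### The degree zero part and the zeroth cohomology algebra -/

/-- The subalgebra of elements of degree zero. -/
def degZero (E : CDGA K) : Subalgebra K E.carrier :=
  SetLike.GradeZero.subalgebra E.deg

theorem commute_of_mem_zero {E : CDGA K} {x : E.carrier} (hx : x ∈ E.deg 0) (y : E.carrier) :
    x * y = y * x := by
  induction y using E.induction_on with
  | mem j y hy => rw [E.comm 0 j x y hx hy, zero_mul, Int.negOnePow_zero, one_smul]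
  | add y z hy hz => rw [mul_add, add_mul, hy, hz]

instance (E : CDGA K) : CommRing E.degZero where
  mul_comm x _ := Subtype.ext (commute_of_mem_zero x.2 _)

/-- Since no degree is positive, two degrees add up to zero only if both are zero. -/
theorem proj_zero_mul (E : CDGA K) (x y : E.carrier) :
    E.proj 0 (x * y) = E.proj 0 x * E.proj 0 y := by
  induction x using E.induction_on with
  | add x x' hx hx' => simp only [add_mul, map_add, hx, hx']
  | mem i x hx =>
    induction y using E.induction_on with
    | add y y' hy hy' => simp only [mul_add, map_add, hy, hy']
    | mem j y hy =>
      have hxy := E.gradedMonoid.mul_mem hx hy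
      rcases lt_trichotomy i 0 with hi | rfl | hi
      · rw [proj_of_mem_ne hx hi.ne, zero_mul]
        rcases le_or_gt j 0 with hj | hj
        · exact proj_of_mem_ne hxy (by omega)
        · rw [eq_zero_of_mem hj hy, mul_zero, map_zero]
      · rw [proj_of_mem hx]
        rcases eq_or_ne j 0 with rfl | hj
        · rw [proj_of_mem hy, proj_of_mem (by simpa using hxy)]
        · rw [proj_of_mem_ne hy hj, mul_zero, proj_of_mem_ne hxy (by omega)]
      · rw [eq_zero_of_mem hi hx, zero_mul, map_zero, zero_mul]

/-- The projection to the degree zero part. -/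
noncomputable def toDegZero (E : CDGA K) : E.carrier →ₐ[K] E.degZero :=
  AlgHom.ofLinearMap ((E.proj 0).codRestrict (Subalgebra.toSubmodule E.degZero) (E.proj_mem 0))
    (Subtype.ext (proj_of_mem E.gradedMonoid.one_mem))
    (fun x y => Subtype.ext (E.proj_zero_mul x y))

/-- The ideal of coboundaries in the degree zero part. -/
def boundaryIdeal (E : CDGA K) : Ideal E.degZero where
  carrier := {x | (x : E.carrier) ∈ E.coboundaries 0}
  add_mem' hx hy := (E.coboundaries 0).add_mem hx hy
  zero_mem' := (E.coboundaries 0).zero_mem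
  smul_mem' := by
    rintro ⟨c, hc⟩ ⟨x, hx⟩ ⟨y, hy, rfl⟩
    refine ⟨c * y, by simpa using E.gradedMonoid.mul_mem hc hy, ?_⟩
    rw [E.leibniz 0 c y hc, d_eq_zero_of_mem_zero hc, zero_mul, zero_add, Int.negOnePow_zero,
      one_smul]
    rfl

theorem mem_boundaryIdeal {E : CDGA K} {x : E.degZero} :
    x ∈ E.boundaryIdeal ↔ (x : E.carrier) ∈ E.coboundaries 0 := by
  rfl

/-- The zeroth cohomology of `E`, as a commutative algebra. -/
def cohomologyZero (E : CDGA K) : CommAlgCat.{u} K :=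
  CommAlgCat.of K (E.degZero ⧸ E.boundaryIdeal)

/-- The projection of the total space of `E` to the zeroth cohomology. -/
noncomputable def toCohomologyZeroAlgHom (E : CDGA K) : E.carrier →ₐ[K] E.cohomologyZero :=
  (Ideal.Quotient.mkₐ K E.boundaryIdeal).comp E.toDegZero

theorem toCohomologyZeroAlgHom_surjective (E : CDGA K) :
    Function.Surjective E.toCohomologyZeroAlgHom := by
  intro y
  obtain ⟨⟨x, hx⟩, rfl⟩ := Ideal.Quotient.mk_surjective y
  exact ⟨x, congrArg (Ideal.Quotient.mk _) (Subtype.ext (proj_of_mem hx))⟩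

theorem toCohomologyZeroAlgHom_eq_zero_iff (E : CDGA K) (x : E.carrier) :
    E.toCohomologyZeroAlgHom x = 0 ↔ E.proj 0 x ∈ E.coboundaries 0 :=
  (Ideal.Quotient.eq_zero_iff_mem (I := E.boundaryIdeal) (a := E.toDegZero x)).trans
    mem_boundaryIdeal

theorem toCohomologyZeroAlgHom_of_mem_ne {E : CDGA K} {i : ℤ} {x : E.carrier} (hx : x ∈ E.deg i)
    (hi : i ≠ 0) : E.toCohomologyZeroAlgHom x = 0 := by
  rw [toCohomologyZeroAlgHom_eq_zero_iff, proj_of_mem_ne hx hi]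
  exact zero_mem _

theorem toCohomologyZeroAlgHom_d (E : CDGA K) (x : E.carrier) :
    E.toCohomologyZeroAlgHom (E.d x) = 0 := by
  rw [toCohomologyZeroAlgHom_eq_zero_iff]
  exact mem_coboundaries_of_d_eq (E.proj_mem _ _) (y := E.proj (-1) x) (by rw [d_proj]; rfl)

/-- A map to an algebra in degree zero, given by an algebra map which kills the elements of
nonzero degree and the coboundaries. -/
def homOfAlgHom {E : CDGA K} {R : Type u} [CommRing R] [Algebra K R] (f : E.carrier →ₐ[K] R)
    (h : ∀ i x, x ∈ E.deg i → i ≠ 0 → f x = 0) (hd : ∀ x, f (E.d x) = 0) :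
    E ⟶ ofAlgebra K R :=
  { toAlgHom := f
    map_deg := fun i x hx => by
      by_cases hi : i = 0
      · subst hi
        exact (zeroGrading_zero (K := K) R).ge (Submodule.mem_top (x := f x))
      · have h0 : f x = 0 := h i x hx hi
        have : f x ∈ zeroGrading K R i := by rw [h0]; exact zero_mem _
        exact this
    map_d := hd }

theorem apply_of_mem_ne {E : CDGA K} {R : Type u} [CommRing R] [Algebra K R]
    (g : E ⟶ ofAlgebra K R) {i : ℤ} {x : E.carrier} (hx : x ∈ E.deg i) (hi : i ≠ 0) :
    g.toAlgHom x = 0 := by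
  have h : g.toAlgHom x ∈ zeroGrading K R i := g.map_deg i x hx
  exact (Submodule.mem_bot K).1 ((zeroGrading_ne (K := K) R hi).le h)

theorem apply_proj_zero {E : CDGA K} {R : Type u} [CommRing R] [Algebra K R]
    (g : E ⟶ ofAlgebra K R) (x : E.carrier) : g.toAlgHom (E.proj 0 x) = g.toAlgHom x := by
  induction x using E.induction_on with
  | mem i x hx =>
    by_cases hi : i = 0
    · subst hi
      rw [proj_of_mem hx]
    · rw [proj_of_mem_ne hx hi, map_zero, apply_of_mem_ne g hx hi]
  | add x y hx hy => simp only [map_add, hx, hy]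

theorem apply_d {E : CDGA K} {R : Type u} [CommRing R] [Algebra K R]
    (g : E ⟶ ofAlgebra K R) (x : E.carrier) : g.toAlgHom (E.d x) = 0 := g.map_d x

/-- The factorization through the zeroth cohomology of a map to an algebra in degree zero. -/
def cohomologyZeroLift {E : CDGA K} {R : CommAlgCat.{u} K} (g : E ⟶ (inclusion K).obj R) :
    E.cohomologyZero ⟶ R :=
  CommAlgCat.ofHom (Ideal.Quotient.liftₐ E.boundaryIdeal
    ((show E.carrier →ₐ[K] R from g.toAlgHom).comp E.degZero.val) (by
      rintro ⟨_, _⟩ h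
      obtain ⟨y, _, rfl⟩ := mem_boundaryIdeal.1 h
      exact apply_d g y))

theorem cohomologyZeroLift_apply {E : CDGA K} {R : CommAlgCat.{u} K}
    (g : E ⟶ (inclusion K).obj R) (x : E.carrier) :
    (cohomologyZeroLift g).hom (E.toCohomologyZeroAlgHom x) = g.toAlgHom x :=
  apply_proj_zero g x

/-- The unit of the adjunction between zeroth cohomology and inclusion. -/
noncomputable def toCohomologyZero (E : CDGA K) :
    E ⟶ (inclusion K).obj E.cohomologyZero :=
  homOfAlgHom (R := E.cohomologyZero) E.toCohomologyZeroAlgHom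
    (fun _ _ => toCohomologyZeroAlgHom_of_mem_ne) E.toCohomologyZeroAlgHom_d

/-- Zeroth cohomology is left adjoint to the inclusion of algebras: bijection on morphisms. -/
noncomputable def cohomologyZeroHomEquiv (E : CDGA K) (R : CommAlgCat.{u} K) :
    (E.cohomologyZero ⟶ R) ≃ (E ⟶ (inclusion K).obj R) where
  toFun h := E.toCohomologyZero ≫ (inclusion K).map h
  invFun := cohomologyZeroLift
  left_inv h := by
    ext y
    obtain ⟨x, rfl⟩ := E.toCohomologyZeroAlgHom_surjective y
    exact cohomologyZeroLift_apply _ x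
  right_inv g := by
    ext x
    exact cohomologyZeroLift_apply g x

theorem cohomologyZeroHomEquiv_naturality (E : CDGA K) (R S : CommAlgCat.{u} K) (g : R ⟶ S)
    (h : E.cohomologyZero ⟶ R) : cohomologyZeroHomEquiv E S (h ≫ g) =
      cohomologyZeroHomEquiv E R h ≫ (inclusion K).map g := rfl

/-- The zeroth cohomology functor. -/
noncomputable def cohomologyZeroFunctor (K : Type u) [Field K] : CDGA K ⥤ CommAlgCat.{u} K :=
  Adjunction.leftAdjointOfEquiv (G := inclusion K) cohomologyZeroHomEquiv
    cohomologyZeroHomEquiv_naturality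

/-- Zeroth cohomology is left adjoint to the inclusion of algebras. -/
noncomputable def cohomologyZeroAdjunction (K : Type u) [Field K] :
    cohomologyZeroFunctor K ⊣ inclusion K :=
  Adjunction.adjunctionOfEquivLeft _ _

theorem cohomologyZeroAdjunction_unit_app (E : CDGA K) :
    (cohomologyZeroAdjunction K).unit.app E = E.toCohomologyZero := by
  ext x
  simp [cohomologyZeroAdjunction]
  rfl

theorem cohomologyZeroFunctor_map_apply {E F : CDGA K} (f : E ⟶ F) (x : E.carrier) :
    ((cohomologyZeroFunctor K).map f).hom (E.toCohomologyZeroAlgHom x) =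
      F.toCohomologyZeroAlgHom (f.toAlgHom x) :=
  cohomologyZeroLift_apply (R := F.cohomologyZero) _ x

instance : (inclusion K).Full where
  map_surjective f := ⟨CommAlgCat.ofHom f.toAlgHom, rfl⟩

instance : (inclusion K).Faithful where
  map_injective h := CommAlgCat.hom_ext (congrArg Hom.toAlgHom h)

/-- The inclusion of algebras is left adjoint to the degree zero part: bijection on morphisms. -/
noncomputable def degZeroHomEquiv (R : CommAlgCat.{u} K) (E : CDGA K) :
    ((inclusion K).obj R ⟶ E) ≃ (R ⟶ CommAlgCat.of K E.degZero) where
  toFun f := CommAlgCat.ofHom (f.toAlgHom.codRestrict E.degZero fun x =>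
    f.map_deg 0 x ((zeroGrading_zero (K := K) R).ge trivial))
  invFun g :=
    { toAlgHom := E.degZero.val.comp g.hom
      map_deg := map_mem_of_mem_zeroGrading R (E.degZero.val.comp g.hom).toLinearMap E.deg
        fun x => (g.hom x).2
      map_d := fun x => (map_zero (E.degZero.val.comp g.hom)).trans
        (d_eq_zero_of_mem_zero (g.hom x).2).symm }
  left_inv _ := rfl
  right_inv _ := rfl

/-- This second adjunction is what makes the inclusion preserve push-outs. -/
instance : (inclusion K).IsLeftAdjoint :=
  (Adjunction.adjunctionOfEquivRight (F := inclusion K) degZeroHomEquiv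
    fun _ _ _ _ _ => rfl).isLeftAdjoint

instance : (cohomologyZeroFunctor K).IsLeftAdjoint :=
  (cohomologyZeroAdjunction K).isLeftAdjoint

/-! ### Isomorphisms and quasi-isomorphisms -/

theorem isIso_of_bijective {E F : CDGA K} (f : E ⟶ F) (hf : Function.Bijective f.toAlgHom) :
    IsIso f := by
  let e := AlgEquiv.ofBijective f.toAlgHom hf
  have he : ∀ x, f.toAlgHom (e.symm x) = x := e.apply_symm_apply
  refine ⟨⟨⟨e.symm, ?_, ?_⟩, ?_, ?_⟩⟩
  · intro i y hy
    obtain ⟨x, hx, rfl⟩ := exists_proj_of_map_eq hf.2 hy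
    have : e.symm (f.toAlgHom x) = x := e.symm_apply_apply x
    change e.symm (f.toAlgHom x) ∈ _
    rwa [this]
  · intro x
    apply hf.1
    change f.toAlgHom (e.symm _) = f.toAlgHom (E.d (e.symm x))
    rw [he, f.map_d, he]
  · ext x
    exact e.symm_apply_apply x
  · ext x
    exact he x

theorem bijective_of_isIso {E F : CDGA K} (f : E ⟶ F) [IsIso f] :
    Function.Bijective f.toAlgHom := by
  refine Function.bijective_iff_has_inverse.2 ⟨(inv f).toAlgHom, fun x => ?_, fun x => ?_⟩
  · rw [← comp_apply, IsIso.hom_inv_id, id_apply]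
  · rw [← comp_apply, IsIso.inv_hom_id, id_apply]

theorem isIso_of_bijective_hom {R S : CommAlgCat.{u} K} (f : R ⟶ S)
    (hf : Function.Bijective f.hom) : IsIso f :=
  (CommAlgCat.isoMk (AlgEquiv.ofBijective f.hom hf)).isIso_hom

/-- All elements of degree zero are cocycles, so the algebra `cohomologyZero` is the cohomology
space in degree zero, and only bijectivity of `cohomologyMap f 0` matters. -/
theorem isIso_cohomologyZeroFunctor_map {E F : CDGA K} (f : E ⟶ F)
    (hf : weakEquivalences (CDGA K) f) : IsIso ((cohomologyZeroFunctor K).map f) := by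
  rw [weakEquivalences_iff] at hf
  apply isIso_of_bijective_hom
  constructor
  · rw [injective_iff_map_eq_zero]
    intro y hy
    obtain ⟨x, rfl⟩ := E.toCohomologyZeroAlgHom_surjective y
    have hy' := (F.toCohomologyZeroAlgHom_eq_zero_iff (f.toAlgHom x)).1
      ((cohomologyZeroFunctor_map_apply f x).symm.trans hy)
    rw [← map_proj] at hy'
    refine (E.toCohomologyZeroAlgHom_eq_zero_iff x).2 ?_
    exact (cohomologyMap_injective_iff f 0).1 (hf 0).1 _
      ⟨E.proj_mem 0 x, d_eq_zero_of_mem_zero (E.proj_mem 0 x)⟩ hy'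
  · intro y
    obtain ⟨z, rfl⟩ := F.toCohomologyZeroAlgHom_surjective y
    obtain ⟨x, hx, hxz⟩ := (cohomologyMap_surjective_iff f 0).1 (hf 0).2 (F.proj 0 z)
      ⟨F.proj_mem 0 z, d_eq_zero_of_mem_zero (F.proj_mem 0 z)⟩
    refine ⟨E.toCohomologyZeroAlgHom x, (cohomologyZeroFunctor_map_apply f x).trans ?_⟩
    have h : F.toCohomologyZeroAlgHom (f.toAlgHom x - z) = 0 := by
      rw [toCohomologyZeroAlgHom_eq_zero_iff, map_sub, ← map_proj, proj_of_mem hx.1]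
      exact hxz
    rw [map_sub] at h
    exact sub_eq_zero.1 h

/-- Nothing lives in degree `-1`, so there are no coboundaries to divide out. -/
theorem isIso_toCohomologyZero {E : CDGA K} (hE : E.ConcentratedInDegreeZero) :
    IsIso E.toCohomologyZero := by
  have h0 : ∀ x : E.carrier, E.proj 0 x = x := by
    intro x
    induction x using E.induction_on with
    | mem i x hx =>
      by_cases hi : i = 0
      · subst hi; exact proj_of_mem hx
      · rw [hE i hi, Submodule.mem_bot] at hx
        rw [hx, map_zero]
    | add x y hx hy => rw [map_add, hx, hy]
  refine isIso_of_bijective _ ⟨?_, E.toCohomologyZeroAlgHom_surjective⟩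
  rw [injective_iff_map_eq_zero]
  intro x hx
  obtain ⟨y, hy, hyx⟩ := (E.toCohomologyZeroAlgHom_eq_zero_iff x).1 hx
  have hy : y = 0 := (Submodule.mem_bot K).1 ((hE (0 - 1) (by norm_num)).le hy)
  rw [← h0 x, ← hyx, hy, map_zero]

/-- The unit is even a trivial fibration. A cocycle in its kernel is a coboundary of degree zero
plus a cocycle without component in degree zero, and the latter is exact by hypothesis. -/
theorem weakEquivalences_toCohomologyZero {E : CDGA K} (hE : E.NegAcyclic) :
    weakEquivalences (CDGA K) E.toCohomologyZero := by
  have h : trivialFibrations (CDGA K) E.toCohomologyZero := by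
    refine (trivialFibrations_iff _).2 ⟨E.toCohomologyZeroAlgHom_surjective, fun x hx hdx => ?_⟩
    obtain ⟨y, hy, hyx⟩ := (E.toCohomologyZeroAlgHom_eq_zero_iff x).1 hx
    obtain ⟨z, hz⟩ := hE (x - E.proj 0 x)
      (by rw [map_sub, hdx, d_eq_zero_of_mem_zero (E.proj_mem 0 x), sub_zero])
      (by rw [map_sub, proj_of_mem (E.proj_mem 0 x), sub_self])
    have hyz : E.d (y + z) = x := by rw [map_add, hyx, hz]; abel
    -- Dropping the degree zero component puts the primitive into the kernel and leaves its
    -- differential unchanged.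
    refine ⟨y + z - E.proj 0 (y + z), ?_, ?_⟩
    · refine (E.toCohomologyZeroAlgHom_eq_zero_iff _).2 ?_
      rw [map_sub, proj_of_mem (E.proj_mem 0 _), sub_self]
      exact zero_mem _
    · rw [map_sub, hyz, d_eq_zero_of_mem_zero (E.proj_mem 0 _), sub_zero]
  exact h.2

end CDGA

/-! ### The graded tensor product of differential graded algebras -/

section GradedTensor

open scoped TensorProduct
open DirectSum GradedTensorProduct

variable {R E B : Type u} [CommRing R] [Ring E] [Ring B] [Algebra R E] [Algebra R B]

/-- The conditions, relative to a base ring, for a graded algebra with an endomorphism to be a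
commutative differential graded algebra concentrated in non-positive degrees. -/
structure IsDifferentialGraded (𝒜 : ℤ → Submodule R E) (d : E →ₗ[R] E) : Prop where
  nonpos : ∀ i : ℤ, 0 < i → 𝒜 i = ⊥
  comm : ∀ (i j : ℤ) (x y : E), x ∈ 𝒜 i → y ∈ 𝒜 j → x * y = (i * j).negOnePow • (y * x)
  d_mem : ∀ (i : ℤ) (x : E), x ∈ 𝒜 i → d x ∈ 𝒜 (i + 1)
  d_d : ∀ x : E, d (d x) = 0
  leibniz : ∀ (i : ℤ) (x y : E), x ∈ 𝒜 i → d (x * y) = d x * y + i.negOnePow • (x * d y)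

namespace GradedTensorProduct

variable (𝒜 : ℤ → Submodule R E) (ℬ : ℤ → Submodule R B) [GradedAlgebra 𝒜] [GradedAlgebra ℬ]

section

variable {𝒜 ℬ}

theorem add_tmul (a a' : E) (b : B) :
    ((a + a') ᵍ⊗ₜ[R] b : 𝒜 ᵍ⊗[R] ℬ) = a ᵍ⊗ₜ[R] b + a' ᵍ⊗ₜ[R] b :=
  TensorProduct.add_tmul a a' b

theorem tmul_add (a : E) (b b' : B) :
    (a ᵍ⊗ₜ[R] (b + b') : 𝒜 ᵍ⊗[R] ℬ) = a ᵍ⊗ₜ[R] b + a ᵍ⊗ₜ[R] b' :=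
  TensorProduct.tmul_add a b b'

theorem smul_tmul (r : R) (a : E) (b : B) :
    ((r • a) ᵍ⊗ₜ[R] b : 𝒜 ᵍ⊗[R] ℬ) = r • a ᵍ⊗ₜ[R] b := rfl

theorem tmul_smul (r : R) (a : E) (b : B) :
    (a ᵍ⊗ₜ[R] (r • b) : 𝒜 ᵍ⊗[R] ℬ) = r • a ᵍ⊗ₜ[R] b :=
  TensorProduct.tmul_smul r a b

theorem zero_tmul (b : B) : ((0 : E) ᵍ⊗ₜ[R] b : 𝒜 ᵍ⊗[R] ℬ) = 0 :=
  TensorProduct.zero_tmul E b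

theorem tmul_zero (a : E) : (a ᵍ⊗ₜ[R] (0 : B) : 𝒜 ᵍ⊗[R] ℬ) = 0 :=
  TensorProduct.tmul_zero B a

theorem units_smul_tmul (r : ℤˣ) (a : E) (b : B) :
    ((r • a) ᵍ⊗ₜ[R] b : 𝒜 ᵍ⊗[R] ℬ) = r • a ᵍ⊗ₜ[R] b := by
  rcases Int.units_eq_one_or r with rfl | rfl
  · simp only [one_smul]
  · simp only [Units.neg_smul, one_smul]
    exact TensorProduct.neg_tmul a b

theorem tmul_units_smul (r : ℤˣ) (a : E) (b : B) :
    (a ᵍ⊗ₜ[R] (r • b) : 𝒜 ᵍ⊗[R] ℬ) = r • a ᵍ⊗ₜ[R] b := by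
  rcases Int.units_eq_one_or r with rfl | rfl
  · simp only [one_smul]
  · simp only [Units.neg_smul, one_smul]
    exact TensorProduct.tmul_neg a b

end

theorem map_units_smul {M N : Type*} [AddCommGroup M] [AddCommGroup N] [Module R M] [Module R N]
    (f : M →ₗ[R] N) (r : ℤˣ) (x : M) : f (r • x) = r • f x := by
  rw [Units.smul_def, map_zsmul, Units.smul_def]

theorem mul_units_smul {S : Type*} [Ring S] (r : ℤˣ) (x y : S) : x * r • y = r • (x * y) := by
  rw [Units.smul_def, Units.smul_def, mul_smul_comm]

theorem induction_on_homogeneous {p : 𝒜 ᵍ⊗[R] ℬ → Prop}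
    (tmul : ∀ i j a b, a ∈ 𝒜 i → b ∈ ℬ j → p (a ᵍ⊗ₜ[R] b))
    (add : ∀ x y, p x → p y → p (x + y)) (x : 𝒜 ᵍ⊗[R] ℬ) : p x := by
  have h0 : p 0 := by
    have := tmul 0 0 0 0 (zero_mem _) (zero_mem _)
    rwa [zero_tmul] at this
  change p (of R 𝒜 ℬ ((of R 𝒜 ℬ).symm x))
  induction (of R 𝒜 ℬ).symm x using TensorProduct.induction_on with
  | zero => simpa using h0
  | add x y hx hy => rw [map_add]; exact add _ _ hx hy
  | tmul a b =>
    induction a using Decomposition.inductionOn 𝒜 with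
    | zero => simpa using h0
    | add a a' ha ha' => rw [TensorProduct.add_tmul, map_add]; exact add _ _ ha ha'
    | homogeneous a =>
      induction b using Decomposition.inductionOn ℬ with
      | zero => simpa using h0
      | add a a' ha ha' => rw [TensorProduct.tmul_add, map_add]; exact add _ _ ha ha'
      | homogeneous b => exact tmul _ _ _ _ a.2 b.2

theorem tmul_mul_tmul {j i : ℤ} (a : E) {b : B} (hb : b ∈ ℬ j) {a' : E} (ha' : a' ∈ 𝒜 i) (b' : B) :
    (a ᵍ⊗ₜ[R] b * a' ᵍ⊗ₜ[R] b' : 𝒜 ᵍ⊗[R] ℬ) =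
      (j * i).negOnePow • ((a * a') ᵍ⊗ₜ[R] (b * b')) :=
  tmul_coe_mul_coe_tmul 𝒜 ℬ a ⟨b, hb⟩ ⟨a', ha'⟩ b'

/-- The total grading of the graded tensor product. -/
noncomputable def grading (n : ℤ) : Submodule R (𝒜 ᵍ⊗[R] ℬ) :=
  Submodule.span R {x | ∃ i j a b, a ∈ 𝒜 i ∧ b ∈ ℬ j ∧ i + j = n ∧ a ᵍ⊗ₜ[R] b = x}

variable {𝒜 ℬ} in
theorem tmul_mem_grading {i j : ℤ} {a : E} {b : B} (ha : a ∈ 𝒜 i) (hb : b ∈ ℬ j) :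
    a ᵍ⊗ₜ[R] b ∈ grading 𝒜 ℬ (i + j) :=
  Submodule.subset_span ⟨i, j, a, b, ha, hb, rfl, rfl⟩

/-- The bilinear map underlying the decomposition of the graded tensor product. -/
noncomputable def decomposeBilin (i j : ℤ) :
    𝒜 i →ₗ[R] ℬ j →ₗ[R] ⨁ n, grading 𝒜 ℬ n :=
  (LinearMap.mk₂ R (fun (a : 𝒜 i) (b : ℬ j) =>
      (⟨(a : E) ᵍ⊗ₜ[R] (b : B), tmul_mem_grading a.2 b.2⟩ : grading 𝒜 ℬ (i + j)))
    (fun _ _ _ => Subtype.ext (add_tmul _ _ _))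
    (fun _ _ _ => Subtype.ext (smul_tmul _ _ _))
    (fun _ _ _ => Subtype.ext (tmul_add _ _ _))
    (fun _ _ _ => Subtype.ext (tmul_smul _ _ _))).compr₂
    (DirectSum.lof R ℤ (fun n => grading 𝒜 ℬ n) (i + j))

/-- The decomposition of the graded tensor product. -/
noncomputable def decomposeHom : (𝒜 ᵍ⊗[R] ℬ) →ₗ[R] ⨁ n, grading 𝒜 ℬ n :=
  (TensorProduct.lift ((DirectSum.toModule R ℤ _ fun i =>
    (DirectSum.toModule R ℤ _ fun j => (decomposeBilin 𝒜 ℬ i j).flip).flip))) ∘ₗ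
    (auxEquiv R 𝒜 ℬ).toLinearMap

theorem decomposeHom_tmul {i j : ℤ} {a : E} {b : B} (ha : a ∈ 𝒜 i) (hb : b ∈ ℬ j) :
    decomposeHom 𝒜 ℬ (a ᵍ⊗ₜ[R] b) =
      DirectSum.lof R ℤ (fun n => grading 𝒜 ℬ n) (i + j) ⟨a ᵍ⊗ₜ[R] b, tmul_mem_grading ha hb⟩ := by
  lift a to 𝒜 i using ha
  lift b to ℬ j using hb
  simp only [decomposeHom, LinearMap.comp_apply, LinearEquiv.coe_coe, auxEquiv_tmul,
    decompose_coe, TensorProduct.lift.tmul, ← lof_eq_of R, toModule_lof, LinearMap.flip_apply]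
  rfl

theorem decomposeHom_of_mem {n : ℤ} (x : 𝒜 ᵍ⊗[R] ℬ) (hx : x ∈ grading 𝒜 ℬ n) :
    decomposeHom 𝒜 ℬ x = DirectSum.lof R ℤ (fun n => grading 𝒜 ℬ n) n ⟨x, hx⟩ := by
  induction hx using Submodule.span_induction with
  | mem x h =>
    obtain ⟨i, j, a, b, ha, hb, rfl, rfl⟩ := h
    exact decomposeHom_tmul 𝒜 ℬ ha hb
  | zero => rw [map_zero]; exact (map_zero _).symm
  | add x y hx hy h h' => rw [map_add, h, h', ← map_add]; rfl
  | smul r x hx h => rw [map_smul, h, ← map_smul]; rfl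

noncomputable instance gradingDecomposition : Decomposition (grading 𝒜 ℬ) :=
  Decomposition.ofLinearMap _ (decomposeHom 𝒜 ℬ)
    (by
      refine LinearMap.ext fun x => ?_
      induction x using induction_on_homogeneous 𝒜 ℬ with
      | tmul i j a b ha hb =>
        rw [LinearMap.comp_apply, decomposeHom_tmul 𝒜 ℬ ha hb, coeLinearMap_lof]
        rfl
      | add x y hx hy => rw [map_add, hx, hy, map_add])
    (by
      refine DirectSum.linearMap_ext _ fun n => LinearMap.ext fun x => ?_
      rw [LinearMap.comp_apply, LinearMap.comp_apply, coeLinearMap_lof,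
        decomposeHom_of_mem 𝒜 ℬ x.1 x.2]
      rfl)

variable {𝒜 ℬ} in
theorem mem_grading_induction {n : ℤ} {p : ∀ x, x ∈ grading 𝒜 ℬ n → Prop}
    (tmul : ∀ i j a b (ha : a ∈ 𝒜 i) (hb : b ∈ ℬ j) (hij : i + j = n),
      p (a ᵍ⊗ₜ[R] b) (hij ▸ tmul_mem_grading ha hb))
    (add : ∀ x y hx hy, p x hx → p y hy → p (x + y) (add_mem hx hy))
    {x : 𝒜 ᵍ⊗[R] ℬ} (hx : x ∈ grading 𝒜 ℬ n) : p x hx := by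
  -- The span is generated additively by scalar multiples of generators. The scalar is absorbed into
  -- the left factor, so users of the principle face no scalar case.
  induction hx using Submodule.closure_induction with
  | zero =>
    have := tmul n 0 0 0 (zero_mem _) (zero_mem _) (add_zero n)
    simpa only [zero_tmul] using this
  | add x y _ _ hx hy => exact add x y _ _ hx hy
  | smul_mem r x h =>
    obtain ⟨i, j, a, b, ha, hb, hij, rfl⟩ := h
    exact tmul i j (r • a) b (Submodule.smul_mem _ r ha) hb hij

instance gradingGradedMonoid : SetLike.GradedMonoid (grading 𝒜 ℬ) where
  one_mem := tmul_mem_grading (i := 0) (j := 0) SetLike.GradedOne.one_mem SetLike.GradedOne.one_mem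
  mul_mem m n x y hx hy := by
    induction hx using mem_grading_induction with
    | add x x' _ _ hx hx' => rw [add_mul]; exact add_mem hx hx'
    | tmul i j a b ha hb hij =>
      induction hy using mem_grading_induction with
      | add y y' _ _ hy hy' => rw [mul_add]; exact add_mem hy hy'
      | tmul i' j' a' b' ha' hb' hij' =>
        rw [tmul_mul_tmul 𝒜 ℬ a hb ha' b', Units.smul_def]
        refine zsmul_mem ?_ _
        have := tmul_mem_grading (R := R) (SetLike.mul_mem_graded ha ha')
          (SetLike.mul_mem_graded hb hb')
        rwa [show i + i' + (j + j') = m + n by omega] at this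

noncomputable instance gradingGradedAlgebra : GradedAlgebra (grading 𝒜 ℬ) where

/-- The sign involution of a graded module. -/
noncomputable def signHom : E →ₗ[R] E :=
  (DirectSum.toModule R ℤ E fun i => ((i.negOnePow : ℤˣ) : ℤ) • (𝒜 i).subtype) ∘ₗ
    (decomposeLinearEquiv 𝒜).toLinearMap

theorem signHom_of_mem {i : ℤ} {a : E} (ha : a ∈ 𝒜 i) : signHom 𝒜 a = i.negOnePow • a := by
  lift a to 𝒜 i using ha
  simp only [signHom, LinearMap.comp_apply, LinearEquiv.coe_coe, decomposeLinearEquiv_apply,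
    decompose_coe, ← lof_eq_of R, toModule_lof]
  rfl

/-- The differential of the graded tensor product. -/
noncomputable def differential (dE : E →ₗ[R] E) (dB : B →ₗ[R] B) :
    (𝒜 ᵍ⊗[R] ℬ) →ₗ[R] (𝒜 ᵍ⊗[R] ℬ) :=
  (of R 𝒜 ℬ).toLinearMap ∘ₗ
    (TensorProduct.map dE LinearMap.id + TensorProduct.map (signHom 𝒜) dB) ∘ₗ
    (of R 𝒜 ℬ).symm.toLinearMap

variable {𝒜 ℬ} {dE : E →ₗ[R] E} {dB : B →ₗ[R] B}

theorem differential_tmul {i : ℤ} {a : E} (ha : a ∈ 𝒜 i) (b : B) :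
    differential 𝒜 ℬ dE dB (a ᵍ⊗ₜ[R] b) =
      dE a ᵍ⊗ₜ[R] b + i.negOnePow • (a ᵍ⊗ₜ[R] dB b) := by
  simp only [differential, LinearMap.comp_apply, LinearEquiv.coe_coe, of_symm_of,
    LinearMap.add_apply, TensorProduct.map_tmul, signHom_of_mem 𝒜 ha, LinearMap.id_apply, map_add]
  exact congrArg _ (units_smul_tmul _ _ _)

theorem differential_tmul_one (hB : dB 1 = 0) (a : E) :
    differential 𝒜 ℬ dE dB (a ᵍ⊗ₜ[R] 1) = dE a ᵍ⊗ₜ[R] 1 := by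
  induction a using Decomposition.inductionOn 𝒜 with
  | zero => simp only [map_zero, zero_tmul]
  | add a a' ha ha' => rw [add_tmul, map_add, ha, ha', map_add, add_tmul]
  | homogeneous a => rw [differential_tmul a.2, hB, tmul_zero, smul_zero, add_zero]

theorem differential_one_tmul (hE : dE 1 = 0) (b : B) :
    differential 𝒜 ℬ dE dB (1 ᵍ⊗ₜ[R] b) = 1 ᵍ⊗ₜ[R] dB b := by
  rw [differential_tmul (i := 0) SetLike.GradedOne.one_mem, hE, zero_tmul, zero_add,
    Int.negOnePow_zero, one_smul]

theorem isDifferentialGraded (hE : IsDifferentialGraded 𝒜 dE) (hB : IsDifferentialGraded ℬ dB) :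
    IsDifferentialGraded (grading 𝒜 ℬ) (differential 𝒜 ℬ dE dB) where
  nonpos n hn := by
    rw [eq_bot_iff]
    intro x hx
    rw [Submodule.mem_bot]
    induction hx using mem_grading_induction with
    | add x y _ _ hx hy => rw [hx, hy, add_zero]
    | tmul i j a b ha hb hij =>
      rcases le_or_gt i 0 with hi | hi
      · rw [hB.nonpos j (by omega), Submodule.mem_bot] at hb
        rw [hb, tmul_zero]
      · rw [hE.nonpos i hi, Submodule.mem_bot] at ha
        rw [ha, zero_tmul]
  comm m n x y hx hy := by
    induction hx using mem_grading_induction with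
    | add x x' _ _ hx hx' => rw [add_mul, mul_add, hx, hx', smul_add]
    | tmul i j a b ha hb hij =>
      induction hy using mem_grading_induction with
      | add y y' _ _ hy hy' => rw [add_mul, mul_add, hy, hy', smul_add]
      | tmul i' j' a' b' ha' hb' hij' =>
        rw [tmul_mul_tmul 𝒜 ℬ a hb ha' b', tmul_mul_tmul 𝒜 ℬ a' hb' ha b,
          hE.comm _ _ _ _ ha ha', hB.comm _ _ _ _ hb hb']
        simp only [units_smul_tmul, tmul_units_smul, smul_smul, ← Int.negOnePow_add]
        congr 1
        rw [Int.negOnePow_eq_iff, ← hij, ← hij']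
        -- The two sign exponents differ by `-2 * (j' * i)`.
        exact ⟨- (j' * i), by ring⟩
  d_mem n x hx := by
    induction hx using mem_grading_induction with
    | add x y _ _ hx hy => rw [map_add]; exact add_mem hx hy
    | tmul i j a b ha hb hij =>
      rw [differential_tmul ha, Units.smul_def]
      refine add_mem ?_ (zsmul_mem ?_ _)
      · have := tmul_mem_grading (R := R) (hE.d_mem _ _ ha) hb
        rwa [show i + 1 + j = n + 1 by omega] at this
      · have := tmul_mem_grading (R := R) ha (hB.d_mem _ _ hb)
        rwa [show i + (j + 1) = n + 1 by omega] at this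
  d_d x := by
    induction x using induction_on_homogeneous 𝒜 ℬ with
    | add x y hx hy => rw [map_add, map_add, hx, hy, add_zero]
    | tmul i j a b ha hb =>
      rw [differential_tmul ha, map_add, differential_tmul (hE.d_mem _ _ ha), hE.d_d,
        map_units_smul, differential_tmul ha, hB.d_d, zero_tmul, tmul_zero, smul_zero, zero_add,
        add_zero, Int.negOnePow_succ, Units.neg_smul, neg_add_cancel]
  leibniz n x y hx := by
    induction hx using mem_grading_induction with
    | add x x' _ _ hx hx' => simp only [add_mul, map_add, hx, hx', smul_add]; abel
    | tmul i j a b ha hb hij =>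
      induction y using induction_on_homogeneous 𝒜 ℬ with
      | add y y' hy hy' => simp only [mul_add, map_add, hy, hy', smul_add]; abel
      | tmul i' j' a' b' ha' hb' =>
        have h1 := differential_tmul (dE := dE) (dB := dB) (ℬ := ℬ)
          (SetLike.mul_mem_graded ha ha') (b * b')
        rw [tmul_mul_tmul 𝒜 ℬ a hb ha' b', differential_tmul ha, differential_tmul ha',
          map_units_smul, h1, hE.leibniz _ _ _ ha, hB.leibniz _ _ _ hb, add_mul, mul_add,
          tmul_mul_tmul 𝒜 ℬ (dE a) hb ha' b', smul_mul_assoc, mul_units_smul,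
          tmul_mul_tmul 𝒜 ℬ a (hB.d_mem _ _ hb) ha' b',
          tmul_mul_tmul 𝒜 ℬ a hb (hE.d_mem _ _ ha') b', tmul_mul_tmul 𝒜 ℬ a hb ha' (dB b')]
        rw [← hij]
        simp only [add_mul, mul_add, one_mul, mul_one, Int.negOnePow_add]
        -- All signs are now products of four independent units of `ℤ`, so the identity is checked
        -- in sixteen cases.
        generalize (j * i').negOnePow = s
        generalize i.negOnePow = s₁
        generalize i'.negOnePow = s₂
        generalize j.negOnePow = s₃
        simp only [add_tmul, tmul_add, units_smul_tmul, tmul_units_smul]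
        rcases Int.units_eq_one_or s with rfl | rfl <;> rcases Int.units_eq_one_or s₁ with rfl | rfl
          <;> rcases Int.units_eq_one_or s₂ with rfl | rfl <;>
          rcases Int.units_eq_one_or s₃ with rfl | rfl <;>
          simp only [Units.neg_smul, one_smul, mul_neg, mul_one, neg_neg, smul_add] <;> abel

end GradedTensorProduct

end GradedTensor

namespace CDGA

open scoped TensorProduct
open DirectSum GradedTensorProduct

variable {K : Type u} [Field K] {A : Type u} [CommRing A] [Algebra K A]

/-! ### Differential graded algebras under an algebra in degree zero -/

/-- The total space of `E`, regarded as an algebra over `A` by means of `s`. -/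
@[nolint unusedArguments]
def Total {E : CDGA K} (_ : ofAlgebra K A ⟶ E) : Type u := E.carrier

namespace Total

variable {E : CDGA K} (s : ofAlgebra K A ⟶ E)

instance : Ring (Total s) := inferInstanceAs (Ring E.carrier)

instance : Algebra K (Total s) := inferInstanceAs (Algebra K E.carrier)

/-- The structure map, as a map of algebras. -/
def structureHom : A →ₐ[K] E.carrier := s.toAlgHom

theorem structureHom_mem (a : A) : structureHom s a ∈ E.deg 0 :=
  s.map_deg 0 a ((zeroGrading_zero (K := K) A).ge trivial)

instance : Algebra A (Total s) :=
  RingHom.toAlgebra' (structureHom s : A →+* E.carrier)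
    fun a x => commute_of_mem_zero (structureHom_mem s a) x

instance : IsScalarTower K A (Total s) :=
  IsScalarTower.of_algebraMap_eq fun k => ((structureHom s).commutes k).symm

/-- The homogeneous components, as submodules over `A`. -/
def gr (i : ℤ) : Submodule A (Total s) where
  carrier := {x | (show E.carrier from x) ∈ E.deg i}
  add_mem' hx hy := (E.deg i).add_mem hx hy
  zero_mem' := (E.deg i).zero_mem
  smul_mem' a x hx := by
    have := E.gradedMonoid.mul_mem (structureHom_mem s a) hx
    rwa [zero_add] at this

instance : SetLike.GradedMonoid (gr s) where
  one_mem := E.gradedMonoid.one_mem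
  mul_mem _ _ _ _ hx hy := E.gradedMonoid.mul_mem hx hy

noncomputable instance : Decomposition (gr s) :=
  IsInternal.chooseDecomposition _ E.isInternal

noncomputable instance : GradedAlgebra (gr s) where

theorem structureHom_mul_d (a : A) (x : E.carrier) :
    E.d (structureHom s a * x) = structureHom s a * E.d x := by
  rw [E.leibniz 0 _ x (structureHom_mem s a), d_eq_zero_of_mem_zero (structureHom_mem s a),
    zero_mul, zero_add, Int.negOnePow_zero, one_smul]

/-- The differential, as a linear map over `A`. -/
def diff : Total s →ₗ[A] Total s where
  toFun := E.d
  map_add' := E.d.map_add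
  map_smul' a x := structureHom_mul_d s a x

theorem isDifferentialGraded : IsDifferentialGraded (gr s) (diff s) where
  nonpos i hi := by
    rw [eq_bot_iff]
    intro x hx
    exact eq_zero_of_mem hi hx
  comm := E.comm
  d_mem := E.d_mem
  d_d := E.d_d
  leibniz := E.leibniz

/-- A morphism under `A`, as a map of algebras over `A`. -/
def map {F : CDGA K} {s} {s' : ofAlgebra K A ⟶ F} (g : E ⟶ F) (h : s ≫ g = s') :
    Total s →ₐ[A] Total s' :=
  { (g.toAlgHom : E.carrier →+* F.carrier) with
    commutes' := fun a => by subst h; rfl }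

end Total

open Total

/-- A graded algebra over `A` with a differential, regarded as a differential graded algebra
over `K`. -/
noncomputable def ofGraded (K : Type u) [Field K] [Algebra K A] {T : Type u} [Ring T] [Algebra A T]
    (𝒢 : ℤ → Submodule A T) [GradedAlgebra 𝒢] (δ : T →ₗ[A] T) (h : IsDifferentialGraded 𝒢 δ) :
    CDGA K :=
  letI : Algebra K T := Algebra.compHom T (algebraMap K A)
  { carrier := T
    deg := fun i =>
      { (𝒢 i).toAddSubmonoid with
        smul_mem' := fun k _ hx => (𝒢 i).smul_mem (algebraMap K A k) hx }
    isInternal := Decomposition.isInternal 𝒢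
    gradedMonoid :=
      { one_mem := SetLike.GradedOne.one_mem (A := 𝒢)
        mul_mem := fun _ _ _ _ hx hy => SetLike.GradedMul.mul_mem (A := 𝒢) hx hy }
    nonpos := fun i hi => by
      rw [eq_bot_iff]
      intro x hx
      exact (Submodule.mem_bot A).1 ((h.nonpos i hi).le hx)
    comm := h.comm
    d :=
      { toFun := δ
        map_add' := δ.map_add
        map_smul' := fun k x => δ.map_smul (algebraMap K A k) x }
    d_mem := h.d_mem
    d_d := h.d_d
    leibniz := h.leibniz }

section Tensor

variable {E B : CDGA K} (s : ofAlgebra K A ⟶ E) (f : ofAlgebra K A ⟶ B)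

/-- The graded tensor product over an algebra in degree zero. -/
noncomputable def tensor : CDGA K :=
  ofGraded K (grading (gr s) (gr f)) (differential (gr s) (gr f) (diff s) (diff f))
    (GradedTensorProduct.isDifferentialGraded (Total.isDifferentialGraded s)
      (Total.isDifferentialGraded f))

/-- The left inclusion into the graded tensor product. -/
noncomputable def tensorInl : E ⟶ tensor s f :=
  { toAlgHom :=
      { (includeLeft (gr s) (gr f) : Total s →+* gr s ᵍ⊗[A] gr f) with
        commutes' := fun k => by
          have h := (includeLeft (gr s) (gr f)).commutes (algebraMap K A k)
          rw [← IsScalarTower.algebraMap_apply K A (Total s)] at h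
          exact h }
    map_deg := fun i x hx => by
      have := tmul_mem_grading (R := A) (𝒜 := gr s) (ℬ := gr f) (i := i) (j := 0) (a := x) hx
        SetLike.GradedOne.one_mem
      rwa [add_zero] at this
    map_d := fun x => (differential_tmul_one (R := A) (𝒜 := gr s) (ℬ := gr f) (dE := diff s)
      (dB := diff f) B.d_one x).symm }

/-- The right inclusion into the graded tensor product. -/
noncomputable def tensorInr : B ⟶ tensor s f :=
  { toAlgHom :=
      { (includeRight (gr s) (gr f) : Total f →+* gr s ᵍ⊗[A] gr f) with
        commutes' := fun k => by
          have h := (includeRight (gr s) (gr f)).commutes (algebraMap K A k)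
          rw [← IsScalarTower.algebraMap_apply K A (Total f)] at h
          exact h }
    map_deg := fun i x hx => by
      have := tmul_mem_grading (R := A) (𝒜 := gr s) (ℬ := gr f) (i := 0) (j := i) (b := x)
        SetLike.GradedOne.one_mem hx
      rwa [zero_add] at this
    map_d := fun x => (differential_one_tmul (R := A) (𝒜 := gr s) (ℬ := gr f) (dE := diff s)
      (dB := diff f) E.d_one x).symm }

theorem tensor_condition : s ≫ tensorInl s f = f ≫ tensorInr s f := by
  ext a
  exact (algebraMap_def (gr s) (gr f) a).symm.trans (algebraMap_def' (gr s) (gr f) a)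

variable {s f} {G : CDGA K} {e : E ⟶ G} {h : B ⟶ G} (w : s ≫ e = f ≫ h)

/-- The algebra map out of the graded tensor product induced by a commutative square. -/
noncomputable def mulAlgHom : gr s ᵍ⊗[A] gr f →ₐ[A] Total (s ≫ e) :=
  GradedTensorProduct.lift (gr s) (gr f) (Total.map e rfl) (Total.map h w.symm)
    fun i j a b => by
      rw [mul_comm j i]
      exact G.comm i j _ _ (e.map_deg i a.1 a.2) (h.map_deg j b.1 b.2)

/-- The linear map out of the tensor product induced by a commutative square. -/
noncomputable def mulMap : Total s ⊗[A] Total f →ₗ[A] Total (s ≫ e) :=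
  (mulAlgHom w).toLinearMap ∘ₗ (GradedTensorProduct.of A (gr s) (gr f)).toLinearMap

theorem mulMap_tmul (x : Total s) (b : Total f) :
    mulMap w (x ⊗ₜ[A] b) = (show Total (s ≫ e) from e.toAlgHom x * h.toAlgHom b) := rfl

/-- This is the Leibniz rule in `G`, read through the multiplication map. -/
theorem diff_mulMap_tmul {i : ℤ} {x : Total s} (hx : x ∈ gr s i) (b : Total f) :
    diff (s ≫ e) (mulMap w (x ⊗ₜ[A] b)) =
      mulMap w (diff s x ⊗ₜ[A] b) + i.negOnePow • mulMap w (x ⊗ₜ[A] diff f b) := by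
  refine (G.leibniz i _ _ (e.map_deg i x hx)).trans ?_
  exact congrArg₂ (fun u v => u * (h.toAlgHom b : G.carrier) + i.negOnePow • (e.toAlgHom x * v))
    (e.map_d x).symm (h.map_d b).symm

/-- The morphism out of the graded tensor product induced by a commutative square. -/
noncomputable def tensorDesc : tensor s f ⟶ G :=
  { toAlgHom :=
      { (mulAlgHom w : gr s ᵍ⊗[A] gr f →+* Total (s ≫ e)) with
        commutes' := fun k => by
          have h := (mulAlgHom w).commutes (algebraMap K A k)
          rw [← IsScalarTower.algebraMap_apply K A (Total (s ≫ e))] at h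
          exact h }
    map_deg := fun i x hx => by
      refine mem_grading_induction (R := A) (𝒜 := gr s) (ℬ := gr f)
        (p := fun x _ => (show G.carrier from mulAlgHom w x) ∈ G.deg i) ?_ ?_ hx
      · rintro i j a b ha hb rfl
        exact G.gradedMonoid.mul_mem (e.map_deg i a ha) (h.map_deg j b hb)
      · intro x y _ _ hx hy
        rw [map_add]
        exact add_mem hx hy
    map_d := fun x => by
      refine induction_on_homogeneous (R := A) (gr s) (gr f) (p := fun x =>
        mulAlgHom w (differential (gr s) (gr f) (diff s) (diff f) x) = G.d (mulAlgHom w x)) ?_ ?_ x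
      · intro i j a b ha _
        refine Eq.trans ?_ (diff_mulMap_tmul w ha b).symm
        rw [differential_tmul ha, map_add]
        exact congrArg _ (map_units_smul (mulAlgHom w).toLinearMap i.negOnePow
          (a ᵍ⊗ₜ[A] diff f b : gr s ᵍ⊗[A] gr f))
      · intro x y hx hy
        rw [map_add, map_add, hx, hy, map_add]
        exact (map_add G.d _ _).symm }

theorem tensorInl_desc : tensorInl s f ≫ tensorDesc w = e := by
  ext x
  exact (congrArg (e.toAlgHom x * ·) (map_one h.toAlgHom)).trans (mul_one _)

theorem tensorInr_desc : tensorInr s f ≫ tensorDesc w = h := by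
  ext x
  exact (congrArg (· * h.toAlgHom x) (map_one e.toAlgHom)).trans (one_mul _)

theorem tensor_tmul (x : E.carrier) (b : B.carrier) :
    ((show Total s from x) ᵍ⊗ₜ[A] (show Total f from b) : gr s ᵍ⊗[A] gr f) =
      (show (tensor s f).carrier from
        (tensorInl s f).toAlgHom x * (tensorInr s f).toAlgHom b) :=
  (tmul_one_mul_one_tmul (gr s) (gr f) x b).symm

/-- Every pure tensor is the product of an element from the left factor and one from the right. -/
theorem tensor_hom_ext {g g' : tensor s f ⟶ G} (hl : tensorInl s f ≫ g = tensorInl s f ≫ g')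
    (hr : tensorInr s f ≫ g = tensorInr s f ≫ g') : g = g' := by
  ext x
  refine induction_on_homogeneous (R := A) (gr s) (gr f)
    (p := fun x => g.toAlgHom x = g'.toAlgHom x) ?_ ?_ x
  · intro i j a b _ _
    have e1 := congrArg (fun φ : E ⟶ G => φ.toAlgHom a) hl
    have e2 := congrArg (fun φ : B ⟶ G => φ.toAlgHom b) hr
    refine (congrArg g.toAlgHom (tensor_tmul a b)).trans
      (Eq.trans ?_ (congrArg g'.toAlgHom (tensor_tmul a b)).symm)
    refine (map_mul g.toAlgHom _ _).trans (Eq.trans ?_ (map_mul g'.toAlgHom _ _).symm)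
    exact congrArg₂ (· * ·) e1 e2
  · intro x y hx hy
    exact (map_add g.toAlgHom _ _).trans
      ((congrArg₂ (· + ·) hx hy).trans (map_add g'.toAlgHom _ _).symm)

variable (s f) in
/-- Push-outs along maps out of an algebra in degree zero are graded tensor products. -/
theorem isPushout_tensor : IsPushout s f (tensorInl s f) (tensorInr s f) :=
  ⟨⟨tensor_condition s f⟩, ⟨Limits.PushoutCocone.IsColimit.mk _
    (fun c => tensorDesc c.condition) (fun c => tensorInl_desc c.condition)
    (fun c => tensorInr_desc c.condition)
    (fun c _ h₁ h₂ => tensor_hom_ext (h₁.trans (tensorInl_desc c.condition).symm)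
      (h₂.trans (tensorInr_desc c.condition).symm))⟩⟩

/-- Any push-out is canonically isomorphic to the graded tensor product. This allows elements of an
arbitrary push-out to be handled as tensors of `A`-modules. -/
theorem mulMap_bijective (hp : IsPushout s f e h) : Function.Bijective (mulMap hp.w) := by
  have he : tensorDesc hp.w = ((isPushout_tensor s f).isoIsPushout _ _ hp).hom :=
    tensor_hom_ext (by rw [tensorInl_desc, IsPushout.inl_isoIsPushout_hom])
      (by rw [tensorInr_desc, IsPushout.inr_isoIsPushout_hom])
  have : IsIso (tensorDesc hp.w) := by rw [he]; infer_instance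
  exact bijective_of_isIso (tensorDesc hp.w)

end Tensor

end CDGA

/-! ### Exactness properties of flat modules -/

section FlatModules

open scoped TensorProduct

variable {R M E D P C : Type*} [CommRing R] [AddCommGroup M] [Module R M] [AddCommGroup E]
  [Module R E] [AddCommGroup D] [Module R D] [AddCommGroup P] [Module R P] [AddCommGroup C]
  [Module R C]

/-- Acyclicity of `ker r` is expressed without a grading, as exactness of the pair formed by its
differential and itself. Flatness preserves this exactness and makes `ker r ⊗ M` the kernel of `r ⊗
M`. -/
theorem Module.Flat.acyclic_rTensor [Module.Flat R M] {r : E →ₗ[R] D} (hr : Function.Surjective r)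
    {dE : E →ₗ[R] E} {dD : D →ₗ[R] D} (hd : r ∘ₗ dE = dD ∘ₗ r) (hdd : dE ∘ₗ dE = 0)
    (ha : ∀ x, r x = 0 → dE x = 0 → ∃ y, r y = 0 ∧ dE y = x) (z : E ⊗[R] M)
    (hz : r.rTensor M z = 0) (hdz : dE.rTensor M z = 0) :
    ∃ y, r.rTensor M y = 0 ∧ dE.rTensor M y = z := by
  let N := LinearMap.ker r
  have hN : ∀ x ∈ N, dE x ∈ N := by
    intro x hx
    have h1 : r (dE x) = dD (r x) := LinearMap.congr_fun hd x
    rw [LinearMap.mem_ker.1 hx, map_zero] at h1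
    exact h1
  let dN : N →ₗ[R] N := dE.restrict hN
  have hsub : N.subtype ∘ₗ dN = dE ∘ₗ N.subtype := rfl
  have hinj := Module.Flat.rTensor_preserves_injective_linearMap (M := M) N.subtype
    N.injective_subtype
  have hex : Function.Exact (N.subtype.rTensor M) (r.rTensor M) :=
    _root_.rTensor_exact M (LinearMap.exact_subtype_ker_map r) hr
  have hdN : Function.Exact dN dN := by
    intro x
    constructor
    · intro hx
      obtain ⟨y, hy, hyx⟩ := ha x.1 x.2 (congrArg Subtype.val hx)
      exact ⟨⟨y, hy⟩, Subtype.ext hyx⟩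
    · rintro ⟨y, rfl⟩
      exact Subtype.ext (LinearMap.congr_fun hdd y.1)
  obtain ⟨n, rfl⟩ := (hex z).1 hz
  have hn : dN.rTensor M n = 0 := by
    apply hinj
    rw [map_zero, ← LinearMap.comp_apply, ← LinearMap.rTensor_comp, hsub, LinearMap.rTensor_comp]
    exact hdz
  obtain ⟨m, rfl⟩ := (Module.Flat.rTensor_exact M hdN n).1 hn
  refine ⟨N.subtype.rTensor M m, (hex _).2 ⟨m, rfl⟩, ?_⟩
  rw [← LinearMap.comp_apply, ← LinearMap.comp_apply, ← LinearMap.rTensor_comp,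
    ← LinearMap.rTensor_comp, hsub]

/-- Right exactness suffices: `y` lifts along the surjection `l ⊗ M`, and the error in the other
coordinate comes from `ker r ⊗ M`, onto which `ker l ⊗ M` maps. -/
theorem exists_rTensor_of_pullback {t : P →ₗ[R] E} {l : P →ₗ[R] C} {r : E →ₗ[R] D}
    {b : C →ₗ[R] D} (hr : Function.Surjective r) (hex : ∀ x y, r x = b y → ∃ p, t p = x ∧ l p = y)
    (hw : r ∘ₗ t = b ∘ₗ l)
    (x : E ⊗[R] M) (y : C ⊗[R] M) (hxy : r.rTensor M x = b.rTensor M y) :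
    ∃ p, t.rTensor M p = x ∧ l.rTensor M p = y := by
  have hl : Function.Surjective l := by
    intro y
    obtain ⟨x, hx⟩ := hr (b y)
    obtain ⟨p, -, hp⟩ := hex x y hx
    exact ⟨p, hp⟩
  have hker : ∀ x : LinearMap.ker r, ∃ p : LinearMap.ker l, t p = x := by
    rintro ⟨x, hx⟩
    obtain ⟨p, hp, hp'⟩ := hex x 0 (by rw [map_zero]; exact hx)
    exact ⟨⟨p, hp'⟩, hp⟩
  let j : LinearMap.ker l →ₗ[R] LinearMap.ker r := t.restrict fun p hp => by
    have h1 : r (t p) = b (l p) := LinearMap.congr_fun hw p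
    rw [LinearMap.mem_ker.1 hp, map_zero] at h1
    exact h1
  have hj : Function.Surjective (j.rTensor M) := LinearMap.rTensor_surjective M fun x => by
    obtain ⟨p, hp⟩ := hker x
    exact ⟨p, Subtype.ext hp⟩
  obtain ⟨p, rfl⟩ := LinearMap.rTensor_surjective M hl y
  have h0 : r.rTensor M (x - t.rTensor M p) = 0 := by
    rw [map_sub, hxy, sub_eq_zero, ← LinearMap.comp_apply, ← LinearMap.comp_apply,
      ← LinearMap.rTensor_comp, ← LinearMap.rTensor_comp, hw]
  obtain ⟨n, hn⟩ := (_root_.rTensor_exact M (LinearMap.exact_subtype_ker_map r) hr _).1 h0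
  obtain ⟨q, rfl⟩ := hj n
  refine ⟨p + (LinearMap.ker l).subtype.rTensor M q, ?_, ?_⟩
  · rw [← LinearMap.comp_apply, ← LinearMap.rTensor_comp] at hn
    rw [map_add, ← LinearMap.comp_apply, ← LinearMap.rTensor_comp,
      show t ∘ₗ (LinearMap.ker l).subtype = (LinearMap.ker r).subtype ∘ₗ j from rfl, hn]
    abel
  · have h1 := (_root_.rTensor_exact M (LinearMap.exact_subtype_ker_map l) hl _).2 ⟨q, rfl⟩
    rw [map_add, h1, add_zero]

/-- An element killed by `l ⊗ M` comes from `ker l ⊗ M`. As `t` is injective on `ker l`, flatness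
keeps `ker l ⊗ M → E ⊗ M` injective. -/
theorem Module.Flat.eq_zero_of_rTensor_of_pullback [Module.Flat R M] {t : P →ₗ[R] E}
    {l : P →ₗ[R] C} (hl : Function.Surjective l) (hinj : ∀ p, t p = 0 → l p = 0 → p = 0)
    (p : P ⊗[R] M) (ht : t.rTensor M p = 0) (hlp : l.rTensor M p = 0) : p = 0 := by
  obtain ⟨q, rfl⟩ := (_root_.rTensor_exact M (LinearMap.exact_subtype_ker_map l) hl p).1 hlp
  have hi : Function.Injective (t ∘ₗ (LinearMap.ker l).subtype) := by
    rw [injective_iff_map_eq_zero]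
    intro p hp
    exact Subtype.ext (hinj p.1 hp p.2)
  have h2 := Module.Flat.rTensor_preserves_injective_linearMap (M := M) _ hi
  have : q = 0 := by
    apply h2
    rw [LinearMap.rTensor_comp, LinearMap.comp_apply, ht, map_zero]
  rw [this, map_zero]

end FlatModules

namespace CDGA

variable {K : Type u} [Field K]

/-! ### Pull-backs of differential graded algebras -/

section Pullback

variable {E C D : CDGA K} (r : E ⟶ D) (b : C ⟶ D)

/-- The total space of the pull-back. -/
def pullbackSubalgebra : Subalgebra K (E.carrier × C.carrier) :=
  AlgHom.equalizer (r.toAlgHom.comp (AlgHom.fst K E.carrier C.carrier))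
    (b.toAlgHom.comp (AlgHom.snd K E.carrier C.carrier))

variable {r b} in
theorem mem_pullbackSubalgebra {z : E.carrier × C.carrier} :
    z ∈ pullbackSubalgebra r b ↔ r.toAlgHom z.1 = b.toAlgHom z.2 := Iff.rfl

/-- The grading of the pull-back. -/
def pullbackGrading (i : ℤ) : Submodule K (pullbackSubalgebra r b) :=
  ((E.deg i).prod (C.deg i)).comap (pullbackSubalgebra r b).val.toLinearMap

/-- The homogeneous components in the pull-back. -/
noncomputable def pullbackProj (i : ℤ) :
    pullbackSubalgebra r b →ₗ[K] pullbackSubalgebra r b :=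
  ((E.proj i).prodMap (C.proj i)).restrict
    (p := Subalgebra.toSubmodule (pullbackSubalgebra r b))
    (q := Subalgebra.toSubmodule (pullbackSubalgebra r b)) fun z hz => by
      change r.toAlgHom (E.proj i z.1) = b.toAlgHom (C.proj i z.2)
      rw [map_proj, map_proj, mem_pullbackSubalgebra.1 hz]

theorem isInternal_pullbackGrading : DirectSum.IsInternal (pullbackGrading r b) := by
  classical
  rw [DirectSum.isInternal_submodule_iff_iSupIndep_and_iSup_eq_top]
  constructor
  · intro i
    rw [Submodule.disjoint_def]
    intro z hz hz'
    have h1 : pullbackProj r b i z = z :=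
      Subtype.ext (Prod.ext (proj_of_mem hz.1) (proj_of_mem hz.2))
    have h2 : (⨆ (j : ℤ) (_ : j ≠ i), pullbackGrading r b j) ≤
        LinearMap.ker (pullbackProj r b i) := by
      refine iSup₂_le fun j hj z hz => ?_
      exact Subtype.ext (Prod.ext (proj_of_mem_ne hz.1 hj) (proj_of_mem_ne hz.2 hj))
    rw [← h1]
    exact h2 hz'
  · rw [eq_top_iff]
    intro z _
    -- One finite set of degrees that serves both coordinates.
    let T := (DirectSum.decompose E.deg z.1.1).support ∪ (DirectSum.decompose C.deg z.1.2).support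
    have key : ∀ (F : CDGA K) (x : F.carrier), (DirectSum.decompose F.deg x).support ⊆ T →
        ∑ i ∈ T, F.proj i x = x := by
      intro F x hT
      conv_rhs => rw [← DirectSum.sum_support_decompose F.deg x]
      refine (Finset.sum_subset hT fun i _ hi => ?_).symm
      rw [proj_apply, DFinsupp.notMem_support_iff.1 hi]
      rfl
    have hz : ∑ i ∈ T, pullbackProj r b i z = z := by
      refine Subtype.ext ?_
      rw [AddSubmonoidClass.coe_finsetSum]
      refine Prod.ext ?_ ?_
      · rw [Prod.fst_sum]
        exact key E _ Finset.subset_union_left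
      · rw [Prod.snd_sum]
        exact key C _ Finset.subset_union_right
    rw [← hz]
    exact Submodule.sum_mem _ fun i _ => (le_iSup (pullbackGrading r b) i)
      ⟨E.proj_mem _ _, C.proj_mem _ _⟩

/-- The pull-back of differential graded algebras. -/
def pullbackObj : CDGA K where
  carrier := pullbackSubalgebra r b
  deg := pullbackGrading r b
  isInternal := isInternal_pullbackGrading r b
  gradedMonoid :=
    { one_mem := ⟨E.gradedMonoid.one_mem, C.gradedMonoid.one_mem⟩
      mul_mem := fun _ _ _ _ hx hy =>
        ⟨E.gradedMonoid.mul_mem hx.1 hy.1, C.gradedMonoid.mul_mem hx.2 hy.2⟩ }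
  nonpos i hi := by
    rw [eq_bot_iff]
    intro z hz
    exact Subtype.ext (Prod.ext (eq_zero_of_mem hi hz.1) (eq_zero_of_mem hi hz.2))
  comm i j x y hx hy := by
    rw [Units.smul_def]
    exact Subtype.ext (Prod.ext (E.comm i j _ _ hx.1 hy.1) (C.comm i j _ _ hx.2 hy.2))
  d := (E.d.prodMap C.d).restrict
    (p := Subalgebra.toSubmodule (pullbackSubalgebra r b))
    (q := Subalgebra.toSubmodule (pullbackSubalgebra r b)) fun z hz => by
      change r.toAlgHom (E.d z.1) = b.toAlgHom (C.d z.2)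
      rw [r.map_d, b.map_d, mem_pullbackSubalgebra.1 hz]
  d_mem i x hx := ⟨E.d_mem i _ hx.1, C.d_mem i _ hx.2⟩
  d_d x := Subtype.ext (Prod.ext (E.d_d _) (C.d_d _))
  leibniz i x y hx := by
    rw [Units.smul_def]
    exact Subtype.ext (Prod.ext (E.leibniz i _ _ hx.1) (C.leibniz i _ _ hx.2))

/-- The first projection of the pull-back. -/
def pullbackFst : pullbackObj r b ⟶ E :=
  { toAlgHom := (AlgHom.fst K E.carrier C.carrier).comp (pullbackSubalgebra r b).val
    map_deg := fun _ _ hx => hx.1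
    map_d := fun _ => rfl }

/-- The second projection of the pull-back. -/
def pullbackSnd : pullbackObj r b ⟶ C :=
  { toAlgHom := (AlgHom.snd K E.carrier C.carrier).comp (pullbackSubalgebra r b).val
    map_deg := fun _ _ hx => hx.2
    map_d := fun _ => rfl }

variable {r b} in
/-- The morphism to the pull-back induced by a commutative square. -/
def pullbackLift {P : CDGA K} {t : P ⟶ E} {l : P ⟶ C} (w : t ≫ r = l ≫ b) :
    P ⟶ pullbackObj r b :=
  { toAlgHom := (t.toAlgHom.prod l.toAlgHom).codRestrict (pullbackSubalgebra r b) fun x =>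
      congrArg (fun φ : P ⟶ D => φ.toAlgHom x) w
    map_deg := fun i x hx => ⟨t.map_deg i x hx, l.map_deg i x hx⟩
    map_d := fun x => Subtype.ext (Prod.ext (t.map_d x) (l.map_d x)) }

theorem isPullback_pullbackObj :
    IsPullback (pullbackFst r b) (pullbackSnd r b) r b :=
  have w : pullbackFst r b ≫ r = pullbackSnd r b ≫ b := by ext z; exact z.2
  ⟨⟨w⟩, ⟨Limits.PullbackCone.IsLimit.mk w (fun c => pullbackLift c.condition)
    (fun _ => rfl) (fun _ => rfl) (fun c m h₁ h₂ => by
      ext x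
      exact Subtype.ext (Prod.ext (congrArg (fun φ : c.pt ⟶ E => φ.toAlgHom x) h₁)
        (congrArg (fun φ : c.pt ⟶ C => φ.toAlgHom x) h₂)))⟩⟩

instance : Limits.HasPullbacks (CDGA K) :=
  have : ∀ {E C D : CDGA K} {r : E ⟶ D} {b : C ⟶ D}, Limits.HasLimit (Limits.cospan r b) :=
    fun {_ _ _ r b} => (isPullback_pullbackObj r b).hasPullback
  Limits.hasPullbacks_of_hasLimit_cospan _

variable {r b}

theorem pullbackLift_bijective_iff {P : CDGA K} {t : P ⟶ E} {l : P ⟶ C} (w : t ≫ r = l ≫ b) :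
    Function.Bijective (pullbackLift w).toAlgHom ↔
      (∀ p, t.toAlgHom p = 0 → l.toAlgHom p = 0 → p = 0) ∧
      ∀ x y, r.toAlgHom x = b.toAlgHom y → ∃ p, t.toAlgHom p = x ∧ l.toAlgHom p = y := by
  refine and_congr ?_ ?_
  · rw [injective_iff_map_eq_zero]
    refine forall_congr' fun p => ?_
    rw [← and_imp]
    refine imp_congr_left ?_
    exact Subtype.ext_iff.trans Prod.ext_iff
  · constructor
    · intro h x y hxy
      obtain ⟨p, hp⟩ := h ⟨(x, y), hxy⟩
      exact ⟨p, congrArg (fun z => z.1.1) hp, congrArg (fun z => z.1.2) hp⟩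
    · rintro h ⟨⟨x, y⟩, hxy⟩
      obtain ⟨p, rfl, rfl⟩ := h x y hxy
      exact ⟨p, rfl⟩

/-- Comparison with the explicit pull-back turns the universal property into two statements about
linear maps, which can be tested after tensoring. -/
theorem isPullback_iff {P : CDGA K} {t : P ⟶ E} {l : P ⟶ C} (w : t ≫ r = l ≫ b) :
    IsPullback t l r b ↔
      (∀ p, t.toAlgHom p = 0 → l.toAlgHom p = 0 → p = 0) ∧
      ∀ x y, r.toAlgHom x = b.toAlgHom y → ∃ p, t.toAlgHom p = x ∧ l.toAlgHom p = y := by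
  rw [← pullbackLift_bijective_iff w]
  constructor
  · intro h
    have hl : pullbackLift w = (h.isoIsPullback _ _ (isPullback_pullbackObj r b)).hom := by
      apply (isPullback_pullbackObj r b).hom_ext
      · rw [IsPullback.isoIsPullback_hom_fst]; rfl
      · rw [IsPullback.isoIsPullback_hom_snd]; rfl
    rw [hl]
    exact bijective_of_isIso _
  · intro h
    have := isIso_of_bijective _ h
    exact (isPullback_pullbackObj r b).of_iso (asIso (pullbackLift w)).symm (Iso.refl _)
      (Iso.refl _) (Iso.refl _)
      (by rw [Iso.symm_hom, Iso.eq_inv_comp, Iso.refl_hom, Category.comp_id]; rfl)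
      (by rw [Iso.symm_hom, Iso.eq_inv_comp, Iso.refl_hom, Category.comp_id]; rfl)
      (by simp) (by simp)

end Pullback

theorem isPullback_under_iff {A : CDGA K} {P E C D : Under A} {t : P ⟶ E} {l : P ⟶ C} {r : E ⟶ D}
    {b : C ⟶ D} (w : t ≫ r = l ≫ b) :
    IsPullback t l r b ↔ IsPullback t.right l.right r.right b.right :=
  ⟨fun h => h.map (Under.forget A), fun h => IsPullback.of_map (Under.forget A) w h⟩

end CDGA

namespace CDGA

open scoped TensorProduct

variable {K : Type u} [Field K] {A : Type u} [CommRing A] [Algebra K A]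

/-! ### Classically flat algebras are flat -/

section PushoutSquare

variable {E E' B G G' : CDGA K} {s : ofAlgebra K A ⟶ E} {s' : ofAlgebra K A ⟶ E'}
  {f : ofAlgebra K A ⟶ B} {e : E ⟶ G} {e' : E' ⟶ G'} {h : B ⟶ G} {h' : B ⟶ G'}
  (w : s ≫ e = f ≫ h) (w' : s' ≫ e' = f ≫ h')

/-- A morphism under `A`, as a linear map over `A`. -/
abbrev Total.mapLinear (g : E ⟶ E') (hg : s ≫ g = s') : Total s →ₗ[A] Total s' :=
  (Total.map g hg).toLinearMap

theorem map_mulMap {g : E ⟶ E'} (hg : s ≫ g = s') {g' : G ⟶ G'} (hge : e ≫ g' = g ≫ e')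
    (hgh : h ≫ g' = h') (z : Total s ⊗[A] Total f) :
    g'.toAlgHom (mulMap w z) = mulMap w' ((Total.mapLinear g hg).rTensor (Total f) z) := by
  induction z using TensorProduct.induction_on with
  | zero =>
    rw [map_zero, map_zero]
    exact (map_zero g'.toAlgHom).trans (map_zero (mulMap w')).symm
  | add x y hx hy =>
    rw [map_add, map_add]
    exact (map_add g'.toAlgHom _ _).trans
      ((congrArg₂ (· + ·) hx hy).trans (map_add (mulMap w') _ _).symm)
  | tmul x b =>
    refine (map_mul g'.toAlgHom _ _).trans ?_
    exact congrArg₂ (· * ·) (congrArg (fun φ : E ⟶ G' => φ.toAlgHom x) hge)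
      (congrArg (fun φ : B ⟶ G' => φ.toAlgHom b) hgh)

/-- When `B` has zero differential the signed term of the Leibniz rule disappears, so the
differential of the push-out is that of `E` tensored with the identity. -/
theorem diff_mulMap_of_diff_eq_zero (hf : Total.diff f = 0) (z : Total s ⊗[A] Total f) :
    Total.diff (s ≫ e) (mulMap w z) = mulMap w ((Total.diff s).rTensor (Total f) z) := by
  induction z using TensorProduct.induction_on with
  | zero => simp only [map_zero]
  | add x y hx hy => simp only [map_add, hx, hy]
  | tmul x b =>
    induction x using DirectSum.Decomposition.inductionOn (Total.gr s) with
    | zero => simp only [TensorProduct.zero_tmul, map_zero]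
    | add x y hx hy => simp only [TensorProduct.add_tmul, map_add, hx, hy]
    | homogeneous x =>
      rw [diff_mulMap_tmul w x.2, hf, LinearMap.zero_apply, TensorProduct.tmul_zero, map_zero,
        smul_zero, add_zero, LinearMap.rTensor_tmul]

theorem rTensor_eq_zero {g : E ⟶ E'} (hg : s ≫ g = s') {g' : G ⟶ G'} (hge : e ≫ g' = g ≫ e')
    (hgh : h ≫ g' = h') (hp' : IsPushout s' f e' h') {z : Total s ⊗[A] Total f}
    (hz : g'.toAlgHom (mulMap w z) = 0) :
    (Total.mapLinear g hg).rTensor (Total f) z = 0 := by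
  apply (mulMap_bijective hp').1
  rw [map_zero]
  exact (map_mulMap w hp'.w hg hge hgh z).symm.trans hz

/-- Surjectivity survives tensoring by right exactness, and acyclicity of the kernel survives by
`Module.Flat.acyclic_rTensor`. -/
theorem trivialFibrations_of_flat [Module.Flat A (Total f)] (hf : Total.diff f = 0)
    (hp : IsPushout s f e h) (hp' : IsPushout s' f e' h') {r : E ⟶ E'} (hr : s ≫ r = s')
    {r' : G ⟶ G'} (hre : e ≫ r' = r ≫ e') (hrh : h ≫ r' = h')
    (htf : trivialFibrations (CDGA K) r) : trivialFibrations (CDGA K) r' := by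
  obtain ⟨hs, ha⟩ := (trivialFibrations_iff r).1 htf
  refine (trivialFibrations_iff r').2 ⟨fun y => ?_, fun y hy hdy => ?_⟩
  · obtain ⟨z, rfl⟩ := (mulMap_bijective hp').2 y
    obtain ⟨z, rfl⟩ := LinearMap.rTensor_surjective (Total f) (g := Total.mapLinear r hr) hs z
    exact ⟨mulMap hp.w z, map_mulMap hp.w hp'.w hr hre hrh z⟩
  · obtain ⟨z, rfl⟩ := (mulMap_bijective hp).2 y
    have hz := rTensor_eq_zero hp.w hr hre hrh hp' hy
    have hdz : (Total.diff s).rTensor (Total f) z = 0 := by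
      apply (mulMap_bijective hp).1
      rw [map_zero]
      exact (diff_mulMap_of_diff_eq_zero hp.w hf z).symm.trans hdy
    obtain ⟨t, ht, hdt⟩ := Module.Flat.acyclic_rTensor (r := Total.mapLinear r hr) hs
      (dE := Total.diff s) (dD := Total.diff s') (LinearMap.ext r.map_d) (LinearMap.ext E.d_d) ha
      z hz hdz
    refine ⟨mulMap hp.w t, ?_, ?_⟩
    · refine (map_mulMap hp.w hp'.w hr hre hrh t).trans ?_
      rw [ht, map_zero]
      rfl
    · refine (diff_mulMap_of_diff_eq_zero hp.w hf t).trans ?_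
      rw [hdt]

end PushoutSquare

section Square

variable {P E C D P' E' C' D' B : CDGA K} {sP : ofAlgebra K A ⟶ P} {sE : ofAlgebra K A ⟶ E}
  {sC : ofAlgebra K A ⟶ C} {sD : ofAlgebra K A ⟶ D} {f : ofAlgebra K A ⟶ B}
  {p : P ⟶ P'} {e : E ⟶ E'} {c : C ⟶ C'} {d : D ⟶ D'}
  {hP : B ⟶ P'} {hE : B ⟶ E'} {hC : B ⟶ C'} {hD : B ⟶ D'}

theorem pushout_square_comm (pP : IsPushout sP f p hP) {t : P ⟶ E} {l : P ⟶ C} {r : E ⟶ D}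
    {b : C ⟶ D} (w : t ≫ r = l ≫ b) {t' : P' ⟶ E'} {l' : P' ⟶ C'} {r' : E' ⟶ D'} {b' : C' ⟶ D'}
    (ht' : p ≫ t' = t ≫ e) (hl' : p ≫ l' = l ≫ c) (hr' : e ≫ r' = r ≫ d) (hb' : c ≫ b' = b ≫ d)
    (kt : hP ≫ t' = hE) (kl : hP ≫ l' = hC) (kr : hE ≫ r' = hD) (kb : hC ≫ b' = hD) :
    t' ≫ r' = l' ≫ b' := by
  apply pP.hom_ext
  · rw [reassoc_of% ht', hr', reassoc_of% hl', hb', reassoc_of% w]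
  · rw [reassoc_of% kt, kr, reassoc_of% kl, kb]

/-- Through `mulMap` the square becomes the original one tensored with a flat module. Surjectivity
of `r` then lets the two lemmas on tensored pull-backs of modules apply. -/
theorem isPullback_of_flat [Module.Flat A (Total f)]
    (pP : IsPushout sP f p hP) (pE : IsPushout sE f e hE) (pC : IsPushout sC f c hC)
    (pD : IsPushout sD f d hD) {t : P ⟶ E} {l : P ⟶ C} {r : E ⟶ D} {b : C ⟶ D}
    (ht : sP ≫ t = sE) (hl : sP ≫ l = sC) (hr : sE ≫ r = sD) (hb : sC ≫ b = sD)
    (hpb : IsPullback t l r b) (hsurj : Function.Surjective r.toAlgHom)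
    {t' : P' ⟶ E'} {l' : P' ⟶ C'} {r' : E' ⟶ D'} {b' : C' ⟶ D'}
    (ht' : p ≫ t' = t ≫ e) (hl' : p ≫ l' = l ≫ c) (hr' : e ≫ r' = r ≫ d) (hb' : c ≫ b' = b ≫ d)
    (kt : hP ≫ t' = hE) (kl : hP ≫ l' = hC) (kr : hE ≫ r' = hD) (kb : hC ≫ b' = hD) :
    IsPullback t' l' r' b' := by
  have hw := pushout_square_comm pP hpb.w ht' hl' hr' hb' kt kl kr kb
  obtain ⟨hinj, hex⟩ := (isPullback_iff hpb.w).1 hpb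
  have hls : Function.Surjective l.toAlgHom := by
    intro y
    obtain ⟨x, hx⟩ := hsurj (b.toAlgHom y)
    obtain ⟨q, -, hq⟩ := hex x y hx
    exact ⟨q, hq⟩
  refine (isPullback_iff hw).2 ⟨fun q hq₁ hq₂ => ?_, fun x y hxy => ?_⟩
  · obtain ⟨z, rfl⟩ := (mulMap_bijective pP).2 q
    have := Module.Flat.eq_zero_of_rTensor_of_pullback (t := Total.mapLinear t ht)
      (l := Total.mapLinear l hl) hls hinj z (rTensor_eq_zero pP.w ht ht' kt pE hq₁)
      (rTensor_eq_zero pP.w hl hl' kl pC hq₂)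
    rw [this, map_zero]
    rfl
  · obtain ⟨x, rfl⟩ := (mulMap_bijective pE).2 x
    obtain ⟨y, rfl⟩ := (mulMap_bijective pC).2 y
    have hxy' : (Total.mapLinear r hr).rTensor (Total f) x =
        (Total.mapLinear b hb).rTensor (Total f) y := by
      apply (mulMap_bijective pD).1
      exact (map_mulMap pE.w pD.w hr hr' kr x).symm.trans
        (hxy.trans (map_mulMap pC.w pD.w hb hb' kb y))
    obtain ⟨q, rfl, rfl⟩ := exists_rTensor_of_pullback (t := Total.mapLinear t ht)
      (l := Total.mapLinear l hl) (r := Total.mapLinear r hr) (b := Total.mapLinear b hb) hsurj hex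
      (LinearMap.ext fun q => congrArg (fun φ : P ⟶ D => φ.toAlgHom q) hpb.w) x y hxy'
    exact ⟨mulMap pP.w q, map_mulMap pP.w pE.w ht ht' kt q, map_mulMap pP.w pC.w hl hl' kl q⟩

end Square

/-- A flat homomorphism of algebras is flat as a morphism of differential graded algebras. -/
theorem isFlatMorphism_ofAlgHom {R : Type u} [CommRing R] [Algebra K R] (φ : A →ₐ[K] R)
    (hφ : φ.toRingHom.Flat) : IsFlatMorphism (ofAlgHom φ) := by
  have : Module.Flat A (Total (ofAlgHom φ)) := hφ
  intro P E C D t l r b hpb hr P' E' C' D' p e c d pP pE pC pD t' l' r' b' ht' hl' hr' hb'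
  have hw : t' ≫ r' = l' ≫ b' := by
    apply Under.UnderMorphism.ext
    exact pushout_square_comm pP ((isPullback_under_iff hpb.w).1 hpb).w ht' hl' hr' hb'
      (Under.w t') (Under.w l') (Under.w r') (Under.w b')
  refine ⟨(isPullback_under_iff hw).2 ?_, ?_⟩
  · exact isPullback_of_flat pP pE pC pD (Under.w t) (Under.w l) (Under.w r) (Under.w b)
      ((isPullback_under_iff hpb.w).1 hpb) (surjective_of_trivialFibrations hr) ht' hl' hr' hb'
      (Under.w t') (Under.w l') (Under.w r') (Under.w b')
  · exact trivialFibrations_of_flat (f := ofAlgHom φ) rfl pE pD (Under.w r) hr' (Under.w r') hr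

end CDGA

/-! ### Complexes with vanishing cohomology in negative degrees -/

section NegExact

open scoped TensorProduct

variable {A : Type u} [CommRing A] {N : Type u} [AddCommGroup N] [Module A N]

/-- The cohomology of the complex `M ⊗ N` vanishes in negative degrees, where `d` is the
differential of `N` and `π` the projection to degree zero. -/
def NegExact (d π : N →ₗ[A] N) (M : Type u) [AddCommGroup M] [Module A M] : Prop :=
  ∀ z : M ⊗[A] N, d.lTensor M z = 0 → π.lTensor M z = 0 → ∃ y, d.lTensor M y = z

/-- The kernel of the map from the cone of `M₂ ⊗ N ⟶ M₁ ⊗ N` to `M₃ ⊗ N` is acyclic. -/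
def ConeExact (d : N →ₗ[A] N) {M₁ M₂ M₃ : Type u} [AddCommGroup M₁] [AddCommGroup M₂]
    [AddCommGroup M₃] [Module A M₁] [Module A M₂] [Module A M₃] (ι : M₂ →ₗ[A] M₁)
    (q : M₁ →ₗ[A] M₃) : Prop :=
  ∀ u v, q.rTensor N u = 0 → d.lTensor M₁ u + ι.rTensor N v = 0 → d.lTensor M₂ v = 0 →
    ∃ u' v', d.lTensor M₁ u' + ι.rTensor N v' = u ∧ - d.lTensor M₂ v' = v

variable {M M' M₁ M₂ M₃ : Type u} [AddCommGroup M] [AddCommGroup M'] [AddCommGroup M₁]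
  [AddCommGroup M₂] [AddCommGroup M₃] [Module A M] [Module A M'] [Module A M₁] [Module A M₂]
  [Module A M₃] {d π ρ : N →ₗ[A] N} {ι : M₂ →ₗ[A] M₁} {q : M₁ →ₗ[A] M₃}

theorem lTensor_rTensor_apply {N' : Type u} [AddCommGroup N'] [Module A N'] (g : N →ₗ[A] N')
    (h : M →ₗ[A] M') (z : M ⊗[A] N) :
    g.lTensor M' (h.rTensor N z) = h.rTensor N' (g.lTensor M z) := by
  rw [← LinearMap.comp_apply, ← LinearMap.comp_apply, LinearMap.lTensor_comp_rTensor,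
    LinearMap.rTensor_comp_lTensor]

theorem lTensor_lTensor_eq_zero {N' N'' : Type u} [AddCommGroup N'] [Module A N']
    [AddCommGroup N''] [Module A N''] {g : N →ₗ[A] N'} {h : N' →ₗ[A] N''} (hgh : h ∘ₗ g = 0)
    (z : M ⊗[A] N) : h.lTensor M (g.lTensor M z) = 0 := by
  rw [← LinearMap.comp_apply, ← LinearMap.lTensor_comp, hgh, LinearMap.lTensor_zero,
    LinearMap.zero_apply]

theorem NegExact.of_linearEquiv (h : NegExact d π M) (e : M ≃ₗ[A] M') : NegExact d π M' := by
  intro z hz hz'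
  obtain ⟨y, hy⟩ := h (e.symm.toLinearMap.rTensor N z)
    (by rw [lTensor_rTensor_apply, hz, map_zero]) (by rw [lTensor_rTensor_apply, hz', map_zero])
  refine ⟨e.toLinearMap.rTensor N y, ?_⟩
  rw [lTensor_rTensor_apply, hy, ← LinearMap.comp_apply, ← LinearMap.rTensor_comp,
    LinearEquiv.comp_symm, LinearMap.rTensor_id, LinearMap.id_apply]

/-- This is the step from the outer terms to the middle one in the long exact cohomology sequence.
Since elements need not be homogeneous, the last lines remove a stray component of degree zero; `ρ`
stands for the projection to degree `-1`. -/
theorem NegExact.of_coneExact (hι : NegExact d π M₂) (hq : NegExact d π M₃)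
    (hc : ConeExact d ι q) (hs : Function.Surjective q) (hdd : d ∘ₗ d = 0) (hdπ : d ∘ₗ π = 0)
    (hππ : π ∘ₗ π = π) (hπd : π ∘ₗ d = d ∘ₗ ρ) : NegExact d π M₁ := by
  intro z hz hz'
  obtain ⟨w, hw⟩ := hq (q.rTensor N z) (by rw [lTensor_rTensor_apply, hz, map_zero])
    (by rw [lTensor_rTensor_apply, hz', map_zero])
  obtain ⟨w, rfl⟩ := LinearMap.rTensor_surjective N hs w
  -- After subtracting `d w` the cocycle dies in `M₃ ⊗ N`, so it is a boundary in the cone, with a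
  -- cocycle `v` of `M₂ ⊗ N` as second coordinate.
  obtain ⟨u, v, huv, hv⟩ := hc (z - d.lTensor M₁ w) 0
    (by rw [map_sub, ← hw, lTensor_rTensor_apply, sub_self])
    (by rw [map_sub, hz, lTensor_lTensor_eq_zero hdd, map_zero, sub_zero, add_zero])
    (map_zero _)
  rw [neg_eq_zero] at hv
  have hππ' : π.lTensor M₂ (π.lTensor M₂ v) = π.lTensor M₂ v := by
    rw [← LinearMap.comp_apply, ← LinearMap.lTensor_comp, hππ]
  -- Only the part of `v` outside degree zero is known to be exact.
  obtain ⟨v', hv'⟩ := hι (v - π.lTensor M₂ v)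
    (by rw [map_sub, hv, lTensor_lTensor_eq_zero hdπ, sub_zero])
    (by rw [map_sub, hππ', sub_self])
  set y := w + u + ι.rTensor N v' with hy
  have hzy : z = d.lTensor M₁ y + π.lTensor M₁ (ι.rTensor N v) := by
    have hz3 : z = d.lTensor M₁ w + (d.lTensor M₁ u + ι.rTensor N v) := by rw [huv]; abel
    conv_lhs => rw [hz3]
    rw [hy, map_add, map_add, lTensor_rTensor_apply, hv', map_sub, lTensor_rTensor_apply]
    abel
  -- Since `z` has no component in degree zero, applying `π` to the formula for `z` shows that the
  -- remaining term is itself a coboundary.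
  have h1 : π.lTensor M₁ (ι.rTensor N v) = - d.lTensor M₁ (ρ.lTensor M₁ y) := by
    have h2 := congrArg (π.lTensor M₁) hzy
    rw [hz', map_add, ← LinearMap.lTensor_comp_apply, ← LinearMap.lTensor_comp_apply, hππ, hπd,
      LinearMap.lTensor_comp_apply] at h2
    exact (neg_eq_of_add_eq_zero_right h2.symm).symm
  refine ⟨y - ρ.lTensor M₁ y, ?_⟩
  rw [map_sub, sub_eq_add_neg, ← h1, ← hzy]

/-- The injectivity of `M₂ ⊗ H ⟶ A ⊗ H`, where `H` is the zeroth cohomology of `N`. -/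
theorem ConeExact.rTensor_injective {H : Type u} [AddCommGroup H] [Module A H] {p : N →ₗ[A] H}
    {ι : M₂ →ₗ[A] A} {q : A →ₗ[A] M₃} (hc : ConeExact d ι q) (hq : NegExact d π M₃)
    (hs : Function.Surjective q) (hqι : q ∘ₗ ι = 0) (hdd : d ∘ₗ d = 0) (hdπ : d ∘ₗ π = 0)
    (hp : Function.Surjective p) (hpd : p ∘ₗ d = 0) (hpπ : p ∘ₗ π = p)
    (hker : ∀ x, p x = 0 → ∃ y, π y = 0 ∧ d y = π x) :
    Function.Injective (ι.rTensor H) := by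
  rw [injective_iff_map_eq_zero]
  intro v hv
  obtain ⟨w, rfl⟩ := LinearMap.lTensor_surjective M₂ hp v
  rw [← lTensor_rTensor_apply] at hv
  -- As `M₁ = A`, the tensor `ι w` is `1 ⊗ x`. Its class in `H` vanishes, so its degree zero
  -- component is the differential of some `b` without component in degree zero.
  obtain ⟨b, hb, hdb⟩ : ∃ b, π.lTensor A b = 0 ∧
      d.lTensor A b = ι.rTensor N (π.lTensor M₂ w) := by
    obtain ⟨x, hx⟩ : ∃ x, ι.rTensor N w = 1 ⊗ₜ[A] x :=
      ⟨TensorProduct.lid A N (ι.rTensor N w), ((TensorProduct.lid A N).symm_apply_apply _).symm⟩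
    rw [hx, LinearMap.lTensor_tmul] at hv
    have hpx : p x = 0 := by
      have := congrArg (TensorProduct.lid A H) hv
      rwa [TensorProduct.lid_tmul, one_smul, map_zero] at this
    obtain ⟨y, hy, hdy⟩ := hker x hpx
    refine ⟨1 ⊗ₜ[A] y, ?_, ?_⟩
    · rw [LinearMap.lTensor_tmul, hy, TensorProduct.tmul_zero]
    · rw [← lTensor_rTensor_apply, hx, LinearMap.lTensor_tmul, LinearMap.lTensor_tmul, hdy]
  -- The image of `b` in `M₃ ⊗ N` is a cocycle outside degree zero, hence exact; this is where
  -- vanishing of `H⁻¹` enters.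
  obtain ⟨c, hc'⟩ := hq (q.rTensor N b)
    (by rw [lTensor_rTensor_apply, hdb, ← LinearMap.comp_apply, ← LinearMap.rTensor_comp, hqι,
      LinearMap.rTensor_zero, LinearMap.zero_apply])
    (by rw [lTensor_rTensor_apply, hb, map_zero])
  obtain ⟨c, rfl⟩ := LinearMap.rTensor_surjective N hs c
  rw [lTensor_rTensor_apply] at hc'
  -- The pair `(d c - b, π w)` is a cocycle of the cone lying over zero, so `π w` is a coboundary
  -- and its class in `M₂ ⊗ H` is zero.
  obtain ⟨_, v', -, hv'⟩ := hc (d.lTensor A c - b) (π.lTensor M₂ w)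
    (by rw [map_sub, hc', sub_self])
    (by rw [map_sub, lTensor_lTensor_eq_zero hdd, hdb, zero_sub, neg_add_cancel])
    (lTensor_lTensor_eq_zero hdπ w)
  have h1 : p.lTensor M₂ w = p.lTensor M₂ (π.lTensor M₂ w) := by
    rw [← LinearMap.comp_apply, ← LinearMap.lTensor_comp, hpπ]
  rw [h1, ← hv', map_neg, lTensor_lTensor_eq_zero hpd, neg_zero]

end NegExact

/-! ### Local Artinian rings -/

section Artinian

variable {A : Type u} [CommRing A] [IsLocalRing A]

/-- The maximal ideal is nilpotent. Take the least power whose image in `R` is zero; any nonzero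
image of an element of the preceding power will do. -/
theorem exists_socle_element [IsArtinianRing A] {R : Type u} [CommRing R] [Algebra A R] [Nontrivial R] :
    ∃ t : R, t ≠ 0 ∧ ∀ a ∈ IsLocalRing.maximalIdeal A, a • t = 0 := by
  classical
  let m := IsLocalRing.maximalIdeal A
  obtain ⟨n, hn⟩ : IsNilpotent m := by
    have := IsArtinianRing.isNilpotent_jacobson_bot (R := A)
    rwa [IsLocalRing.jacobson_eq_maximalIdeal ⊥ bot_ne_top] at this
  have hex : ∃ k, ∀ a ∈ m ^ k, algebraMap A R a = 0 := ⟨n, fun a ha => by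
    rw [hn] at ha
    rw [(Submodule.mem_bot A).1 ha, map_zero]⟩
  have hk := Nat.find_spec hex
  have hmin := fun k => Nat.find_min hex (m := k)
  -- The exponent zero is excluded because it would make `1` vanish in `R`.
  rcases h : Nat.find hex with _ | k
  · rw [h] at hk
    have := hk 1 (by rw [pow_zero, Ideal.one_eq_top]; trivial)
    rw [map_one] at this
    exact absurd this one_ne_zero
  · rw [h] at hk
    have h2 := hmin k (by omega)
    push Not at h2
    obtain ⟨b, hb, hb0⟩ := h2
    refine ⟨algebraMap A R b, hb0, fun a ha => ?_⟩
    rw [Algebra.smul_def, ← map_mul]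
    refine hk _ ?_
    rw [pow_succ']
    exact Ideal.mul_mem_mul ha hb

/-- The ideal generated by a nonzero element killed by the maximal ideal is isomorphic to the
residue field. -/
theorem nonempty_linearEquiv_span {R L : Type u} [CommRing R] [Algebra A R]
    (hR : Function.Surjective (algebraMap A R)) {t : R} (ht : t ≠ 0)
    (hm : ∀ a ∈ IsLocalRing.maximalIdeal A, a • t = 0) [AddCommGroup L] [Module A L]
    {g : A →ₗ[A] L} (hg : Function.Surjective g)
    (hgm : LinearMap.ker g = IsLocalRing.maximalIdeal A) :
    Nonempty (L ≃ₗ[A] Ideal.span {t}) := by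
  have htm : t ∈ Ideal.span {t} := Ideal.mem_span_singleton_self t
  let h : A →ₗ[A] Ideal.span {t} := LinearMap.toSpanSingleton A _ ⟨t, htm⟩
  have hh : Function.Surjective h := by
    rintro ⟨x, hx⟩
    obtain ⟨r, rfl⟩ := Ideal.mem_span_singleton'.1 hx
    obtain ⟨a, rfl⟩ := hR r
    exact ⟨a, Subtype.ext (Algebra.smul_def a t)⟩
  have hker : LinearMap.ker h = IsLocalRing.maximalIdeal A := by
    refine le_antisymm (IsLocalRing.le_maximalIdeal fun htop => ?_)
      fun a ha => Subtype.ext (hm a ha)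
    have h1 : (1 : A) ∈ LinearMap.ker h := by rw [htop]; trivial
    have h2 : (1 : A) • t = 0 := congrArg Subtype.val (LinearMap.mem_ker.1 h1)
    rw [one_smul] at h2
    exact ht h2
  exact ⟨((g.quotKerEquivOfSurjective hg).symm.trans
    (Submodule.quotEquivOfEq _ _ (hgm.trans hker.symm))).trans
    (h.quotKerEquivOfSurjective hh)⟩

end Artinian

namespace CDGA

open scoped TensorProduct

variable (K : Type u) [Field K]

/-! ### The cone of an ideal -/

section Cone

variable {R : Type u} [CommRing R] [Algebra K R] (J : Ideal R)

/-- The grading of the trivial square zero extension `R ⊕ J` with `R` in degree zero and `J` in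
degree `-1`. -/
def coneGrading (i : ℤ) : Submodule K (TrivSqZeroExt R J) where
  carrier := {x | (i ≠ 0 → x.fst = 0) ∧ (i ≠ -1 → x.snd = 0)}
  add_mem' hx hy := ⟨fun h => by rw [TrivSqZeroExt.fst_add, hx.1 h, hy.1 h, add_zero],
    fun h => by rw [TrivSqZeroExt.snd_add, hx.2 h, hy.2 h, add_zero]⟩
  zero_mem' := ⟨fun _ => rfl, fun _ => rfl⟩
  smul_mem' c x hx := ⟨fun h => by rw [TrivSqZeroExt.fst_smul, hx.1 h, smul_zero],
    fun h => by rw [TrivSqZeroExt.snd_smul, hx.2 h, smul_zero]⟩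

theorem inl_mem_coneGrading (a : R) : TrivSqZeroExt.inl a ∈ coneGrading K J 0 :=
  ⟨fun h => absurd rfl h, fun _ => rfl⟩

theorem inr_mem_coneGrading (x : J) : TrivSqZeroExt.inr x ∈ coneGrading K J (-1) :=
  ⟨fun _ => rfl, fun h => absurd rfl h⟩

theorem isInternal_coneGrading : DirectSum.IsInternal (coneGrading K J) := by
  rw [DirectSum.isInternal_submodule_iff_iSupIndep_and_iSup_eq_top]
  constructor
  · intro i
    rw [Submodule.disjoint_def]
    intro x hx hx'
    have hle : (⨆ (j : ℤ) (_ : j ≠ i), coneGrading K J j) ≤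
        { carrier := {x | (i = 0 → x.fst = 0) ∧ (i = -1 → x.snd = 0)}
          add_mem' := fun hx hy => ⟨fun h => by rw [TrivSqZeroExt.fst_add, hx.1 h, hy.1 h, add_zero],
            fun h => by rw [TrivSqZeroExt.snd_add, hx.2 h, hy.2 h, add_zero]⟩
          zero_mem' := ⟨fun _ => rfl, fun _ => rfl⟩
          smul_mem' := fun c x hx =>
            ⟨fun h => by rw [TrivSqZeroExt.fst_smul, hx.1 h, smul_zero],
              fun h => by rw [TrivSqZeroExt.snd_smul, hx.2 h, smul_zero]⟩ } :=
      iSup₂_le fun j hj x hx => ⟨fun h => hx.1 (h ▸ hj), fun h => hx.2 (h ▸ hj)⟩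
    have h := hle hx'
    refine TrivSqZeroExt.ext ?_ ?_
    · by_cases hi : i = 0
      · exact h.1 hi
      · exact hx.1 hi
    · by_cases hi : i = -1
      · exact h.2 hi
      · exact hx.2 hi
  · rw [eq_top_iff]
    intro x _
    rw [← TrivSqZeroExt.inl_fst_add_inr_snd_eq x]
    exact add_mem ((le_iSup (coneGrading K J) 0) (inl_mem_coneGrading K J _))
      ((le_iSup (coneGrading K J) (-1)) (inr_mem_coneGrading K J _))

/-- The differential of the cone. -/
def coneDiff : TrivSqZeroExt R J →ₗ[K] TrivSqZeroExt R J where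
  toFun x := TrivSqZeroExt.inl (x.snd : R)
  map_add' _ _ := TrivSqZeroExt.inl_add _ _ _
  map_smul' _ _ := TrivSqZeroExt.inl_smul _ _ _

theorem coneDiff_apply (x : TrivSqZeroExt R J) :
    coneDiff K J x = TrivSqZeroExt.inl (x.snd : R) := rfl

variable {J} in
theorem coneDiff_mul {i : ℤ} {x : TrivSqZeroExt R J} (hx : x ∈ coneGrading K J i)
    (y : TrivSqZeroExt R J) :
    coneDiff K J (x * y) = coneDiff K J x * y + i.negOnePow • (x * coneDiff K J y) := by
  simp only [coneDiff_apply]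
  have hfst : ((x * y).snd : R) = x.fst * y.snd + y.fst * x.snd := by
    rw [TrivSqZeroExt.snd_mul, op_smul_eq_smul]; rfl
  by_cases hi : i = 0
  · have hx2 : x.snd = 0 := hx.2 (by omega)
    rw [hfst, hx2, hi, Int.negOnePow_zero, one_smul]
    refine TrivSqZeroExt.ext ?_ ?_ <;> simp [hx2]
  · have hx1 : x.fst = 0 := hx.1 hi
    by_cases hi' : i = -1
    · rw [hfst, hx1, hi', Int.negOnePow_neg, Int.negOnePow_one, Units.neg_smul, one_smul]
      refine TrivSqZeroExt.ext ?_ (Subtype.ext ?_)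
      · simp [hx1, mul_comm]
      · simp [mul_comm]
    · have hx2 : x.snd = 0 := hx.2 hi'
      have hx0 : x = 0 := TrivSqZeroExt.ext hx1 hx2
      rw [hx0]
      simp

/-- The cone of the inclusion of the ideal `J` in `R`, as a differential graded algebra. -/
def cone : CDGA K where
  carrier := TrivSqZeroExt R J
  deg := coneGrading K J
  isInternal := isInternal_coneGrading K J
  gradedMonoid :=
    { one_mem := inl_mem_coneGrading K J 1
      mul_mem := fun i j x y hx hy => by
        constructor
        · intro h
          rw [TrivSqZeroExt.fst_mul]
          by_cases hi : i = 0
          · rw [hy.1 (by omega), mul_zero]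
          · rw [hx.1 hi, zero_mul]
        · intro h
          rw [TrivSqZeroExt.snd_mul]
          have h1 : x.fst • y.snd = 0 := by
            by_cases hi : i = 0
            · rw [hy.2 (by omega), smul_zero]
            · rw [hx.1 hi, zero_smul]
          have h2 : y.fst • x.snd = 0 := by
            by_cases hj : j = 0
            · rw [hx.2 (by omega), smul_zero]
            · rw [hy.1 hj, zero_smul]
          rw [h1, op_smul_eq_smul, h2, add_zero] }
  nonpos i hi := by
    rw [eq_bot_iff]
    intro x hx
    exact TrivSqZeroExt.ext (hx.1 (by omega)) (hx.2 (by omega))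
  comm i j x y hx hy := by
    by_cases h : i = 0 ∨ j = 0
    · have : i * j = 0 := by rcases h with rfl | rfl <;> simp
      rw [this, Int.negOnePow_zero, one_smul, mul_comm]
    · push Not at h
      have h0 : x * y = 0 := by
        refine TrivSqZeroExt.ext ?_ ?_
        · rw [TrivSqZeroExt.fst_mul, hx.1 h.1, zero_mul]; rfl
        · rw [TrivSqZeroExt.snd_mul, hx.1 h.1, hy.1 h.2, zero_smul, op_smul_eq_smul, zero_smul,
            add_zero]; rfl
      rw [mul_comm y x, h0, smul_zero]
  d := coneDiff K J
  d_mem i x hx := ⟨fun h => by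
    have : x.snd = 0 := hx.2 (by omega)
    change (x.snd : R) = 0
    rw [this]; rfl, fun _ => rfl⟩
  d_d x := rfl
  leibniz i x y hx := coneDiff_mul K hx y

/-- The projection of the cone to the quotient by the ideal. -/
def coneToQuotient : cone K J ⟶ ofAlgebra K (R ⧸ J) :=
  homOfAlgHom (E := cone K J) ((Ideal.Quotient.mkₐ K J).comp (TrivSqZeroExt.fstHom K R J))
    (fun i x hx hi => by
      have h : (show TrivSqZeroExt R J from x).fst = 0 := hx.1 hi
      change Ideal.Quotient.mk J (show TrivSqZeroExt R J from x).fst = 0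
      rw [h, map_zero])
    fun x => Ideal.Quotient.eq_zero_iff_mem.2 (show TrivSqZeroExt R J from x).snd.2

/-- The kernel is `J` in degrees `-1` and `0` with the identity as differential. -/
theorem trivialFibrations_coneToQuotient :
    trivialFibrations (CDGA K) (coneToQuotient K J) := by
  refine (trivialFibrations_iff _).2 ⟨fun y => ?_, fun x hx hdx => ?_⟩
  · obtain ⟨a, rfl⟩ := Ideal.Quotient.mk_surjective y
    exact ⟨(TrivSqZeroExt.inl a : TrivSqZeroExt R J), rfl⟩
  · change TrivSqZeroExt R J at x
    have hx' : x.fst ∈ J := Ideal.Quotient.eq_zero_iff_mem.1 hx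
    have hdx' : (x.snd : R) = 0 := congrArg TrivSqZeroExt.fst hdx
    refine ⟨(TrivSqZeroExt.inr ⟨x.fst, hx'⟩ : TrivSqZeroExt R J),
      map_zero (Ideal.Quotient.mk J), ?_⟩
    exact TrivSqZeroExt.ext rfl (Subtype.ext hdx'.symm)

variable (A : Type u) [CommRing A] [Algebra K A] [Algebra A R] [IsScalarTower K A R]

/-- The structure map of the cone over a base algebra. -/
def coneStructure : ofAlgebra K A ⟶ cone K J :=
  { toAlgHom := (TrivSqZeroExt.inlAlgHom K R J).comp (IsScalarTower.toAlgHom K A R)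
    map_deg := map_mem_of_mem_zeroGrading A
      ((TrivSqZeroExt.inlAlgHom K R J).comp (IsScalarTower.toAlgHom K A R)).toLinearMap
      (coneGrading K J) fun _ => inl_mem_coneGrading K J _
    map_d := fun _ => map_zero ((TrivSqZeroExt.inlAlgHom K R J).comp (IsScalarTower.toAlgHom K A R)) }

theorem coneStructure_coneToQuotient : coneStructure K J A ≫ coneToQuotient K J =
    ofAlgHom (IsScalarTower.toAlgHom K A (R ⧸ J)) := by
  ext a
  exact (IsScalarTower.algebraMap_apply A R (R ⧸ J) a).symm

theorem cone_smul_fst (c : A) (x : Total (coneStructure K J A)) :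
    (show TrivSqZeroExt R J from c • x).fst = c • (show TrivSqZeroExt R J from x).fst := by
  exact (TrivSqZeroExt.fst_mul (TrivSqZeroExt.inl (algebraMap A R c) : TrivSqZeroExt R J) x).trans
    (Algebra.smul_def c _).symm

theorem cone_smul_snd (c : A) (x : Total (coneStructure K J A)) :
    (show TrivSqZeroExt R J from c • x).snd = c • (show TrivSqZeroExt R J from x).snd := by
  refine (TrivSqZeroExt.snd_mul (TrivSqZeroExt.inl (algebraMap A R c) : TrivSqZeroExt R J)
    x).trans ?_
  rw [TrivSqZeroExt.fst_inl, TrivSqZeroExt.snd_inl, smul_zero, add_zero, algebraMap_smul]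

/-- The inclusion of the degree zero part of the cone. -/
def coneInl : R →ₗ[A] Total (coneStructure K J A) where
  toFun a := (TrivSqZeroExt.inl a : TrivSqZeroExt R J)
  map_add' a b := TrivSqZeroExt.inl_add J a b
  map_smul' c a := 
    let y : Total (coneStructure K J A) := (TrivSqZeroExt.inl a : TrivSqZeroExt R J)
    TrivSqZeroExt.ext (cone_smul_fst K J A c y).symm
      ((cone_smul_snd K J A c y).trans (smul_zero c)).symm

/-- The inclusion of the part of degree `-1` of the cone. -/
def coneInr : J →ₗ[A] Total (coneStructure K J A) where
  toFun a := (TrivSqZeroExt.inr a : TrivSqZeroExt R J)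
  map_add' a b := TrivSqZeroExt.inr_add R a b
  map_smul' c a := 
    let y : Total (coneStructure K J A) := (TrivSqZeroExt.inr a : TrivSqZeroExt R J)
    TrivSqZeroExt.ext ((cone_smul_fst K J A c y).trans (smul_zero c)).symm
      (cone_smul_snd K J A c y).symm

/-- The projection to the degree zero part of the cone. -/
def coneFst : Total (coneStructure K J A) →ₗ[A] R where
  toFun x := (show TrivSqZeroExt R J from x).fst
  map_add' _ _ := rfl
  map_smul' := cone_smul_fst K J A

/-- The projection to the part of degree `-1` of the cone. -/
def coneSnd : Total (coneStructure K J A) →ₗ[A] J where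
  toFun x := (show TrivSqZeroExt R J from x).snd
  map_add' _ _ := rfl
  map_smul' := cone_smul_snd K J A

end Cone

end CDGA

namespace CDGA

open scoped TensorProduct

variable {K : Type u} [Field K] {A : Type u} [CommRing A] [Algebra K A]

/-! ### Consequences of flatness -/

/-- Flatness is applied to the degenerate pull-back square whose horizontal maps are identities;
only the preservation of the trivial fibration is retained. -/
theorem trivialFibrations_tensorDesc {B : CDGA K} {f : ofAlgebra K A ⟶ B} (hf : IsFlatMorphism f)
    {E D : CDGA K} {s : ofAlgebra K A ⟶ E} {s' : ofAlgebra K A ⟶ D} {r : E ⟶ D} (hr : s ≫ r = s')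
    (htf : trivialFibrations (CDGA K) r)
    (w : s ≫ (r ≫ tensorInl s' f) = f ≫ tensorInr s' f) :
    trivialFibrations (CDGA K) (tensorDesc w) := by
  let r₀ : Under.mk s ⟶ Under.mk s' := Under.homMk r hr
  let r₁ : Under.mk (tensorInr s f) ⟶ Under.mk (tensorInr s' f) :=
    Under.homMk (tensorDesc w) (tensorInr_desc w)
  exact (hf (𝟙 _) r₀ r₀ (𝟙 _) (IsPullback.of_horiz_isIso ⟨by simp⟩) htf
    (P' := Under.mk (tensorInr s f)) (E' := Under.mk (tensorInr s f))
    (C' := Under.mk (tensorInr s' f)) (D' := Under.mk (tensorInr s' f))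
    (tensorInl s f) (tensorInl s f) (tensorInl s' f) (tensorInl s' f)
    (isPushout_tensor s f) (isPushout_tensor s f) (isPushout_tensor s' f) (isPushout_tensor s' f)
    (𝟙 _) r₁ r₁ (𝟙 _) (by simp) (tensorInl_desc w) (tensorInl_desc w) (by simp)).2

theorem diff_mulMap_tmul_of_mem_zero {E B G : CDGA K} {s : ofAlgebra K A ⟶ E}
    {f : ofAlgebra K A ⟶ B} {e : E ⟶ G} {h : B ⟶ G} (w : s ≫ e = f ≫ h) {x : Total s}
    (hx : x ∈ Total.gr s 0) (b : Total f) :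
    Total.diff (s ≫ e) (mulMap w (x ⊗ₜ[A] b)) = mulMap w (x ⊗ₜ[A] Total.diff f b) := by
  have h0 : Total.diff s x = 0 := d_eq_zero_of_mem_zero hx
  rw [diff_mulMap_tmul w hx, h0, TensorProduct.zero_tmul, map_zero, zero_add, Int.negOnePow_zero,
    one_smul]

section ConeExact

variable (K) {R : Type u} [CommRing R] [Algebra K R] [Algebra A R] [IsScalarTower K A R]
  (J : Ideal R)

variable (A) in
/-- The inclusion of an ideal, as a linear map over a base ring. -/
abbrev idealInclusion : J →ₗ[A] R := J.subtype.restrictScalars A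

variable (A) in
/-- The projection to the quotient by an ideal, as a linear map over a base ring. -/
abbrev idealQuotient : R →ₗ[A] R ⧸ J := (Ideal.Quotient.mkₐ A J).toLinearMap

/-- In the coordinates `R ⊕ J` the differential sends `(u, v)` to `(d u + ι v, - d v)`. The minus
sign reflects that `J` sits in degree `-1`; it is the source of the sign in `ConeExact`. -/
theorem diff_mulMap_cone {B G : CDGA K} {f : ofAlgebra K A ⟶ B} {e : cone K J ⟶ G} {h : B ⟶ G}
    (w : coneStructure K J A ≫ e = f ≫ h) (u : R ⊗[A] Total f) (v : J ⊗[A] Total f) :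
    Total.diff (coneStructure K J A ≫ e) (mulMap w ((coneInl K J A).rTensor (Total f) u +
        (coneInr K J A).rTensor (Total f) v)) =
      mulMap w ((coneInl K J A).rTensor (Total f) ((Total.diff f).lTensor R u +
          (idealInclusion A J).rTensor (Total f) v) -
        (coneInr K J A).rTensor (Total f) ((Total.diff f).lTensor J v)) := by
  have hu : Total.diff (coneStructure K J A ≫ e) (mulMap w ((coneInl K J A).rTensor _ u)) =
      mulMap w ((coneInl K J A).rTensor _ ((Total.diff f).lTensor R u)) := by
    induction u using TensorProduct.induction_on with
    | zero => simp only [map_zero]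
    | add x y hx hy => simp only [map_add, hx, hy]
    | tmul a b =>
      rw [LinearMap.rTensor_tmul, LinearMap.lTensor_tmul, LinearMap.rTensor_tmul,
        diff_mulMap_tmul_of_mem_zero w (x := coneInl K J A a) (inl_mem_coneGrading K J a)]
  have hv : Total.diff (coneStructure K J A ≫ e) (mulMap w ((coneInr K J A).rTensor _ v)) =
      mulMap w ((coneInl K J A).rTensor _ ((idealInclusion A J).rTensor _ v)) -
      mulMap w ((coneInr K J A).rTensor _ ((Total.diff f).lTensor J v)) := by
    induction v using TensorProduct.induction_on with
    | zero => simp only [map_zero, sub_zero]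
    | add x y hx hy => simp only [map_add, hx, hy]; abel
    | tmul a b =>
      rw [LinearMap.rTensor_tmul, LinearMap.lTensor_tmul, LinearMap.rTensor_tmul,
        LinearMap.rTensor_tmul, LinearMap.rTensor_tmul,
        diff_mulMap_tmul w (x := coneInr K J A a) (inr_mem_coneGrading K J a), Int.negOnePow_neg,
        Int.negOnePow_one, Units.neg_smul, one_smul, ← sub_eq_add_neg]
      rfl
  rw [map_add (mulMap w), map_add (Total.diff _), hu, hv, map_sub (mulMap w), map_add, map_add]
  abel

/-- The push-out of the trivial fibration from the cone of `J` to `R ⧸ J` is again one, so its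
kernel is acyclic. Written in the two coordinates of the cone, this is the claim. -/
theorem coneExact_of_isFlatMorphism {B : CDGA K} {f : ofAlgebra K A ⟶ B}
    (hf : IsFlatMorphism f) :
    ConeExact (Total.diff f) (idealInclusion A J) (idealQuotient A J) := by
  intro u v hu huv hv
  let s := coneStructure K J A
  let s' := ofAlgHom (IsScalarTower.toAlgHom K A (R ⧸ J))
  have hr : s ≫ coneToQuotient K J = s' := coneStructure_coneToQuotient K J A
  have w : s ≫ (coneToQuotient K J ≫ tensorInl s' f) = f ≫ tensorInr s' f := by
    rw [← Category.assoc, hr, tensor_condition]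
  have w₀ := tensor_condition s f
  obtain ⟨-, ha⟩ := (trivialFibrations_iff _).1
    (trivialFibrations_tensorDesc hf hr (trivialFibrations_coneToQuotient K J) w)
  -- The identity, comparing two presentations of the same `A`-module.
  let κ : (R ⧸ J) →ₗ[A] Total s' :=
    { toFun := fun x => x
      map_add' := fun _ _ => rfl
      map_smul' := fun c x => by rw [Algebra.smul_def]; rfl }
  have hκ : Total.mapLinear (coneToQuotient K J) hr ∘ₗ coneInl K J A = κ ∘ₗ idealQuotient A J :=
    LinearMap.ext fun _ => rfl
  have hκ' : Total.mapLinear (coneToQuotient K J) hr ∘ₗ coneInr K J A = 0 :=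
    LinearMap.ext fun _ => map_zero (Ideal.Quotient.mk J)
  obtain ⟨y, -, hy⟩ := ha (mulMap w₀ ((coneInl K J A).rTensor _ u + (coneInr K J A).rTensor _ v))
    (by
      refine (map_mulMap w₀ (tensor_condition s' f) hr (tensorInl_desc w) (tensorInr_desc w)
        _).trans ?_
      rw [map_add, ← LinearMap.rTensor_comp_apply, ← LinearMap.rTensor_comp_apply, hκ, hκ',
        LinearMap.rTensor_comp_apply, hu, LinearMap.rTensor_zero, LinearMap.zero_apply, map_zero,
        add_zero, map_zero]
      rfl)
    (by
      refine (diff_mulMap_cone K J w₀ u v).trans ?_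
      rw [huv, hv, map_zero, map_zero, sub_zero, map_zero]
      rfl)
  obtain ⟨z, rfl⟩ := (mulMap_bijective (isPushout_tensor s f)).2 y
  -- The primitive splits into its part over `R` and its part over `J`; these are the required `u'`
  -- and `v'`.
  have hz : z = (coneInl K J A).rTensor _ ((coneFst K J A).rTensor _ z) +
      (coneInr K J A).rTensor _ ((coneSnd K J A).rTensor _ z) := by
    have h1 : coneInl K J A ∘ₗ coneFst K J A + coneInr K J A ∘ₗ coneSnd K J A = LinearMap.id :=
      LinearMap.ext fun x => TrivSqZeroExt.inl_fst_add_inr_snd_eq (show TrivSqZeroExt R J from x)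
    rw [← LinearMap.rTensor_comp_apply, ← LinearMap.rTensor_comp_apply, ← LinearMap.add_apply,
      ← LinearMap.rTensor_add, h1, LinearMap.rTensor_id, LinearMap.id_apply]
  have h11 : coneFst K J A ∘ₗ coneInl K J A = LinearMap.id := rfl
  have h12 : coneFst K J A ∘ₗ coneInr K J A = 0 := rfl
  have h21 : coneSnd K J A ∘ₗ coneInl K J A = 0 := rfl
  have h22 : coneSnd K J A ∘ₗ coneInr K J A = LinearMap.id := rfl
  generalize (coneFst K J A).rTensor _ z = u' at hz
  generalize (coneSnd K J A).rTensor _ z = v' at hz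
  subst hz
  have key := (mulMap_bijective (isPushout_tensor s f)).1
    ((diff_mulMap_cone K J w₀ u' v').symm.trans hy)
  refine ⟨u', v', ?_, ?_⟩
  · have := congrArg ((coneFst K J A).rTensor (Total f)) key
    rw [map_sub, map_add (LinearMap.rTensor _ (coneFst K J A)), ← LinearMap.rTensor_comp_apply,
      ← LinearMap.rTensor_comp_apply, ← LinearMap.rTensor_comp_apply,
      ← LinearMap.rTensor_comp_apply, h11, h12, LinearMap.rTensor_zero, LinearMap.zero_apply,
      LinearMap.zero_apply, LinearMap.rTensor_id, LinearMap.id_apply, LinearMap.id_apply, sub_zero,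
      add_zero] at this
    exact this
  · have := congrArg ((coneSnd K J A).rTensor (Total f)) key
    rw [map_sub, map_add (LinearMap.rTensor _ (coneSnd K J A)), ← LinearMap.rTensor_comp_apply,
      ← LinearMap.rTensor_comp_apply, ← LinearMap.rTensor_comp_apply,
      ← LinearMap.rTensor_comp_apply, h21, h22, LinearMap.rTensor_zero, LinearMap.zero_apply,
      LinearMap.zero_apply, LinearMap.rTensor_id, LinearMap.id_apply, LinearMap.id_apply, zero_sub,
      zero_add] at this
    exact this

end ConeExact

/-! ### Deformations over local Artinian algebras -/

namespace Total

variable {B : CDGA K} (f : ofAlgebra K A ⟶ B)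

theorem proj_structureHom_mul (i : ℤ) (a : A) (x : B.carrier) :
    B.proj i (structureHom f a * x) = structureHom f a * B.proj i x := by
  induction x using B.induction_on with
  | mem j x hx =>
    have hax := B.gradedMonoid.mul_mem (structureHom_mem f a) hx
    rw [zero_add] at hax
    by_cases h : j = i
    · subst h
      rw [proj_of_mem hx, proj_of_mem hax]
    · rw [proj_of_mem_ne hx h, proj_of_mem_ne hax h, mul_zero]
  | add x y hx hy => rw [mul_add, map_add, map_add, hx, hy, mul_add]

/-- The projection to a homogeneous component, as a linear map over `A`. -/
noncomputable def component (i : ℤ) : Total f →ₗ[A] Total f where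
  toFun := B.proj i
  map_add' := (B.proj i).map_add
  map_smul' a x := proj_structureHom_mul f i a x

theorem diff_comp_diff : diff f ∘ₗ diff f = 0 := LinearMap.ext B.d_d

theorem diff_comp_component_zero : diff f ∘ₗ component f 0 = 0 :=
  LinearMap.ext fun x => d_eq_zero_of_mem_zero (B.proj_mem 0 x)

theorem component_comp_component : component f 0 ∘ₗ component f 0 = component f 0 :=
  LinearMap.ext fun x => proj_of_mem (B.proj_mem 0 x)

theorem component_comp_diff : component f 0 ∘ₗ diff f = diff f ∘ₗ component f (-1) :=
  LinearMap.ext fun x => by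
    have h := B.d_proj (-1) x
    rw [neg_add_cancel] at h
    exact h.symm

end Total

section Pushout

variable {B Q L : CDGA K} {f : ofAlgebra K A ⟶ B} {p : ofAlgebra K A ⟶ L} {q₁ : B ⟶ Q}
  {q₂ : L ⟶ Q}

/-- Since `L` lies in degree zero, the multiplication `L ⊗ B → Q` carries the differential and the
degree zero projection of `B`, tensored with `L`, to those of `Q`. The square is flipped so that `L`
is the left factor and no sign appears. -/
theorem negExact_of_negAcyclic (hL : L.ConcentratedInDegreeZero) (hp : IsPushout f p q₁ q₂)
    (hQ : Q.NegAcyclic) :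
    NegExact (Total.diff f) (Total.component f 0) (Total p) := by
  have hL0 : ∀ x : Total p, x ∈ Total.gr p 0 := by
    intro x
    change L.carrier at x
    change x ∈ L.deg 0
    induction x using L.induction_on with
    | mem i x hx =>
      by_cases hi : i = 0
      · subst hi; exact hx
      · rw [hL i hi, Submodule.mem_bot] at hx
        rw [hx]; exact zero_mem _
    | add x y hx hy => exact add_mem hx hy
  have w := hp.flip.w
  have hd : ∀ z, Total.diff (p ≫ q₂) (mulMap w z) =
      mulMap w ((Total.diff f).lTensor (Total p) z) := by
    intro z
    induction z using TensorProduct.induction_on with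
    | zero => simp only [map_zero]
    | add x y hx hy => simp only [map_add, hx, hy]
    | tmul x b => rw [diff_mulMap_tmul_of_mem_zero w (hL0 x), LinearMap.lTensor_tmul]
  have hπ : ∀ z, Total.component (p ≫ q₂) 0 (mulMap w z) =
      mulMap w ((Total.component f 0).lTensor (Total p) z) := by
    intro z
    induction z using TensorProduct.induction_on with
    | zero => simp only [map_zero]
    | add x y hx hy => simp only [map_add, hx, hy]
    | tmul x b =>
      rw [LinearMap.lTensor_tmul]
      refine (Q.proj_zero_mul _ _).trans ?_
      exact congrArg₂ (· * ·) (proj_of_mem (q₂.map_deg 0 _ (hL0 x))) (map_proj q₁ 0 b).symm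
  intro z hz hz'
  obtain ⟨y, hy⟩ := hQ (mulMap w z)
    ((hd z).trans (by rw [hz, map_zero]; rfl)) ((hπ z).trans (by rw [hz', map_zero]; rfl))
  obtain ⟨y, rfl⟩ := (mulMap_bijective hp.flip).2 y
  exact ⟨y, (mulMap_bijective hp.flip).1 ((hd y).symm.trans hy)⟩

end Pushout

theorem concentratedInDegreeZero_ofAlgebra (R : Type u) [CommRing R] [Algebra K R] :
    (ofAlgebra K R).ConcentratedInDegreeZero := fun _ hi => zeroGrading_ne R hi

section Local

variable [IsLocalRing A] {ε : A →ₐ[K] K}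

theorem ker_eq_maximalIdeal : RingHom.ker ε = IsLocalRing.maximalIdeal A := by
  have : (RingHom.ker ε).IsMaximal := RingHom.ker_isMaximal_of_surjective ε fun k =>
    ⟨algebraMap K A k, ε.commutes k⟩
  exact IsLocalRing.eq_maximalIdeal this

variable [IsArtinianRing A] {B Q : CDGA K} {f : ofAlgebra K A ⟶ B} {q₁ : B ⟶ Q} {q₂ : ofAlgebra K K ⟶ Q}

/-- The proof is dévissage over the quotients of `A`. A socle element `t` of `R` spans a copy of the
residue field, for which the claim is the hypothesis on `Q`, and `R/(t)` is a smaller quotient;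
`NegExact.of_coneExact` combines the two. -/
theorem negExact_of_isFlatMorphism (hf : IsFlatMorphism f) (hp : IsPushout f (ofAlgHom ε) q₁ q₂)
    (hQ : Q.NegAcyclic) (R : Type u) [CommRing R] [Algebra K R] [Algebra A R] [IsScalarTower K A R]
    (hR : Function.Surjective (algebraMap A R)) :
    NegExact (Total.diff f) (Total.component f 0) R := by
  have hL := negExact_of_negAcyclic (concentratedInDegreeZero_ofAlgebra K) hp hQ
  let g : A →ₗ[A] Total (ofAlgHom ε) := Algebra.linearMap A _
  have hg : Function.Surjective g := fun k => ⟨algebraMap K A k, ε.commutes k⟩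
  have hgm : LinearMap.ker g = IsLocalRing.maximalIdeal A := ker_eq_maximalIdeal (ε := ε)
  -- Quotients are indexed by their kernels, so that the ascending chain condition on ideals of `A`
  -- drives the induction.
  suffices h : ∀ I : Ideal A, ∀ (R : Type u) [CommRing R] [Algebra K R] [Algebra A R]
      [IsScalarTower K A R], Function.Surjective (algebraMap A R) →
      RingHom.ker (algebraMap A R) = I → NegExact (Total.diff f) (Total.component f 0) R from
    h _ R hR rfl
  intro I
  induction I using WellFoundedGT.induction with
  | ind I ih =>
    intro R _ _ _ _ hR hI
    rcases subsingleton_or_nontrivial R with hR0 | hR0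
    · intro z _ _
      have : Subsingleton (R ⊗[A] Total f) := Unique.instSubsingleton
      exact ⟨0, Subsingleton.elim _ _⟩
    obtain ⟨t, ht, htm⟩ := exists_socle_element (A := A) (R := R)
    obtain ⟨e⟩ := nonempty_linearEquiv_span hR ht htm hg hgm
    have hq : Function.Surjective (algebraMap A (R ⧸ Ideal.span {t})) :=
      Ideal.Quotient.mk_surjective.comp hR
    obtain ⟨a, ha⟩ := hR t
    refine NegExact.of_coneExact (hL.of_linearEquiv e) (ih _ ?_ (R ⧸ Ideal.span {t}) hq rfl)
      (coneExact_of_isFlatMorphism K (Ideal.span {t}) hf) Ideal.Quotient.mk_surjective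
      (Total.diff_comp_diff f) (Total.diff_comp_component_zero f)
      (Total.component_comp_component f) (Total.component_comp_diff f)
    -- The kernel grows strictly because a preimage `a` of `t` enters it.
    refine lt_of_le_of_ne ?_ ?_
    · rw [← hI]
      intro b hb
      rw [RingHom.mem_ker, IsScalarTower.algebraMap_apply A R, RingHom.mem_ker.1 hb, map_zero]
    · intro hIeq
      have h1 : a ∈ I := by
        rw [hIeq, RingHom.mem_ker, IsScalarTower.algebraMap_apply A R, ha]
        exact Ideal.Quotient.eq_zero_iff_mem.2 (Ideal.mem_span_singleton_self t)
      rw [← hI, RingHom.mem_ker, ha] at h1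
      exact ht h1

/-- The case `R = A` of the preceding lemma, under `A ⊗ B ≅ B`. -/
theorem negAcyclic_of_isFlatMorphism (hf : IsFlatMorphism f)
    (hp : IsPushout f (ofAlgHom ε) q₁ q₂) (hQ : Q.NegAcyclic) : B.NegAcyclic := by
  have h := negExact_of_isFlatMorphism hf hp hQ A Function.surjective_id
  intro x hx hx'
  have hx1 : Total.diff f x = 0 := hx
  have hx2 : Total.component f 0 x = 0 := hx'
  obtain ⟨y, hy⟩ := h (1 ⊗ₜ[A] (show Total f from x))
    (by rw [LinearMap.lTensor_tmul]; exact (congrArg _ hx1).trans (TensorProduct.tmul_zero _ _))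
    (by rw [LinearMap.lTensor_tmul]; exact (congrArg _ hx2).trans (TensorProduct.tmul_zero _ _))
  obtain ⟨y, rfl⟩ := (TensorProduct.lid A (Total f)).symm.surjective y
  refine ⟨y, ?_⟩
  have := congrArg (TensorProduct.lid A (Total f)) hy
  rw [TensorProduct.lid_symm_apply, LinearMap.lTensor_tmul, TensorProduct.lid_tmul,
    TensorProduct.lid_tmul, one_smul, one_smul] at this
  exact this

/-- By the ideal criterion it suffices that `I ⊗ H⁰(B) → A ⊗ H⁰(B)` is injective. This follows from
cone exactness for `I` inside `A` and from the vanishing of negative cohomology over `A ⧸ I`. -/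
theorem flat_toCohomologyZero (hf : IsFlatMorphism f)
    (hp : IsPushout f (ofAlgHom ε) q₁ q₂) (hQ : Q.NegAcyclic) :
    Module.Flat A (Total (f ≫ B.toCohomologyZero)) := by
  rw [Module.Flat.iff_rTensor_injective']
  intro I
  have hc := coneExact_of_isFlatMorphism K I hf
  refine hc.rTensor_injective (π := Total.component f 0)
    (p := Total.mapLinear B.toCohomologyZero rfl)
    (negExact_of_isFlatMorphism hf hp hQ (A ⧸ I) Ideal.Quotient.mk_surjective)
    Ideal.Quotient.mk_surjective (LinearMap.ext fun x => Ideal.Quotient.eq_zero_iff_mem.2 x.2)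
    (Total.diff_comp_diff f) (Total.diff_comp_component_zero f)
    B.toCohomologyZeroAlgHom_surjective (LinearMap.ext B.toCohomologyZeroAlgHom_d)
    (LinearMap.ext fun x => apply_proj_zero (R := B.cohomologyZero) B.toCohomologyZero x)
    fun x hx => ?_
  obtain ⟨y, hy, hyx⟩ := (B.toCohomologyZeroAlgHom_eq_zero_iff x).1 hx
  exact ⟨y, proj_of_mem_ne hy (by norm_num), hyx⟩

end Local

end CDGA

/-! ### Nakayama's lemma and concentration of strict deformations in degree zero -/

namespace CDGA

open scoped TensorProduct

/-- The tensor product `L ⊗ N` is `N / (ker g) N`, and `g 1 ⊗ b` corresponds to the class of `b`. -/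
theorem mem_ker_smul_top_of_tmul_eq_zero {A : Type u} [CommRing A] {L N : Type u} [AddCommGroup L]
    [Module A L] [AddCommGroup N] [Module A N] {g : A →ₗ[A] L} (hg : Function.Surjective g) {b : N}
    (h : g 1 ⊗ₜ[A] b = 0) : b ∈ (LinearMap.ker g : Ideal A) • (⊤ : Submodule A N) := by
  have h1 := congrArg (TensorProduct.congr (g.quotKerEquivOfSurjective hg).symm
    (LinearEquiv.refl A N)) h
  have h2 : (g.quotKerEquivOfSurjective hg).symm (g 1) = Submodule.Quotient.mk 1 :=
    (LinearEquiv.symm_apply_eq _).2 rfl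
  rw [TensorProduct.congr_tmul, map_zero, h2] at h1
  have h3 := TensorProduct.quotTensorEquivQuotSMul_mk_one_tmul (M := N)
    (LinearMap.ker g : Ideal A) b
  rw [← Submodule.Quotient.mk_eq_zero, ← h3]
  exact (congrArg _ h1).trans (map_zero _)

/-- Iterating the inclusion gives `P ≤ I ^ k • P` for all `k`. Nilpotency replaces the finiteness
assumption of Nakayama's lemma. -/
theorem eq_bot_of_le_smul_of_isNilpotent {A : Type u} [CommRing A] {N : Type u} [AddCommGroup N]
    [Module A N] {I : Ideal A} (hI : IsNilpotent I) {P : Submodule A N} (h : P ≤ I • P) :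
    P = ⊥ := by
  obtain ⟨n, hn⟩ := hI
  have : ∀ k : ℕ, P ≤ I ^ k • P := by
    intro k
    induction k with
    | zero => rw [pow_zero, Submodule.one_smul]
    | succ k ih =>
      rw [pow_succ, Submodule.mul_smul]
      exact ih.trans (smul_mono_right _ h)
  have hP := this n
  rw [hn, Ideal.zero_eq_bot, Submodule.bot_smul] at hP
  exact le_bot_iff.1 hP

variable {K : Type u} [Field K] {A : Type u} [CommRing A] [Algebra K A] [IsLocalRing A]
  [IsArtinianRing A] {ε : A →ₐ[K] K}

/-- For `i ≠ 0` the component of degree `i` of `B` vanishes modulo the maximal ideal, as `Q` has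
nothing there. The maximal ideal is nilpotent, so the component is zero. -/
theorem concentratedInDegreeZero_of_isPushout {B Q : CDGA K} {f : ofAlgebra K A ⟶ B} {q₁ : B ⟶ Q}
    {q₂ : ofAlgebra K K ⟶ Q} (hp : IsPushout f (ofAlgHom ε) q₁ q₂)
    (hQ : Q.ConcentratedInDegreeZero) : B.ConcentratedInDegreeZero := by
  let g : A →ₗ[A] Total (ofAlgHom ε) := Algebra.linearMap A _
  have hg : Function.Surjective g := fun k => ⟨algebraMap K A k, ε.commutes k⟩
  have hgm : LinearMap.ker g = IsLocalRing.maximalIdeal A := ker_eq_maximalIdeal (ε := ε)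
  have hnil : IsNilpotent (IsLocalRing.maximalIdeal A) := by
    rw [← IsLocalRing.jacobson_eq_maximalIdeal (⊥ : Ideal A) bot_ne_top]
    exact IsArtinianRing.isNilpotent_jacobson_bot
  intro i hi
  let π := Total.component f i
  have hπ : π ∘ₗ π = π := LinearMap.ext fun x => proj_of_mem (B.proj_mem i x)
  have hle : LinearMap.range π ≤ IsLocalRing.maximalIdeal A • LinearMap.range π := by
    rintro _ ⟨x, rfl⟩
    have h0 : g 1 ⊗ₜ[A] π x = 0 := by
      apply (mulMap_bijective hp.flip).1
      rw [map_zero]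
      refine (mulMap_tmul hp.flip.w (g 1) (π x)).trans ?_
      have h1 : q₁.toAlgHom (B.proj i x) = 0 := by
        have := q₁.map_deg i _ (B.proj_mem i x)
        rwa [hQ i hi, Submodule.mem_bot] at this
      exact (congrArg (q₂.toAlgHom (g 1) * ·) h1).trans (mul_zero _)
    have h2 := mem_ker_smul_top_of_tmul_eq_zero hg h0
    rw [hgm] at h2
    -- A second projection improves membership in `m • B` to membership in `m` times the component
    -- itself.
    have h3 := Submodule.mem_map_of_mem (f := π) h2
    rw [Submodule.map_smul'', Submodule.map_top] at h3
    rwa [← LinearMap.comp_apply, hπ] at h3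
  have hbot := eq_bot_of_le_smul_of_isNilpotent hnil hle
  rw [eq_bot_iff]
  intro x hx
  have : π x = 0 := by rw [LinearMap.range_eq_bot.1 hbot]; rfl
  exact (proj_of_mem hx).symm.trans this

end CDGA

/-! ### Units, counits and push-outs for reflective subcategories -/

section Reflective

variable {M N : Type*} [Category* M] [Category* N] {H : M ⥤ N} {i : N ⥤ M} (adj : H ⊣ i)

theorem CategoryTheory.Adjunction.unit_comp_map_map_counit {B : M} {R : N} (f : B ⟶ i.obj R) :
    adj.unit.app B ≫ i.map (H.map f ≫ adj.counit.app R) = f := by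
  simp

variable [i.Full] [i.Faithful]

/-- The counit is invertible because `i` is fully faithful. The identity says that the reflected
structure map, viewed in `M`, is the original one followed by the unit. -/
theorem CategoryTheory.Adjunction.map_inv_counit_comp_map {R : N} {B : M} (f : i.obj R ⟶ B) :
    i.map (inv (adj.counit.app R) ≫ H.map f) = f ≫ adj.unit.app B := by
  have h := adj.right_triangle_components R
  rw [Functor.map_comp, Functor.map_inv, IsIso.inv_eq_of_inv_hom_id h]
  exact adj.unit_naturality f

theorem CategoryTheory.Adjunction.isPushout_reflection {A L : N} {B Q : M} {p : A ⟶ L}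
    {f : i.obj A ⟶ B} {q₁ : B ⟶ Q} {q₂ : i.obj L ⟶ Q} [H.IsLeftAdjoint]
    (h : IsPushout f (i.map p) q₁ q₂) :
    IsPushout (inv (adj.counit.app A) ≫ H.map f) p (H.map q₁)
      (inv (adj.counit.app L) ≫ H.map q₂) :=
  (h.map H).of_iso (asIso (adj.counit.app A)) (Iso.refl _) (asIso (adj.counit.app L)) (Iso.refl _)
    (by simp) (by simp) (by simp) (by simp)

/-- Both `H` and `i` are left adjoints, so both preserve push-outs; the legs are then rewritten by
means of the unit. -/
theorem CategoryTheory.Adjunction.isPushout_truncation {A L : N} {B Q : M} {p : A ⟶ L}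
    {f : i.obj A ⟶ B} {q₁ : B ⟶ Q} {q₂ : i.obj L ⟶ Q} [H.IsLeftAdjoint] [i.IsLeftAdjoint]
    (h : IsPushout f (i.map p) q₁ q₂) :
    IsPushout (f ≫ adj.unit.app B) (i.map p) (i.map (H.map q₁)) (q₂ ≫ adj.unit.app Q) := by
  have := (adj.isPushout_reflection h).map i
  rwa [adj.map_inv_counit_comp_map, adj.map_inv_counit_comp_map] at this

theorem CategoryTheory.Adjunction.inv_counit_comp_map_map_counit {R S : N} (t : R ⟶ S) :
    inv (adj.counit.app R) ≫ H.map (i.map t) ≫ adj.counit.app S = t :=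
  (IsIso.inv_comp_eq _).2 (adj.counit_naturality t)

end Reflective

/-- This gives compatibility with the projections to `X`: a map to an object at which `η` is
invertible factors through `η.app B`. -/
theorem CategoryTheory.NatTrans.unit_comp_map_comp_inv {M : Type*} [Category* M] {T : M ⥤ M}
    (η : 𝟭 M ⟶ T) {B F : M} [IsIso (η.app F)] (g : B ⟶ F) :
    η.app B ≫ T.map g ≫ inv (η.app F) = g := by
  have h := η.naturality g
  simp only [Functor.id_map] at h
  rw [← reassoc_of% h, IsIso.hom_inv_id, Category.comp_id]

/-! ### Transport of squares of diagrams along truncation and reflection -/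

namespace DiagramSquare

section

variable {C M : Type*} [Category* C] [Category* M] {A L : M} {p : A ⟶ L} {X : C ⥤ M}
  {x : (Functor.const C).obj L ⟶ X}

theorem str_app_comp_map (S : DiagramSquare p x) {a b : C} (f : a ⟶ b) :
    S.str.app a ≫ S.total.map f = S.str.app b :=
  (S.str.naturality f).symm.trans (Category.id_comp _)

theorem comm_app (S : DiagramSquare p x) (a : C) :
    S.str.app a ≫ S.proj.app a = p ≫ x.app a :=
  congrArg (fun t => t.app a) S.comm

/-- The image of a square under an endofunctor with a unit which is invertible on the target. -/
@[simps]
noncomputable def truncation {T : M ⥤ M} (η : 𝟭 M ⟶ T) [∀ a, IsIso (η.app (X.obj a))]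
    (S : DiagramSquare p x) : DiagramSquare p x where
  total := S.total ⋙ T
  str :=
    { app := fun a => S.str.app a ≫ η.app (S.total.obj a)
      naturality := fun a b f => by
        have h := η.naturality (S.total.map f)
        simp only [Functor.id_map] at h
        simp [← h, ← S.str_app_comp_map f] }
  proj :=
    { app := fun a => T.map (S.proj.app a) ≫ inv (η.app (X.obj a))
      naturality := fun a b f => by
        have h := η.naturality (X.map f)
        simp only [Functor.id_map] at h
        simp only [Functor.comp_map, Category.assoc]
        rw [← T.map_comp_assoc, S.proj.naturality, T.map_comp_assoc, (show T.map (X.map f) ≫ inv (η.app (X.obj b)) =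
            inv (η.app (X.obj a)) ≫ X.map f by
              rw [IsIso.comp_inv_eq, Category.assoc, h, IsIso.inv_hom_id_assoc])] }
  comm := by
    ext a
    have h := η.naturality (S.proj.app a)
    simp only [Functor.id_map] at h
    simp only [NatTrans.comp_app, Category.assoc, Functor.const_map_app]
    rw [← reassoc_of% h, IsIso.hom_inv_id, Category.comp_id, S.comm_app]

theorem unit_app_comp_truncation_proj_app {T : M ⥤ M} (η : 𝟭 M ⟶ T)
    [∀ a, IsIso (η.app (X.obj a))] (S : DiagramSquare p x) (a : C) :
    η.app (S.total.obj a) ≫ (S.truncation η).proj.app a = S.proj.app a :=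
  η.unit_comp_map_comp_inv (S.proj.app a)

/-- The unit itself is a morphism of squares, by naturality. -/
theorem rel_truncation {W : MorphismProperty M} {T : M ⥤ M} (η : 𝟭 M ⟶ T)
    [∀ a, IsIso (η.app (X.obj a))] (S : DiagramSquare p x) (h : ∀ a, W (η.app (S.total.obj a))) :
    S.Rel W (S.truncation η) :=
  ⟨Functor.whiskerLeft S.total η, by ext a; rfl,
    by ext a; exact S.unit_app_comp_truncation_proj_app η a, h⟩

theorem Rel.truncation {W W' : MorphismProperty M} {T : M ⥤ M} (η : 𝟭 M ⟶ T)
    [∀ a, IsIso (η.app (X.obj a))] {S S' : DiagramSquare p x} (h : S.Rel W S')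
    (hT : ∀ ⦃E F : M⦄ (f : E ⟶ F), W f → W' (T.map f)) :
    (S.truncation η).Rel W' (S'.truncation η) := by
  obtain ⟨g, h₁, h₂, hg⟩ := h
  refine ⟨Functor.whiskerRight g T, ?_, ?_, fun a => hT _ (hg a)⟩
  · ext a
    have h := η.naturality (g.app a)
    simp only [Functor.id_map] at h
    rw [truncation_str_app, ← h₁]
    change (S.str.app a ≫ η.app _) ≫ T.map (g.app a) = (S.str.app a ≫ g.app a) ≫ η.app _
    rw [Category.assoc, Category.assoc, h]
  · ext a
    rw [truncation_proj_app, ← h₂, NatTrans.comp_app, T.map_comp, Category.assoc]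
    rfl

end

section

variable {C M N : Type*} [Category* C] [Category* M] [Category* N] {H : M ⥤ N} {i : N ⥤ M}
  (adj : H ⊣ i) [i.Full] [i.Faithful] {A L : N} {p : A ⟶ L} {X : C ⥤ N}
  {x : (Functor.const C).obj L ⟶ X} {x' : (Functor.const C).obj (i.obj L) ⟶ X ⋙ i}

/-- The reflection of a square over a diagram in a reflective subcategory. -/
@[simps]
noncomputable def reflection (hx : ∀ a, x'.app a = i.map (x.app a))
    (S : DiagramSquare (i.map p) x') : DiagramSquare p x where
  total := S.total ⋙ H
  str :=
    { app := fun a => inv (adj.counit.app A) ≫ H.map (S.str.app a)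
      naturality := fun a b f => by
        simp [← S.str_app_comp_map f] }
  proj :=
    { app := fun a => H.map (S.proj.app a) ≫ adj.counit.app (X.obj a)
      naturality := fun a b f => by
        simp only [Functor.comp_map, Category.assoc]
        rw [← H.map_comp_assoc, S.proj.naturality, H.map_comp_assoc, Functor.comp_map,
          adj.counit_naturality] }
  comm := by
    ext a
    simp only [NatTrans.comp_app, Category.assoc, Functor.const_map_app]
    rw [← H.map_comp_assoc, S.comm_app, hx, ← i.map_comp, adj.counit_naturality,
      IsIso.inv_hom_id_assoc]

theorem Rel.reflection {W : MorphismProperty M} {W' : MorphismProperty N}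
    (hx : ∀ a, x'.app a = i.map (x.app a))
    {S S' : DiagramSquare (i.map p) x'} (h : S.Rel W S')
    (hH : ∀ ⦃E F : M⦄ (f : E ⟶ F), W f → W' (H.map f)) :
    (S.reflection adj hx).Rel W' (S'.reflection adj hx) := by
  obtain ⟨g, h₁, h₂, hg⟩ := h
  refine ⟨Functor.whiskerRight g H, ?_, ?_, fun a => hH _ (hg a)⟩
  · ext a
    rw [reflection_str_app, ← h₁, NatTrans.comp_app, H.map_comp, ← Category.assoc]
    rfl
  · ext a
    rw [reflection_proj_app, ← h₂, NatTrans.comp_app, H.map_comp, Category.assoc]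
    rfl

end

end DiagramSquare

/-! ### The unit of the adjunction and flatness of the reflection -/

namespace CDGA

variable {K : Type u} [Field K] {A : Type u} [CommRing A] [Algebra K A] {ε : A →ₐ[K] K}
  {C : Type v} [Category.{w} C]

theorem isIso_unit_app {E : CDGA K} (hE : E.ConcentratedInDegreeZero) :
    IsIso ((cohomologyZeroAdjunction K).unit.app E) := by
  rw [cohomologyZeroAdjunction_unit_app]
  exact isIso_toCohomologyZero hE

theorem weakEquivalences_unit_app {E : CDGA K} (hE : E.NegAcyclic) :
    weakEquivalences (CDGA K) ((cohomologyZeroAdjunction K).unit.app E) := by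
  rw [cohomologyZeroAdjunction_unit_app]
  exact weakEquivalences_toCohomologyZero hE

theorem ConcentratedInDegreeZero.of_iso {E F : CDGA K} (hF : F.ConcentratedInDegreeZero)
    (g : E ⟶ F) [IsIso g] : E.ConcentratedInDegreeZero := by
  intro i hi
  rw [eq_bot_iff]
  intro x hx
  have h := g.map_deg i x hx
  rw [hF i hi, Submodule.mem_bot] at h
  exact (bijective_of_isIso g).1 (h.trans (map_zero g.toAlgHom).symm)

section Flat

variable [IsLocalRing A] [IsArtinianRing A] {B Q : CDGA K} {f : ofAlgebra K A ⟶ B} {q₁ : B ⟶ Q}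
  {q₂ : ofAlgebra K K ⟶ Q}

/-- The reflected structure map is `f ≫ B.toCohomologyZero`, which `flat_toCohomologyZero` covers.
-/
theorem flatHoms_reflection (hf : IsFlatMorphism f) (hp : IsPushout f (ofAlgHom ε) q₁ q₂)
    (hQ : Q.NegAcyclic) :
    CommAlgCat.flatHoms K (inv ((cohomologyZeroAdjunction K).counit.app (CommAlgCat.of K A)) ≫
      (cohomologyZeroFunctor K).map f) := by
  have h := (cohomologyZeroAdjunction K).map_inv_counit_comp_map (R := CommAlgCat.of K A) f
  rw [cohomologyZeroAdjunction_unit_app] at h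
  have h' := flat_toCohomologyZero hf hp hQ
  have key : (inv ((cohomologyZeroAdjunction K).counit.app (CommAlgCat.of K A)) ≫
      (cohomologyZeroFunctor K).map f).hom = (f ≫ B.toCohomologyZero).toAlgHom :=
    congrArg Hom.toAlgHom h
  change RingHom.Flat (AlgHom.toRingHom _)
  rw [key]
  exact h'

end Flat

theorem flatMorphisms_inclusion_map {R S : CommAlgCat.{u} K} {φ : R ⟶ S}
    (h : CommAlgCat.flatHoms K φ) : flatMorphisms (CDGA K) ((inclusion K).map φ) :=
  isFlatMorphism_ofAlgHom φ.hom h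

end CDGA

/-! ### Comparison of deformations, strict deformations and classical deformations -/

namespace DiagramSquare

open CDGA

variable {K : Type u} [Field K] {A : Type u} [CommRing A] [Algebra K A] {ε : A →ₐ[K] K}
  {C : Type v} [Category.{w} C]

/-- A classical deformation, placed in degree zero, is a strict deformation. -/
theorem IsDeformation.toCDGA {X : C ⥤ CommAlgCat.{u} K}
    {S : DiagramSquare (CommAlgCat.ofHom ε) (CommAlgCat.unitTrans X)}
    (hS : S.IsDeformation (CommAlgCat.flatHoms K)
      (MorphismProperty.isomorphisms (CommAlgCat.{u} K))) :
    S.toCDGA.IsDeformation (flatMorphisms (CDGA K)) (MorphismProperty.isomorphisms (CDGA K)) := by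
  intro a
  obtain ⟨hf, Q, q₁, q₂, g, hp, h₁, h₂, hg⟩ := hS a
  refine ⟨flatMorphisms_inclusion_map hf, (inclusion K).obj Q, (inclusion K).map q₁,
    (inclusion K).map q₂, (inclusion K).map g, hp.map (inclusion K), ?_, ?_, ?_⟩
  · exact congrArg (inclusion K).map h₁
  · exact congrArg (inclusion K).map h₂
  · have : IsIso g := hg
    change IsIso ((inclusion K).map g)
    infer_instance

theorem Rel.toCDGA {X : C ⥤ CommAlgCat.{u} K}
    {S T : DiagramSquare (CommAlgCat.ofHom ε) (CommAlgCat.unitTrans X)}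
    (h : S.Rel (MorphismProperty.isomorphisms (CommAlgCat.{u} K)) T) :
    S.toCDGA.Rel (MorphismProperty.isomorphisms (CDGA K)) T.toCDGA := by
  obtain ⟨g, h₁, h₂, hg⟩ := h
  refine ⟨Functor.whiskerRight g (inclusion K), ?_, ?_, fun a => ?_⟩
  · ext a : 2
    exact congrArg (fun t => (inclusion K).map (t.app a)) h₁
  · ext a : 2
    exact congrArg (fun t => (inclusion K).map (t.app a)) h₂
  · have : IsIso (g.app a) := hg a
    change IsIso ((inclusion K).map (g.app a))
    infer_instance

section Classical

variable {X : C ⥤ CommAlgCat.{u} K}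

theorem unitTrans_app (a : C) : (CDGA.unitTrans (X ⋙ inclusion K)).app a =
    (inclusion K).map ((CommAlgCat.unitTrans X).app a) := rfl

/-- The reduction to zeroth cohomology of a square over a diagram of algebras in degree zero. -/
noncomputable abbrev cohomologyZero
    (S : DiagramSquare (ofAlgHom ε) (CDGA.unitTrans (X ⋙ inclusion K))) :
    DiagramSquare (CommAlgCat.ofHom ε) (CommAlgCat.unitTrans X) :=
  reflection (i := inclusion K) (p := CommAlgCat.ofHom ε) (cohomologyZeroAdjunction K)
    unitTrans_app S

/-- The comparison is the counit, invertible because the inclusion is fully faithful. -/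
theorem rel_cohomologyZero_toCDGA
    (S : DiagramSquare (CommAlgCat.ofHom ε) (CommAlgCat.unitTrans X)) :
    S.toCDGA.cohomologyZero.Rel (MorphismProperty.isomorphisms (CommAlgCat.{u} K)) S := by
  refine ⟨Functor.whiskerLeft S.total (cohomologyZeroAdjunction K).counit, ?_, ?_, fun a => ?_⟩
  · ext a : 2
    exact (Category.assoc _ _ _).trans
      ((cohomologyZeroAdjunction K).inv_counit_comp_map_map_counit (R := CommAlgCat.of K A)
        (S.str.app a))
  · ext a : 2
    exact ((cohomologyZeroAdjunction K).counit_naturality (S.proj.app a)).symm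
  · change IsIso ((cohomologyZeroAdjunction K).counit.app (S.total.obj a))
    infer_instance

end Classical

variable [IsLocalRing A] [IsArtinianRing A]

section DegreeZero

variable {X : C ⥤ CDGA K} {S : DiagramSquare (ofAlgHom ε) (unitTrans X)}

theorem IsDeformation.negAcyclic (hX : ∀ a, (X.obj a).ConcentratedInDegreeZero)
    (hS : S.IsDeformation (flatMorphisms (CDGA K)) (weakEquivalences (CDGA K))) (a : C) :
    (S.total.obj a).NegAcyclic := by
  obtain ⟨hf, Q, q₁, q₂, g, hp, -, -, hg⟩ := hS a
  exact negAcyclic_of_isFlatMorphism hf hp (negAcyclic_of_weakEquivalences hg (hX a))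

theorem IsDeformation.concentratedInDegreeZero
    (hX : ∀ a, (X.obj a).ConcentratedInDegreeZero)
    (hS : S.IsDeformation (flatMorphisms (CDGA K)) (MorphismProperty.isomorphisms (CDGA K)))
    (a : C) : (S.total.obj a).ConcentratedInDegreeZero := by
  obtain ⟨-, Q, q₁, q₂, g, hp, -, -, hg⟩ := hS a
  have : IsIso g := hg
  exact concentratedInDegreeZero_of_isPushout hp ((hX a).of_iso g)

/-- Truncation commutes with the push-out along `A → K`, so the new reduction is the truncation of
`Q`. The weak equivalence `Q → X` becomes an isomorphism on `H⁰`, and the inverse unit identifies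
the truncation of `X` with `X`. -/
theorem IsDeformation.truncation (hX : ∀ a, (X.obj a).ConcentratedInDegreeZero)
    [∀ a, IsIso ((cohomologyZeroAdjunction K).unit.app (X.obj a))]
    (hS : S.IsDeformation (flatMorphisms (CDGA K)) (weakEquivalences (CDGA K))) :
    (S.truncation (cohomologyZeroAdjunction K).unit).IsDeformation (flatMorphisms (CDGA K))
      (MorphismProperty.isomorphisms (CDGA K)) := by
  intro a
  obtain ⟨hf, Q, q₁, q₂, g, hp, h₁, h₂, hg⟩ := hS a
  refine ⟨?_, _, _, _, (inclusion K).map ((cohomologyZeroFunctor K).map g) ≫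
    inv ((cohomologyZeroAdjunction K).unit.app (X.obj a)),
    (cohomologyZeroAdjunction K).isPushout_truncation (A := CommAlgCat.of K A)
      (L := CommAlgCat.of K K) (p := CommAlgCat.ofHom ε) hp, ?_, ?_, ?_⟩
  · have := flatMorphisms_inclusion_map
      (flatHoms_reflection hf hp (negAcyclic_of_weakEquivalences hg (hX a)))
    refine Eq.mp (congrArg _ ?_) this
    exact (cohomologyZeroAdjunction K).map_inv_counit_comp_map (R := CommAlgCat.of K A) _
  · refine (Category.assoc _ _ _).symm.trans (congrArg (· ≫ _) ?_)
    rw [← h₁]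
    exact ((cohomologyZeroFunctor K ⋙ inclusion K).map_comp q₁ g).symm
  · refine (Category.assoc _ _ _).trans ((congrArg (q₂ ≫ ·) ?_).trans h₂)
    exact (cohomologyZeroAdjunction K).unit.unit_comp_map_comp_inv g
  · have := isIso_cohomologyZeroFunctor_map g hg
    change IsIso ((inclusion K).map _ ≫ _)
    infer_instance

end DegreeZero

section Classical

variable {X : C ⥤ CommAlgCat.{u} K}

/-- As for truncation, but the push-out is taken in ordinary algebras, and the counit identifies the
reflection of the included diagram with `X`. -/
theorem IsDeformation.cohomologyZero
    {S : DiagramSquare (ofAlgHom ε) (CDGA.unitTrans (X ⋙ inclusion K))}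
    (hS : S.IsDeformation (flatMorphisms (CDGA K)) (MorphismProperty.isomorphisms (CDGA K))) :
    S.cohomologyZero.IsDeformation (CommAlgCat.flatHoms K)
      (MorphismProperty.isomorphisms (CommAlgCat.{u} K)) := by
  intro a
  obtain ⟨hf, Q, q₁, q₂, g, hp, h₁, h₂, hg⟩ := hS a
  have hX : ((inclusion K).obj (X.obj a)).ConcentratedInDegreeZero :=
    concentratedInDegreeZero_ofAlgebra _
  refine ⟨flatHoms_reflection hf hp (negAcyclic_of_weakEquivalences
    (isomorphisms_le_weakEquivalences _ hg) hX), _, _, _,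
    (cohomologyZeroFunctor K).map g ≫ (cohomologyZeroAdjunction K).counit.app (X.obj a),
    (cohomologyZeroAdjunction K).isPushout_reflection (A := CommAlgCat.of K A)
      (L := CommAlgCat.of K K) (p := CommAlgCat.ofHom ε) hp, ?_, ?_, ?_⟩
  · refine (Category.assoc _ _ _).symm.trans (congrArg (· ≫ _) ?_)
    rw [← h₁]
    exact ((cohomologyZeroFunctor K).map_comp q₁ g).symm
  · refine (Category.assoc _ _ _).trans (Eq.trans (congrArg (_ ≫ ·) ?_)
      ((cohomologyZeroAdjunction K).inv_counit_comp_map_map_counit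
        (R := CommAlgCat.of K K) ((CommAlgCat.unitTrans X).app a)))
    refine (Category.assoc _ _ _).symm.trans (congrArg (· ≫ _) ?_)
    exact ((cohomologyZeroFunctor K).map_comp q₂ g).symm.trans
      (congrArg (cohomologyZeroFunctor K).map h₂)
  · have : IsIso g := hg
    change IsIso ((cohomologyZeroFunctor K).map g ≫ _)
    infer_instance

/-- The comparison is the unit, invertible because strict deformations of such a diagram are
concentrated in degree zero. -/
theorem rel_toCDGA_cohomologyZero
    {S : DiagramSquare (ofAlgHom ε) (CDGA.unitTrans (X ⋙ inclusion K))}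
    (hS : S.IsDeformation (flatMorphisms (CDGA K)) (MorphismProperty.isomorphisms (CDGA K))) :
    S.Rel (MorphismProperty.isomorphisms (CDGA K)) S.cohomologyZero.toCDGA := by
  refine ⟨Functor.whiskerLeft S.total (cohomologyZeroAdjunction K).unit, ?_, ?_, fun a => ?_⟩
  · ext a : 2
    exact ((cohomologyZeroAdjunction K).map_inv_counit_comp_map (R := CommAlgCat.of K A)
      (S.str.app a)).symm
  · ext a : 2
    exact (cohomologyZeroAdjunction K).unit_comp_map_map_counit (R := X.obj a) (S.proj.app a)
  · exact isIso_unit_app (IsDeformation.concentratedInDegreeZero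
      (fun a => concentratedInDegreeZero_ofAlgebra _) hS a)

end Classical

end DiagramSquare

/-- Let `X` be a diagram over a direct Reedy category and `A` a classical local Artin algebra
with residue field `K` of characteristic zero. (1) If `X` is a diagram of differential graded
algebras concentrated in degree zero, then the natural map from strict deformations of `X` over
`A` up to isomorphism to deformations of `X` over `A` up to equivalence is bijective.
(2) If `X` is given by a diagram of ordinary commutative algebras, then placing a classical
deformation in degree zero gives a strict deformation, and this induces a bijection from classical
deformations up to isomorphism to strict deformations up to isomorphism. -/
theorem lemma5p2 {K : Type u} [Field K] [CharZero K]
    {C : Type v} [Category.{w} C] (hC : IsDirectReedy C)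
    (A : Type u) [CommRing A] [Algebra K A] [IsLocalRing A] [IsArtinianRing A] (ε : A →ₐ[K] K) :
    (∀ X : C ⥤ CDGA K, (∀ a : C, (X.obj a).ConcentratedInDegreeZero) →
      Function.Bijective (strictDefToDef A ε X)) ∧
    (∀ X : C ⥤ CommAlgCat.{u} K,
      ∃ φ : ClassicalDefClasses A ε X → StrictDefClasses A ε (X ⋙ CDGA.inclusion K),
        Function.Bijective φ ∧
        ∀ (S : DiagramSquare (CommAlgCat.ofHom ε) (CommAlgCat.unitTrans X))
          (hS : S.IsDeformation (CommAlgCat.flatHoms K)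
            (MorphismProperty.isomorphisms (CommAlgCat.{u} K))),
          ∃ hS' : S.toCDGA.IsDeformation (flatMorphisms (CDGA K))
              (MorphismProperty.isomorphisms (CDGA K)),
            φ (DeformationClasses.mk _ _ S hS) = DeformationClasses.mk _ _ S.toCDGA hS') := by
  refine ⟨fun X hX => ?_, fun X => ?_⟩
  · have := fun a => CDGA.isIso_unit_app (hX a)
    -- The inverse is truncation. It is well defined because weak equivalences become isomorphisms
    -- on `H⁰`.
    let ψ : DefClasses A ε X → StrictDefClasses A ε X :=
      Quot.map (fun S => ⟨S.1.truncation (CDGA.cohomologyZeroAdjunction K).unit,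
        DiagramSquare.IsDeformation.truncation hX S.2⟩)
        fun S T h => h.truncation _ fun _ _ f hf => by
          have := CDGA.isIso_cohomologyZeroFunctor_map f hf
          exact inferInstanceAs (IsIso ((CDGA.inclusion K).map _))
    refine Function.bijective_iff_has_inverse.2 ⟨ψ, ?_, ?_⟩
    -- A strict deformation lies in degree zero, so the unit to its truncation is an isomorphism.
    · rintro ⟨S, hS⟩
      exact Eq.symm (Quot.sound (S.rel_truncation _ fun a =>
        CDGA.isIso_unit_app (DiagramSquare.IsDeformation.concentratedInDegreeZero hX hS a)))
    -- A general deformation is acyclic in negative degrees, so the unit to its truncation is one of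
    -- the weak equivalences generating the relation.
    · rintro ⟨S, hS⟩
      exact Eq.symm (Quot.sound (S.rel_truncation _ fun a =>
        CDGA.weakEquivalences_unit_app (DiagramSquare.IsDeformation.negAcyclic hX hS a)))
  · refine ⟨Quot.map (fun S => ⟨S.1.toCDGA, S.2.toCDGA⟩) fun S T h => h.toCDGA,
      Function.bijective_iff_has_inverse.2
        ⟨Quot.map (fun S => ⟨S.1.cohomologyZero, S.2.cohomologyZero⟩) fun S T h =>
          h.reflection _ _ fun _ _ f hf => ?_, ?_, ?_⟩, fun S hS => ⟨hS.toCDGA, rfl⟩⟩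
    · have : IsIso f := hf
      exact inferInstanceAs (IsIso ((CDGA.cohomologyZeroFunctor K).map f))
    · rintro ⟨S, hS⟩
      exact Quot.sound S.rel_cohomologyZero_toCDGA
    · rintro ⟨S, hS⟩
      exact Eq.symm (Quot.sound (DiagramSquare.rel_toCDGA_cohomologyZero hS))
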